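/- An instance of the lower-bounded min-sum-of-radii problem (LB$k$SR) consists of a finite set $\mathcal F$ of facilities and a finite set $\mathcal D$ of clients located in a common (pseudo)metric space with real distances $c$, lower bounds $L_i\in\mathbb Z_{\ge 0}$ for $i\in\mathcal F$, and a bound $k\in\mathbb Z_{\ge 0}$. A feasible solution is a pair $(S,\sigma)$ with $S\subseteq\mathcal F$, $|S|\le k$, $\sigma:\mathcal D\to S$, and $|\sigma^{-1}(i)|\ge L_i$ for all $i\in S$. Its cost is $\sum_{i\in S}\max_{j\in\sigma^{-1}(i)}c(i,j)$, where the maximum over an empty set is $0$. Let $O^*$ denote the minimum cost of a feasible solution, and let $n=\max\{2,|\mathcal F|+|\mathcal D|\}$. Theorem. There are an absolute constant $C$ and an algorithm that takes as input a real number $\epsilon>0$ and an LB$k$SR instance, halts after at most $n^{C\lceil 1/\epsilon\rceil}$ steps, and, whenever the instance has a feasible solution, outputs a feasible solution $(S,\sigma)$ of cost at most $(3.83+C\epsilon)\,O^*$. In particular, for every $\epsilon>0$ there is a $(3.83+O(\epsilon))$-approximation algorithm for LB$k$SR with running time $n^{O(1/\epsilon)}$ (as $\epsilon\to 0$). Here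 an algorithm is a program for a random-access machine with natural-number and real-number memory and the following operations, each counted as one step: reading and writing memory cells at computed addresses; addition, truncated subtraction and comparison of natural numbers; addition, subtraction and comparison of real numbers; conversion of a natural number to a real number; multiplication and division of a real number by a natural number; and Boolean connectives and branching. -/

import Mathlib

noncomputable section

namespace LBkSR

/-! ### The problem -/

/-- An instance of lower-bounded min-sum-of-radii: facilities `Fin nF` and clients `Fin nD`, located
in a common (pseudo)metric space with distances `c`, lower bounds `L i`, and a bound `k` on the
number of open facilities. Distinct indices may be at distance `0`, so a point can be both
a facility and a client. -/
structure Inst where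
  nF : ℕ
  nD : ℕ
  c : Fin nF ⊕ Fin nD → Fin nF ⊕ Fin nD → ℝ
  c_nonneg : ∀ p q, 0 ≤ c p q
  c_self : ∀ p, c p p = 0
  c_symm : ∀ p q, c p q = c q p
  c_triangle : ∀ p q r, c p r ≤ c p q + c q r
  L : Fin nF → ℕ
  k : ℕ

namespace Inst

variable (I : Inst)

/-- The size parameter `n = |F| + |D|`. -/
def n : ℕ := I.nF + I.nD

/-- The distance from a facility to a client. -/
def d (i : Fin I.nF) (j : Fin I.nD) : ℝ := I.c (Sum.inl i) (Sum.inr j)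

/-- `(S, σ)` is feasible: at most `k` open facilities, every client is assigned to an open facility
(no outliers), and every open facility `i` receives at least `L i` clients. -/
structure Feasible (S : Finset (Fin I.nF)) (σ : Fin I.nD → Fin I.nF) : Prop where
  card_le : S.card ≤ I.k
  mem : ∀ j, σ j ∈ S
  lower : ∀ i ∈ S, I.L i ≤ (Finset.univ.filter fun j => σ j = i).card

/-- The radius of facility `i`: the largest distance to a client assigned to it
(`0` if there is none). -/
def radius (σ : Fin I.nD → Fin I.nF) (i : Fin I.nF) : ℝ :=
  ⨆ j : {j : Fin I.nD // σ j = i}, I.d i j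

/-- The sum of the radii of the open facilities. -/
def cost (S : Finset (Fin I.nF)) (σ : Fin I.nD → Fin I.nF) : ℝ :=
  ∑ i ∈ S, I.radius σ i

/-- The instance has a feasible solution. -/
def IsFeasible : Prop := ∃ S σ, I.Feasible S σ

/-- The optimal cost (meaningful for feasible instances, where the infimum is over a finite
nonempty set). -/
def opt : ℝ := sInf {x | ∃ S σ, I.Feasible S σ ∧ x = I.cost S σ}

end Inst

/-! ### The machine model

Imperative programs over a random-access memory which consists of (two-dimensional) arrays of natural
numbers and of real numbers, named by natural numbers; a program mentions only finitely many arrays,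
and a scalar variable is an entry of an array. Arrays are indexed by computed natural numbers. Every
operation, memory access and test has unit cost.

The arithmetic is deliberately restricted: naturals can only be added, subtracted and compared, and
reals can only be added, subtracted, compared, and multiplied or divided by naturals. There is no
multiplication of naturals, no product or quotient of reals, no rounding, and no real constant other
than naturals. Hence on rational inputs the bit lengths of all numbers that occur stay polynomial in
the number of steps and the bit length of the input, so that unit cost is polynomially related to
bit cost. -/

/-- The memory: `nat x a b` is the entry `(a, b)` of the array of naturals named `x`,
and likewise for `real`. -/
@[ext]
structure Mem where
  nat : ℕ → ℕ → ℕ → ℕ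
  real : ℕ → ℕ → ℕ → ℝ

/-- Expressions for naturals (`sub` is truncated). -/
inductive NatExp where
  | const (v : ℕ)
  | get (x : ℕ) (a b : NatExp)
  | add (e f : NatExp)
  | sub (e f : NatExp)

/-- Expressions for reals. -/
inductive RealExp where
  | ofNat (e : NatExp)
  | get (x : ℕ) (a b : NatExp)
  | add (e f : RealExp)
  | sub (e f : RealExp)
  | mulNat (e : RealExp) (m : NatExp)
  | divNat (e : RealExp) (m : NatExp)

/-- Tests. -/
inductive Test where
  | natLe (e f : NatExp)
  | realLe (e f : RealExp)
  | not (t : Test)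
  | and (t u : Test)

/-- Programs. -/
inductive Prog where
  | skip
  | natSet (x : ℕ) (a b e : NatExp)
  | realSet (x : ℕ) (a b : NatExp) (e : RealExp)
  | seq (p q : Prog)
  | ite (t : Test) (p q : Prog)
  | while (t : Test) (p : Prog)

namespace NatExp

def eval (s : Mem) : NatExp → ℕ
  | const v => v
  | get x a b => s.nat x (a.eval s) (b.eval s)
  | add e f => e.eval s + f.eval s
  | sub e f => e.eval s - f.eval s

/-- The number of operations needed to evaluate the expression. -/
def size : NatExp → ℕ
  | const _ => 1
  | get _ a b => 1 + a.size + b.size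
  | add e f => 1 + e.size + f.size
  | sub e f => 1 + e.size + f.size

end NatExp

namespace RealExp

def eval (s : Mem) : RealExp → ℝ
  | ofNat e => (e.eval s : ℝ)
  | get x a b => s.real x (a.eval s) (b.eval s)
  | add e f => e.eval s + f.eval s
  | sub e f => e.eval s - f.eval s
  | mulNat e m => e.eval s * (m.eval s : ℝ)
  | divNat e m => e.eval s / (m.eval s : ℝ)

/-- The number of operations needed to evaluate the expression. -/
def size : RealExp → ℕ
  | ofNat e => 1 + e.size
  | get _ a b => 1 + a.size + b.size
  | add e f => 1 + e.size + f.size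
  | sub e f => 1 + e.size + f.size
  | mulNat e m => 1 + e.size + m.size
  | divNat e m => 1 + e.size + m.size

end RealExp

namespace Test

def eval (s : Mem) : Test → Prop
  | natLe e f => e.eval s ≤ f.eval s
  | realLe e f => e.eval s ≤ f.eval s
  | not t => ¬ t.eval s
  | and t u => t.eval s ∧ u.eval s

/-- The number of operations needed to evaluate the test. -/
def size : Test → ℕ
  | natLe e f => 1 + e.size + f.size
  | realLe e f => 1 + e.size + f.size
  | not t => 1 + t.size
  | and t u => 1 + t.size + u.size

end Test

namespace Mem

/-- Overwrite the entry `(a, b)` of the array of naturals `x`. -/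
def setNat (s : Mem) (x a b v : ℕ) : Mem where
  nat := fun y a' b' => if y = x ∧ a' = a ∧ b' = b then v else s.nat y a' b'
  real := s.real

/-- Overwrite the entry `(a, b)` of the array of reals `x`. -/
def setReal (s : Mem) (x a b : ℕ) (v : ℝ) : Mem where
  nat := s.nat
  real := fun y a' b' => if y = x ∧ a' = a ∧ b' = b then v else s.real y a' b'

end Mem

/-- `Runs p s t s'`: the program `p`, started in memory `s`, halts in memory `s'` after exactly
`t` steps. -/
inductive Runs : Prog → Mem → ℕ → Mem → Prop where
  | skip (s : Mem) : Runs Prog.skip s 1 s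
  | natSet (s : Mem) (x : ℕ) (a b e : NatExp) :
      Runs (Prog.natSet x a b e) s (1 + a.size + b.size + e.size)
        (s.setNat x (a.eval s) (b.eval s) (e.eval s))
  | realSet (s : Mem) (x : ℕ) (a b : NatExp) (e : RealExp) :
      Runs (Prog.realSet x a b e) s (1 + a.size + b.size + e.size)
        (s.setReal x (a.eval s) (b.eval s) (e.eval s))
  | seq {p q : Prog} {s s' s'' : Mem} {t t' : ℕ} (hp : Runs p s t s') (hq : Runs q s' t' s'') :
      Runs (Prog.seq p q) s (t + t') s''
  | ite_true {b : Test} {p q : Prog} {s s' : Mem} {t : ℕ} (hb : b.eval s) (hp : Runs p s t s') :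
      Runs (Prog.ite b p q) s (b.size + t) s'
  | ite_false {b : Test} {p q : Prog} {s s' : Mem} {t : ℕ} (hb : ¬ b.eval s) (hq : Runs q s t s') :
      Runs (Prog.ite b p q) s (b.size + t) s'
  | while_false {b : Test} {p : Prog} {s : Mem} (hb : ¬ b.eval s) :
      Runs (Prog.while b p) s b.size s
  | while_true {b : Test} {p : Prog} {s s' s'' : Mem} {t t' : ℕ} (hb : b.eval s)
      (hp : Runs p s t s') (hw : Runs (Prog.while b p) s' t' s'') :
      Runs (Prog.while b p) s (b.size + t + t') s''

/-! ### Input and output -/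

/-- The initial memory on the parameter `ε` and the instance `I`. Naturals: arrays `0`, `1`, `2` hold
`|F|`, `|D|`, `k` in entry `(0, 0)`, and array `3` holds `L i` in entry `(i, 0)`. Reals: array `0`
holds `ε` in entry `(0, 0)`, and arrays `1`, `2`, `3` hold the facility-client, facility-facility and
client-client distances. All other entries are `0`. -/
def input (ε : ℝ) (I : Inst) : Mem where
  nat := fun x a b =>
    if x = 0 ∧ a = 0 ∧ b = 0 then I.nF
    else if x = 1 ∧ a = 0 ∧ b = 0 then I.nD
    else if x = 2 ∧ a = 0 ∧ b = 0 then I.k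
    else if h : a < I.nF then (if x = 3 ∧ b = 0 then I.L ⟨a, h⟩ else 0)
    else 0
  real := fun x a b =>
    if x = 0 ∧ a = 0 ∧ b = 0 then ε
    else if x = 1 then
      (if h : a < I.nF ∧ b < I.nD then I.c (Sum.inl ⟨a, h.1⟩) (Sum.inr ⟨b, h.2⟩) else 0)
    else if x = 2 then
      (if h : a < I.nF ∧ b < I.nF then I.c (Sum.inl ⟨a, h.1⟩) (Sum.inl ⟨b, h.2⟩) else 0)
    else if x = 3 then
      (if h : a < I.nD ∧ b < I.nD then I.c (Sum.inr ⟨a, h.1⟩) (Sum.inr ⟨b, h.2⟩) else 0)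
    else 0

/-- The memory `s` holds the solution `(S, σ)`: entry `(i, 0)` of the array of naturals `4` is `1`
exactly if `i ∈ S`, and entry `(j, 0)` of the array of naturals `5` is the index of `σ j`. -/
def Outputs (I : Inst) (s : Mem) (S : Finset (Fin I.nF)) (σ : Fin I.nD → Fin I.nF) : Prop :=
  (∀ i : Fin I.nF, i ∈ S ↔ s.nat 4 i 0 = 1) ∧ (∀ j : Fin I.nD, s.nat 5 j 0 = σ j)

end LBkSR

end

namespace LBkSR

/-! A solution is viewed as a family of balls, a ball being a facility together with a client on its
boundary; a ball is allowed if it holds at least as many clients as the lower bound of its facility.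
Let `P` be the balls of an optimal solution, `X` its `⌈1/ε⌉` largest ones and `R` the largest
remaining radius. Then `R ≤ ε * opt`. The algorithm tries all `X` and all `R`; the rest concerns one
correct guess.

From components to solutions. A family of balls links clients that share a ball. If a covering
family of allowed balls, guessed ones included, leaves at most `k` components, one center per
component, taken from a ball of that component, serves all its clients: the ball of the center lies
inside the component, so the lower bound holds (`feasible_of_centers`). The best such center of a
component costs at most `3.83` times the largest weight of a packing of its balls. This is a
statement about connected graphs with radii on the vertices (`exists_center`, transferred by
`exists_packing_centers`). It remains to find a family with at most `k` components all of whose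
packings are cheap.

Cheap packings by duality. Take a multiplier `lam ≥ 0` and dual variables `α ≥ 0`, zero on the
clients covered by `X`, such that the sum of `α` over each allowed ball of radius at most `R` is at
most its radius plus `lam`. A packing `S` of tight balls weighs at most `∑ α - |S| * lam`
(`sum_rad_packing_le`), while weak duality against `P \ X` bounds `∑ α` by its weight plus `|P \ X|
* lam` (`sum_dual_le`). If the tight balls together with `X` leave more than `k` components, a
maximal packing of tight balls has at least `k - |X|` members, and the multiples of `lam` cancel in
the right direction (`sum_rad_le_of_lt_numComp`).

The multiplier grows from `0` to `(|F| + 1) * R` in steps of `R / |D|`, and after each step `α` is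
raised greedily. At multiplier `0` every packing is cheap whatever the number of components
(`Guess.sum_rad_le`); at the last multiplier there are at most `k` components (`Guess.numComp_le`).
So either the first family already works, or the number of components drops to `k` within some
round. In that round the newly tight balls are added one by one to the old family, until a single
ball `b` brings the number down. The old balls have slack at most `R / |D|`, which costs `R` over a
whole packing, and `b` costs another `R`. Hence all packings weigh at most `∑ rad P + 2 * R`
(`Guess.sum_rad_le_add`), and the solution costs at most `3.83 * (1 + 2 * ε) * opt`.

Running time. `Ends M a` is total correctness within `(M + 2) ^ a` steps, so time analysis is
bookkeeping of exponents. Only the enumeration of guesses, encoded as numbers with `2 * ⌈1/ε⌉`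
digits, and the arithmetic on these codes make the exponent depend on `ε`. -/

/-! ### A program logic with running times and frames -/

/-- The arrays of naturals that a program may write. -/
def Prog.wN : Prog → List ℕ
  | .skip => []
  | .natSet x _ _ _ => [x]
  | .realSet _ _ _ _ => []
  | .seq p q => p.wN ++ q.wN
  | .ite _ p q => p.wN ++ q.wN
  | .while _ p => p.wN

/-- The arrays of reals that a program may write. -/
def Prog.wR : Prog → List ℕ
  | .skip => []
  | .natSet _ _ _ _ => []
  | .realSet x _ _ _ => [x]
  | .seq p q => p.wR ++ q.wR
  | .ite _ p q => p.wR ++ q.wR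
  | .while _ p => p.wR

/-- Two memories agree outside the listed arrays. -/
structure Agree (wn wr : List ℕ) (s s' : Mem) : Prop where
  nat : ∀ x, x ∉ wn → s'.nat x = s.nat x
  real : ∀ x, x ∉ wr → s'.real x = s.real x

theorem Agree.refl (wn wr : List ℕ) (s : Mem) : Agree wn wr s s := ⟨fun _ _ => rfl, fun _ _ => rfl⟩

theorem Agree.trans {wn wr : List ℕ} {s s' s'' : Mem} (h : Agree wn wr s s')
    (h' : Agree wn wr s' s'') : Agree wn wr s s'' :=
  ⟨fun x hx => (h'.nat x hx).trans (h.nat x hx), fun x hx => (h'.real x hx).trans (h.real x hx)⟩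

theorem Agree.mono {wn wr wn' wr' : List ℕ} {s s' : Mem} (h : Agree wn wr s s')
    (hn : wn ⊆ wn') (hr : wr ⊆ wr') : Agree wn' wr' s s' :=
  ⟨fun x hx => h.nat x fun h => hx (hn h), fun x hx => h.real x fun h => hx (hr h)⟩

/-- The frame rule. The written arrays are read off the syntax, so the preservation of an array by a
concrete program is settled by `decide`. -/
theorem Runs.agree {p : Prog} {s s' : Mem} {t : ℕ} (h : Runs p s t s') : Agree p.wN p.wR s s' := by
  induction h with
  | skip s => exact Agree.refl _ _ _
  | natSet s x a b e =>
    refine ⟨fun y hy => ?_, fun y _ => rfl⟩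
    simp only [Prog.wN, List.mem_singleton] at hy
    funext a b
    simp [Mem.setNat, hy]
  | realSet s x a b e =>
    refine ⟨fun y _ => rfl, fun y hy => ?_⟩
    simp only [Prog.wR, List.mem_singleton] at hy
    funext a b
    simp [Mem.setReal, hy]
  | seq _ _ hp hq =>
    exact (hp.mono (by simp [Prog.wN]) (by simp [Prog.wR])).trans
      (hq.mono (by simp [Prog.wN]) (by simp [Prog.wR]))
  | ite_true _ _ hp => exact hp.mono (by simp [Prog.wN]) (by simp [Prog.wR])
  | ite_false _ _ hp => exact hp.mono (by simp [Prog.wN]) (by simp [Prog.wR])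
  | while_false _ => exact Agree.refl _ _ _
  | while_true _ _ _ hp hw => exact Agree.trans hp hw

@[simp] theorem Mem.setNat_nat_ne (s : Mem) {x y : ℕ} (a b v : ℕ) (h : y ≠ x) :
    (s.setNat x a b v).nat y = s.nat y := by
  funext a' b'; simp [Mem.setNat, h]

theorem Mem.setNat_nat_eq (s : Mem) (x a b v a' b' : ℕ) :
    (s.setNat x a b v).nat x a' b' = if a' = a ∧ b' = b then v else s.nat x a' b' := by
  simp [Mem.setNat]

@[simp] theorem Mem.setNat_nat_self (s : Mem) (x a b v : ℕ) :
    (s.setNat x a b v).nat x a b = v := by simp [Mem.setNat]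

@[simp] theorem Mem.setNat_real (s : Mem) (x a b v : ℕ) : (s.setNat x a b v).real = s.real := rfl

@[simp] theorem Mem.setReal_real_ne (s : Mem) {x y : ℕ} (a b : ℕ) (v : ℝ) (h : y ≠ x) :
    (s.setReal x a b v).real y = s.real y := by
  funext a' b'; simp [Mem.setReal, h]

theorem Mem.setReal_real_eq (s : Mem) (x a b : ℕ) (v : ℝ) (a' b' : ℕ) :
    (s.setReal x a b v).real x a' b' = if a' = a ∧ b' = b then v else s.real x a' b' := by
  simp [Mem.setReal]

@[simp] theorem Mem.setReal_real_self (s : Mem) (x a b : ℕ) (v : ℝ) :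
    (s.setReal x a b v).real x a b = v := by simp [Mem.setReal]

@[simp] theorem Mem.setReal_nat (s : Mem) (x a b : ℕ) (v : ℝ) : (s.setReal x a b v).nat = s.nat :=
  rfl

/-! ### Total correctness with a time bound. -/

/-- `p`, started in `s`, halts within `(M + 2) ^ a` steps in a memory with property `Q`. -/
def Ends (M a : ℕ) (p : Prog) (s : Mem) (Q : Mem → Prop) : Prop :=
  ∃ t s', Runs p s t s' ∧ t ≤ (M + 2) ^ a ∧ Q s'

theorem Ends.mono {M a b : ℕ} {p : Prog} {s : Mem} {Q Q' : Mem → Prop} (h : Ends M a p s Q)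
    (hab : a ≤ b) (hQ : ∀ s', Agree p.wN p.wR s s' → Q s' → Q' s') : Ends M b p s Q' := by
  obtain ⟨t, s', hr, ht, hq⟩ := h
  exact ⟨t, s', hr, ht.trans (Nat.pow_le_pow_right (by omega) hab), hQ s' hr.agree hq⟩

theorem Ends.exp {M a b : ℕ} {p : Prog} {s : Mem} {Q : Mem → Prop} (h : Ends M a p s Q)
    (hab : a ≤ b) : Ends M b p s Q := h.mono hab fun _ _ h => h

theorem Ends.imp {M a : ℕ} {p : Prog} {s : Mem} {Q Q' : Mem → Prop} (h : Ends M a p s Q)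
    (hQ : ∀ s', Agree p.wN p.wR s s' → Q s' → Q' s') : Ends M a p s Q' := h.mono le_rfl hQ

/-- The base is at least two, so running two programs in sequence raises the exponent by only one.
-/
theorem pow_add_pow_le (M a : ℕ) : (M + 2) ^ a + (M + 2) ^ a ≤ (M + 2) ^ (a + 1) := by
  rw [pow_succ, mul_add, mul_two]
  exact Nat.le_add_left _ _

/-- Single assignments and tests of size at most `64 = 2 ^ 6` fit under exponent `6`; this is the
source of the side conditions `6 ≤ a` below. -/
theorem le_pow_of_le_sixtyFour {M a n : ℕ} (ha : 6 ≤ a) (hn : n ≤ 64) : n ≤ (M + 2) ^ a :=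
  hn.trans ((Nat.pow_le_pow_left (show 2 ≤ M + 2 by omega) 6).trans
    (Nat.pow_le_pow_right (by omega) ha))

theorem Ends.skip {M a : ℕ} {s : Mem} {Q : Mem → Prop} (h : Q s) : Ends M a .skip s Q :=
  ⟨1, s, .skip s, Nat.one_le_pow _ _ (by omega), h⟩

theorem Ends.natSet {M c x : ℕ} {a b e : NatExp} {s : Mem} {Q : Mem → Prop}
    (h : Q (s.setNat x (a.eval s) (b.eval s) (e.eval s)))
    (hs : 1 + a.size + b.size + e.size ≤ 64 := by decide) (hc : 6 ≤ c := by omega) :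
    Ends M c (.natSet x a b e) s Q :=
  ⟨_, _, .natSet s x a b e, le_pow_of_le_sixtyFour hc hs, h⟩

theorem Ends.realSet {M c x : ℕ} {a b : NatExp} {e : RealExp} {s : Mem} {Q : Mem → Prop}
    (h : Q (s.setReal x (a.eval s) (b.eval s) (e.eval s)))
    (hs : 1 + a.size + b.size + e.size ≤ 64 := by decide) (hc : 6 ≤ c := by omega) :
    Ends M c (.realSet x a b e) s Q :=
  ⟨_, _, .realSet s x a b e, le_pow_of_le_sixtyFour hc hs, h⟩

theorem Ends.seq {M c : ℕ} {p q : Prog} {s : Mem} {Q Q' : Mem → Prop} (hp : Ends M c p s Q)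
    (hq : ∀ s', Agree p.wN p.wR s s' → Q s' → Ends M c q s' Q') : Ends M (c + 1) (.seq p q) s Q' := by
  obtain ⟨t, s', hr, ht, hQ⟩ := hp
  obtain ⟨t', s'', hr', ht', hQ'⟩ := hq s' hr.agree hQ
  exact ⟨t + t', s'', hr.seq hr', (Nat.add_le_add ht ht').trans (pow_add_pow_le M c), hQ'⟩

theorem Ends.natSet_seq {M c x : ℕ} {a b e : NatExp} {q : Prog} {s : Mem} {Q : Mem → Prop}
    (h : Ends M c q (s.setNat x (a.eval s) (b.eval s) (e.eval s)) Q)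
    (hs : 1 + a.size + b.size + e.size ≤ 64 := by decide) (hc : 6 ≤ c := by omega) :
    Ends M (c + 1) (.seq (.natSet x a b e) q) s Q :=
  Ends.seq (Q := fun s' => s' = s.setNat x (a.eval s) (b.eval s) (e.eval s))
    (Ends.natSet rfl hs hc) (by rintro _ _ rfl; exact h)

theorem Ends.realSet_seq {M c x : ℕ} {a b : NatExp} {e : RealExp} {q : Prog} {s : Mem}
    {Q : Mem → Prop} (h : Ends M c q (s.setReal x (a.eval s) (b.eval s) (e.eval s)) Q)
    (hs : 1 + a.size + b.size + e.size ≤ 64 := by decide) (hc : 6 ≤ c := by omega) :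
    Ends M (c + 1) (.seq (.realSet x a b e) q) s Q :=
  Ends.seq (Q := fun s' => s' = s.setReal x (a.eval s) (b.eval s) (e.eval s))
    (Ends.realSet rfl hs hc) (by rintro _ _ rfl; exact h)

theorem Ends.ite {M c : ℕ} {b : Test} {p q : Prog} {s : Mem} {Q : Mem → Prop}
    (hp : b.eval s → Ends M c p s Q) (hq : ¬ b.eval s → Ends M c q s Q)
    (hs : b.size ≤ 64 := by decide) (hc : 6 ≤ c := by omega) : Ends M (c + 1) (.ite b p q) s Q := by
  by_cases hb : b.eval s
  · obtain ⟨t, s', hr, ht, hQ⟩ := hp hb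
    exact ⟨_, s', .ite_true hb hr, (Nat.add_le_add (le_pow_of_le_sixtyFour hc hs) ht).trans
      (pow_add_pow_le M c), hQ⟩
  · obtain ⟨t, s', hr, ht, hQ⟩ := hq hb
    exact ⟨_, s', .ite_false hb hr, (Nat.add_le_add (le_pow_of_le_sixtyFour hc hs) ht).trans
      (pow_add_pow_le M c), hQ⟩

/-- A loop that is left after at most `N` rounds, where `Inv i` holds before round `i`. -/
theorem Ends.while {M a c N : ℕ} {b : Test} {p : Prog} {s : Mem} {Q : Mem → Prop}
    (Inv : ℕ → Mem → Prop) (hN : N ≤ (M + 2) ^ c) (h0 : Inv 0 s)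
    (hend : ∀ i s', Agree p.wN p.wR s s' → Inv i s' → ¬ b.eval s' → Q s')
    (hlt : ∀ i s', Agree p.wN p.wR s s' → Inv i s' → b.eval s' → i < N)
    (hp : ∀ i s', Agree p.wN p.wR s s' → Inv i s' → b.eval s' → Ends M a p s' (Inv (i + 1)))
    (hs : b.size ≤ 64 := by decide) (ha : 6 ≤ a := by omega) :
    Ends M (a + c + 2) (.while b p) s Q := by
  -- Induction on the number `n` of rounds still allowed. Test and body of one round together cost
  -- at most `(M + 2) ^ (a + 1)`; the extra `(M + 2) ^ a` pays for the final failing test.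
  have key : ∀ n i s', i + n = N → Agree p.wN p.wR s s' → Inv i s' →
      ∃ t s'', Runs (.while b p) s' t s'' ∧ t ≤ n * (M + 2) ^ (a + 1) + (M + 2) ^ a ∧ Q s'' := by
    intro n
    induction n with
    | zero =>
      intro i s' hi hag hinv
      by_cases hb : b.eval s'
      · exact absurd (hlt i s' hag hinv hb) (by omega)
      · exact ⟨_, s', .while_false hb,
          (le_pow_of_le_sixtyFour ha hs).trans (Nat.le_add_left _ _), hend i s' hag hinv hb⟩
    | succ n ih =>
      intro i s' hi hag hinv
      by_cases hb : b.eval s'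
      · obtain ⟨t, s₁, hr, ht, hI⟩ := hp i s' hag hinv hb
        obtain ⟨t', s₂, hr', ht', hQ⟩ := ih (i + 1) s₁ (by omega) (hag.trans hr.agree) hI
        refine ⟨_, s₂, .while_true hb hr hr', ?_, hQ⟩
        have h1 := le_pow_of_le_sixtyFour (M := M) ha hs
        have h2 := pow_add_pow_le M a
        rw [Nat.succ_mul]
        omega
      · exact ⟨_, s', .while_false hb,
          (le_pow_of_le_sixtyFour ha hs).trans (Nat.le_add_left _ _), hend i s' hag hinv hb⟩
  obtain ⟨t, s', hr, ht, hQ⟩ := key N 0 s (by omega) (Agree.refl _ _ _) h0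
  refine ⟨t, s', hr, ht.trans ?_, hQ⟩
  calc N * (M + 2) ^ (a + 1) + (M + 2) ^ a
      ≤ (M + 2) ^ c * (M + 2) ^ (a + 1) + (M + 2) ^ (a + 1 + c) :=
        Nat.add_le_add (Nat.mul_le_mul_right _ hN) (Nat.pow_le_pow_right (by omega) (by omega))
    _ = (M + 2) ^ (a + 1 + c) + (M + 2) ^ (a + 1 + c) := by rw [← pow_add, add_comm c]
    _ ≤ (M + 2) ^ (a + 1 + c + 1) := pow_add_pow_le M _
    _ = (M + 2) ^ (a + c + 2) := by congr 1; omega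

/-! ### Scalar variables and counting loops. -/

/-- The scalar variable stored in entry `(0, 0)` of the array `x` of naturals. -/
def var (x : ℕ) : NatExp := .get x (.const 0) (.const 0)

/-- The scalar variable stored in entry `(0, 0)` of the array `x` of reals. -/
def rvar (x : ℕ) : RealExp := .get x (.const 0) (.const 0)

/-- Assignment to a scalar variable. -/
def setV (x : ℕ) (e : NatExp) : Prog := .natSet x (.const 0) (.const 0) e

/-- Assignment to a real scalar variable. -/
def setR (x : ℕ) (e : RealExp) : Prog := .realSet x (.const 0) (.const 0) e

@[simp] theorem var_eval (x : ℕ) (s : Mem) : (var x).eval s = s.nat x 0 0 := rfl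
@[simp] theorem rvar_eval (x : ℕ) (s : Mem) : (rvar x).eval s = s.real x 0 0 := rfl
@[simp] theorem const_eval (v : ℕ) (s : Mem) : (NatExp.const v).eval s = v := rfl
@[simp] theorem get_eval (x : ℕ) (a b : NatExp) (s : Mem) :
    (NatExp.get x a b).eval s = s.nat x (a.eval s) (b.eval s) := rfl
@[simp] theorem add_eval (a b : NatExp) (s : Mem) :
    (NatExp.add a b).eval s = a.eval s + b.eval s := rfl
@[simp] theorem sub_eval (a b : NatExp) (s : Mem) :
    (NatExp.sub a b).eval s = a.eval s - b.eval s := rfl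
@[simp] theorem rget_eval (x : ℕ) (a b : NatExp) (s : Mem) :
    (RealExp.get x a b).eval s = s.real x (a.eval s) (b.eval s) := rfl
@[simp] theorem rofNat_eval (a : NatExp) (s : Mem) : (RealExp.ofNat a).eval s = a.eval s := rfl
@[simp] theorem radd_eval (a b : RealExp) (s : Mem) :
    (RealExp.add a b).eval s = a.eval s + b.eval s := rfl
@[simp] theorem rsub_eval (a b : RealExp) (s : Mem) :
    (RealExp.sub a b).eval s = a.eval s - b.eval s := rfl
@[simp] theorem rmul_eval (a : RealExp) (b : NatExp) (s : Mem) :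
    (RealExp.mulNat a b).eval s = a.eval s * (b.eval s : ℝ) := rfl
@[simp] theorem rdiv_eval (a : RealExp) (b : NatExp) (s : Mem) :
    (RealExp.divNat a b).eval s = a.eval s / (b.eval s : ℝ) := rfl
@[simp] theorem natLe_eval (a b : NatExp) (s : Mem) :
    (Test.natLe a b).eval s ↔ a.eval s ≤ b.eval s := Iff.rfl
@[simp] theorem realLe_eval (a b : RealExp) (s : Mem) :
    (Test.realLe a b).eval s ↔ a.eval s ≤ b.eval s := Iff.rfl
@[simp] theorem not_eval (t : Test) (s : Mem) : (Test.not t).eval s ↔ ¬ t.eval s := Iff.rfl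
@[simp] theorem and_eval (t u : Test) (s : Mem) :
    (Test.and t u).eval s ↔ t.eval s ∧ u.eval s := Iff.rfl

/-- The test `e = f`. -/
def natEq (e f : NatExp) : Test := .and (.natLe e f) (.natLe f e)

@[simp] theorem natEq_eval (a b : NatExp) (s : Mem) :
    (natEq a b).eval s ↔ a.eval s = b.eval s := by
  simp [natEq, le_antisymm_iff]

/-- The loop `for x = 0, …, e - 1 do p`. -/
def forN (x : ℕ) (e : NatExp) (p : Prog) : Prog :=
  .seq (setV x (.const 0))
    (.while (.not (.natLe e (var x))) (.seq p (setV x (.add (var x) (.const 1)))))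

/-- The bound `e` is re-evaluated before every round, hence `he` asks for its value in all memories
the loop can reach. The body must not write the counter, and `hInv` makes the invariant insensitive
to it. Incrementing the counter, looping and initialising account for `1 + 2 + 1` in the exponent.
-/
theorem Ends.forN {M a c x N : ℕ} {e : NatExp} {p : Prog} {s : Mem} {Q : Mem → Prop}
    (Inv : ℕ → Mem → Prop) (hN : N ≤ (M + 2) ^ c)
    (he : ∀ s', Agree (forN x e p).wN (forN x e p).wR s s' → e.eval s' = N)
    (h0 : Inv 0 s)
    (hb : ∀ i, i < N → ∀ s', Agree (LBkSR.forN x e p).wN (LBkSR.forN x e p).wR s s' →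
      s'.nat x 0 0 = i → Inv i s' → Ends M a p s' (Inv (i + 1)))
    (hQ : ∀ s', Agree (LBkSR.forN x e p).wN (LBkSR.forN x e p).wR s s' → Inv N s' → Q s')
    (hInv : ∀ i s' v, Inv i s' → Inv i (s'.setNat x 0 0 v) := by exact fun _ _ _ h => h)
    (hx : x ∉ p.wN := by decide)
    (hes : e.size ≤ 16 := by decide) (ha : 6 ≤ a := by omega) :
    Ends M (a + c + 4) (LBkSR.forN x e p) s Q := by
  have hag0 : Agree (LBkSR.forN x e p).wN (LBkSR.forN x e p).wR s (s.setNat x 0 0 0) :=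
    (Runs.natSet s x (.const 0) (.const 0) (.const 0)).agree.mono
      (by simp [LBkSR.forN, setV, Prog.wN]) (by simp [LBkSR.forN, setV, Prog.wR])
  have hsub : ∀ {s' : Mem}, Agree (Prog.seq p (setV x (.add (var x) (.const 1)))).wN
      (Prog.seq p (setV x (.add (var x) (.const 1)))).wR (s.setNat x 0 0 0) s' →
      Agree (LBkSR.forN x e p).wN (LBkSR.forN x e p).wR s s' := fun {s'} h =>
    hag0.trans (h.mono (by simp [LBkSR.forN, setV, Prog.wN]) (by simp [LBkSR.forN, setV, Prog.wR]))
  have hw : Ends M (a + 1 + c + 2) (.while (.not (.natLe e (var x)))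
      (.seq p (setV x (.add (var x) (.const 1))))) (s.setNat x 0 0 0) Q := by
    refine Ends.while (N := N) (fun i s' => s'.nat x 0 0 = i ∧ i ≤ N ∧ Inv i s') hN
      ⟨by simp, Nat.zero_le _, hInv _ _ _ h0⟩ ?_ ?_ ?_ ?_ (by omega)
    · rintro i s' hag ⟨hi, hiN, hI⟩ hb
      have he' := he s' (hsub hag)
      simp only [not_eval, natLe_eval, var_eval, not_not, he', hi] at hb
      obtain rfl : i = N := le_antisymm hiN hb
      exact hQ s' (hsub hag) hI
    · rintro i s' hag ⟨hi, hiN, hI⟩ hb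
      have he' := he s' (hsub hag)
      simpa only [not_eval, natLe_eval, var_eval, not_le, he', hi] using hb
    · rintro i s' hag ⟨hi, hiN, hI⟩ hb'
      have he' := he s' (hsub hag)
      simp only [not_eval, natLe_eval, var_eval, not_le, he', hi] at hb'
      refine Ends.seq (hb i hb' s' (hsub hag) hi hI) ?_
      intro s'' hag'' hI''
      have hx' : s''.nat x 0 0 = i := by rw [hag''.nat x hx, hi]
      refine Ends.natSet ?_ (by simp [NatExp.size, var]) ha
      refine ⟨by simp [hx'], hb', hInv _ _ _ hI''⟩
    · simp only [Test.size, var, NatExp.size]; omega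
  have := Ends.natSet_seq (M := M) (x := x) (a := .const 0) (b := .const 0) (e := .const 0) hw
    (by decide) (by omega)
  exact this.exp (by omega)

/-- `Ends.forN` with the set of finished indices as the loop parameter. -/
theorem Ends.forFin {M a x N : ℕ} {e : NatExp} {p : Prog} {s : Mem} {Q : Mem → Prop}
    (Inv : Finset (Fin N) → Mem → Prop) (hN : N ≤ M + 2)
    (he : ∀ s', Agree (LBkSR.forN x e p).wN (LBkSR.forN x e p).wR s s' → e.eval s' = N)
    (h0 : Inv ∅ s)
    (hb : ∀ (i : Fin N) (A : Finset (Fin N)), i ∉ A → ∀ s',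
      Agree (LBkSR.forN x e p).wN (LBkSR.forN x e p).wR s s' →
      s'.nat x 0 0 = i → Inv A s' → Ends M a p s' (Inv (insert i A)))
    (hQ : ∀ s', Agree (LBkSR.forN x e p).wN (LBkSR.forN x e p).wR s s' → Inv Finset.univ s' → Q s')
    (hInv : ∀ i s' v, Inv i s' → Inv i (s'.setNat x 0 0 v) := by exact fun _ _ _ h => h)
    (hx : x ∉ p.wN := by decide)
    (hes : e.size ≤ 16 := by decide) (ha : 6 ≤ a := by omega) :
    Ends M (a + 5) (LBkSR.forN x e p) s Q := by
  refine (Ends.forN (c := 1) (N := N)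
    (fun i s' => Inv (Finset.univ.filter fun j : Fin N => (j : ℕ) < i) s')
    (by simpa using hN) he ?_ ?_ ?_ (fun _ _ _ h => hInv _ _ _ h) hx hes ha)
  · simpa using h0
  · intro i hi s' hag hxi hI
    have : (Finset.univ.filter fun j : Fin N => (j : ℕ) < i + 1) =
        insert ⟨i, hi⟩ (Finset.univ.filter fun j : Fin N => (j : ℕ) < i) := by
      ext j
      simp only [Finset.mem_filter, Finset.mem_univ, true_and, Finset.mem_insert, Fin.ext_iff]
      omega
    rw [this]
    exact hb ⟨i, hi⟩ _ (by simp) s' hag hxi hI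
  · intro s' hag hI
    refine hQ s' hag ?_
    have : (Finset.univ.filter fun j : Fin N => (j : ℕ) < N) = Finset.univ := by
      ext j; simp
    rwa [this] at hI

/-- Two nested loops. -/
def forPairs (x y : ℕ) (e f : NatExp) (p : Prog) : Prog := forN x e (forN y f p)

/-- Nested loops with the set of finished pairs as the loop parameter. -/
theorem Ends.forPairs {M a x y N K : ℕ} {e f : NatExp} {p : Prog} {s : Mem} {Q : Mem → Prop}
    (Inv : Finset (Fin N × Fin K) → Mem → Prop) (hN : N ≤ M + 2) (hK : K ≤ M + 2)
    (he : ∀ s', Agree (forPairs x y e f p).wN (forPairs x y e f p).wR s s' →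
      e.eval s' = N ∧ f.eval s' = K)
    (h0 : Inv ∅ s)
    (hb : ∀ (i : Fin N) (j : Fin K) (A : Finset (Fin N × Fin K)), (i, j) ∉ A → ∀ s',
      Agree (LBkSR.forPairs x y e f p).wN (LBkSR.forPairs x y e f p).wR s s' →
      s'.nat x 0 0 = i → s'.nat y 0 0 = j → Inv A s' → Ends M a p s' (Inv (insert (i, j) A)))
    (hQ : ∀ s', Agree (LBkSR.forPairs x y e f p).wN (LBkSR.forPairs x y e f p).wR s s' →
      Inv Finset.univ s' → Q s')
    (hInvx : ∀ i s' v, Inv i s' → Inv i (s'.setNat x 0 0 v) := by exact fun _ _ _ h => h)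
    (hInvy : ∀ i s' v, Inv i s' → Inv i (s'.setNat y 0 0 v) := by exact fun _ _ _ h => h)
    (hx : x ∉ (LBkSR.forN y f p).wN := by decide) (hy : y ∉ p.wN := by decide)
    (hes : e.size ≤ 16 := by decide) (hfs : f.size ≤ 16 := by decide)
    (ha : 6 ≤ a := by omega) :
    Ends M (a + 10) (LBkSR.forPairs x y e f p) s Q := by
  have hsub : ∀ {s' s'' : Mem}, Agree (LBkSR.forN y f p).wN (LBkSR.forN y f p).wR s' s'' →
      Agree (LBkSR.forPairs x y e f p).wN (LBkSR.forPairs x y e f p).wR s' s'' := fun h =>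
    h.mono (by intro z hz; simp [LBkSR.forPairs, LBkSR.forN, setV, Prog.wN] at hz ⊢; tauto)
      (by simp [LBkSR.forPairs, LBkSR.forN, setV, Prog.wR])
  refine Ends.forFin (a := a + 5) (N := N)
    (fun A s' => Inv (Finset.univ.filter fun q : Fin N × Fin K => q.1 ∈ A) s') hN
    (fun s' h => (he s' h).1) (by simpa using h0) ?_ (fun s' hag hI => hQ s' hag (by simpa using hI))
    (fun _ _ _ h => hInvx _ _ _ h) hx hes (by omega)
  intro i A hi s' hag hxi hI
  refine Ends.forFin (N := K) (fun B s'' =>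
    Inv (Finset.univ.filter fun q : Fin N × Fin K => q.1 ∈ A ∨ q.1 = i ∧ q.2 ∈ B) s'') hK
    (fun s'' h => (he s'' (hag.trans (hsub h))).2) (by simpa using hI) ?_ ?_
    (fun _ _ _ h => hInvy _ _ _ h) hy hfs ha
  · intro j B hj s'' hag'' hyj hI''
    have : (Finset.univ.filter fun q : Fin N × Fin K => q.1 ∈ A ∨ q.1 = i ∧ q.2 ∈ insert j B) =
        insert (i, j) (Finset.univ.filter fun q : Fin N × Fin K => q.1 ∈ A ∨ q.1 = i ∧ q.2 ∈ B) := by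
      ext ⟨q, q'⟩
      simp only [Finset.mem_filter, Finset.mem_univ, true_and, Finset.mem_insert, Prod.mk.injEq]
      tauto
    rw [this]
    refine hb i j _ (by simp [hi, hj]) s'' (hag.trans (hsub hag'')) ?_ hyj hI''
    rw [hag''.nat x hx, hxi]
  · intro s'' hag'' hI''
    have : (Finset.univ.filter fun q : Fin N × Fin K => q.1 ∈ insert i A) =
        (Finset.univ.filter fun q : Fin N × Fin K => q.1 ∈ A ∨ q.1 = i ∧ q.2 ∈ Finset.univ) := by
      ext ⟨q, q'⟩
      simp only [Finset.mem_filter, Finset.mem_univ, true_and, Finset.mem_insert, and_true]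
      tauto
    rw [this]
    exact hI''

/-! ### A center of a connected intersection graph -/

/-- Breadth-first levels with respect to a nonempty set of vertices. -/
theorem exists_levels {V : Type*} (G : SimpleGraph V) (hG : G.Preconnected) (P : Set V)
    (hP : P.Nonempty) :
    ∃ D : V → ℕ, (∀ v, D v = 0 ↔ v ∈ P) ∧ (∀ u v, G.Adj u v → D v ≤ D u + 1) ∧
      (∀ v m, D v = m + 1 → ∃ w, G.Adj w v ∧ D w = m) := by
  classical
  have hne : ∀ v, ∃ n, ∃ p ∈ P, ∃ q : G.Walk p v, q.length = n := fun v => by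
    obtain ⟨p, hp⟩ := hP
    obtain ⟨q⟩ := hG p v
    exact ⟨_, p, hp, q, rfl⟩
  have hadj : ∀ u v, G.Adj u v → Nat.find (hne v) ≤ Nat.find (hne u) + 1 := by
    intro u v h
    obtain ⟨p, hp, q, hq⟩ := Nat.find_spec (hne u)
    exact Nat.find_min' _ ⟨p, hp, q.concat h, by simp [hq]⟩
  refine ⟨fun v => Nat.find (hne v), ?_, hadj, ?_⟩
  · intro v
    constructor
    · intro h
      obtain ⟨p, hp, q, hq⟩ := Nat.find_spec (hne v)
      replace hq := hq.trans h
      rwa [← SimpleGraph.Walk.eq_of_length_eq_zero hq]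
    · intro h
      exact Nat.le_zero.1 (Nat.find_min' (hne v) ⟨v, h, .nil, rfl⟩)
  · intro v m h
    obtain ⟨p, hp, q, hq⟩ := Nat.find_spec (hne v)
    have hq' : q.length = m + 1 := hq.trans h
    have hnn : ¬ q.Nil := by
      intro hn
      rw [← SimpleGraph.Walk.length_eq_zero_iff] at hn
      omega
    have ha : G.Adj q.penultimate v := q.adj_penultimate hnn
    refine ⟨q.penultimate, ha, ?_⟩
    have h1 : Nat.find (hne q.penultimate) ≤ m :=
      Nat.find_min' _ ⟨p, hp, q.dropLast, by simp [hq']⟩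
    have h2 := hadj _ _ ha
    change Nat.find (hne v) = m + 1 at h
    change Nat.find (hne q.penultimate) = m
    omega

/-- A shortest path from level `0` to a given vertex. -/
theorem exists_level_path {V : Type*} (G : SimpleGraph V) (D : V → ℕ)
    (hD : ∀ v m, D v = m + 1 → ∃ w, G.Adj w v ∧ D w = m) (m : ℕ) :
    ∀ v, D v = m → ∃ γ : ℕ → V, γ m = v ∧ (∀ l ≤ m, D (γ l) = l) ∧
      ∀ l < m, G.Adj (γ l) (γ (l + 1)) := by
  induction m with
  | zero => exact fun v hv => ⟨fun _ => v, rfl, fun l hl => by simp [hv]; omega, by simp⟩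
  | succ m ih =>
    intro v hv
    obtain ⟨w, hw, hwm⟩ := hD v m hv
    obtain ⟨γ, h1, h2, h3⟩ := ih w hwm
    refine ⟨fun l => if l ≤ m then γ l else v, by simp, ?_, ?_⟩
    · intro l hl
      by_cases h : l ≤ m
      · simp [h, h2 l h]
      · simp only [h, if_false]; omega
    · intro l hl
      by_cases h : l + 1 ≤ m
      · simp only [show l ≤ m by omega, h, if_true]; exact h3 l (by omega)
      · obtain rfl : l = m := by omega
        simpa [h1] using hw

/-- An edge costs the radii of both its ends, so along the path every radius is counted twice,
except that of the first vertex; the second copy for the last vertex is the term `r (γ b)` on the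
left. -/
theorem dist_path_le {V : Type*} (r : V → ℝ) (dist : V → V → ℝ) (hself : ∀ v, dist v v = 0)
    (htri : ∀ u v w, dist u w ≤ dist u v + dist v w) (γ : ℕ → V) (m : ℕ)
    (hγ : ∀ l < m, dist (γ l) (γ (l + 1)) ≤ r (γ l) + r (γ (l + 1))) (a b : ℕ) (hab : a ≤ b)
    (hb : b ≤ m) : dist (γ a) (γ b) + r (γ b) ≤
      2 * ∑ l ∈ Finset.range (b + 1), r (γ l) - 2 * ∑ l ∈ Finset.range a, r (γ l) - r (γ a) := by
  induction b, hab using Nat.le_induction with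
  | base => rw [hself, Finset.sum_range_succ]; linarith
  | succ b hab ih =>
    have h1 := ih (by omega)
    have h2 := hγ b (by omega)
    have h3 := htri (γ a) (γ b) (γ (b + 1))
    rw [Finset.sum_range_succ]
    linarith

/-- The vertices of the levels `l₀, …, m` of two level paths of which the second starts two
levels above the first one split into two independent sets. -/
theorem sum_path_le {V : Type*} [DecidableEq V] (G : SimpleGraph V) (r : V → ℝ) (W : ℝ)
    (hW : ∀ S : Finset V, (∀ u ∈ S, ∀ v ∈ S, ¬ G.Adj u v) → ∑ u ∈ S, r u ≤ W)
    (D E : V → ℕ) (hD : ∀ u v, G.Adj u v → D v ≤ D u + 1) (hE : ∀ u v, G.Adj u v → E v ≤ E u + 1)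
    (γ η : ℕ → V) (m n : ℕ) (hγ : ∀ l < m, D (γ l) = l) (hγE : ∀ l < m, E (γ l) = 0)
    (hη : ∀ l < n, E (η l) = l) :
    ∑ l ∈ Finset.range m, r (γ l) + ∑ l ∈ Finset.range n with 2 ≤ l, r (η l) ≤ 2 * W := by
  -- The vertices of one parity are independent: on either path their levels are equal or differ by
  -- at least two, and `E` separates the first path, at level `0`, from the levels `≥ 2` of the
  -- second.
  have key : ∀ e : ℕ, ∑ l ∈ Finset.range m with l % 2 = e, r (γ l) +
      ∑ l ∈ (Finset.range n).filter (2 ≤ ·) with l % 2 = e, r (η l) ≤ W := by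
    intro e
    have hinj : Set.InjOn γ ↑((Finset.range m).filter (· % 2 = e)) := by
      intro a ha b hb hab
      simp only [Finset.coe_filter, Finset.mem_range, Set.mem_ofPred_eq] at ha hb
      rw [← hγ a ha.1, ← hγ b hb.1, hab]
    have hinj' : Set.InjOn η ↑(((Finset.range n).filter (2 ≤ ·)).filter (· % 2 = e)) := by
      intro a ha b hb hab
      simp only [Finset.coe_filter, Finset.mem_filter, Finset.mem_range, Set.mem_ofPred_eq] at ha hb
      rw [← hη a ha.1.1, ← hη b hb.1.1, hab]
    rw [← Finset.sum_image hinj, ← Finset.sum_image hinj', ← Finset.sum_union]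
    · apply hW
      intro u hu v hv hadj
      have h1 := hD u v hadj
      have h2 := hD v u hadj.symm
      have h3 := hE u v hadj
      have h4 := hE v u hadj.symm
      simp only [Finset.mem_union, Finset.mem_image, Finset.mem_filter, Finset.mem_range] at hu hv
      rcases hu with ⟨a, ⟨ha, hae⟩, rfl⟩ | ⟨a, ⟨⟨ha, ha2⟩, hae⟩, rfl⟩ <;>
      rcases hv with ⟨b, ⟨hb, hbe⟩, rfl⟩ | ⟨b, ⟨⟨hb, hb2⟩, hbe⟩, rfl⟩
      · rw [hγ a ha, hγ b hb] at h1 h2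
        obtain rfl : a = b := by omega
        exact G.irrefl hadj
      · rw [hγE a ha, hη b hb] at h3; omega
      · rw [hη a ha, hγE b hb] at h4; omega
      · rw [hη a ha, hη b hb] at h3 h4
        obtain rfl : a = b := by omega
        exact G.irrefl hadj
    · rw [Finset.disjoint_left]
      intro u hu hu'
      simp only [Finset.mem_image, Finset.mem_filter, Finset.mem_range] at hu hu'
      obtain ⟨a, ⟨ha, -⟩, rfl⟩ := hu
      obtain ⟨b, ⟨⟨hb, hb2⟩, -⟩, hab⟩ := hu'
      have := hη b hb
      rw [hab, hγE a ha] at this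
      omega
  have hsplit : ∀ (A : Finset ℕ) (f : ℕ → ℝ),
      ∑ l ∈ A, f l = ∑ l ∈ A with l % 2 = 0, f l + ∑ l ∈ A with l % 2 = 1, f l := by
    intro A f
    rw [← Finset.sum_filter_add_sum_filter_not A (· % 2 = 0)]
    congr 2
    ext l
    simp
  rw [hsplit (Finset.range m), hsplit ((Finset.range n).filter (2 ≤ ·))]
  linarith [key 0, key 1]

/-- If every independent set of a connected graph has total radius at most `W`, and adjacent
vertices are at most as far apart as the sum of their radii, then some vertex reaches all balls
within `3.83 * W`. -/
theorem exists_center {V : Type*} [Finite V] (G : SimpleGraph V) (hG : G.Connected)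
    (r : V → ℝ) (hr : ∀ v, 0 ≤ r v) (dist : V → V → ℝ) (hself : ∀ v, dist v v = 0)
    (hsymm : ∀ u v, dist u v = dist v u) (htri : ∀ u v w, dist u w ≤ dist u v + dist v w)
    (hadj : ∀ u v, G.Adj u v → dist u v ≤ r u + r v) (W : ℝ)
    (hW : ∀ S : Finset V, (∀ u ∈ S, ∀ v ∈ S, ¬ G.Adj u v) → ∑ u ∈ S, r u ≤ W) :
    ∃ u, ∀ v, dist u v + r v ≤ 3.83 * W := by
  classical
  have := hG.nonempty
  have hW0 : 0 ≤ W := by simpa using hW ∅ (by simp)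
  -- Either the vertex `u` of largest radius is a center, or a path from `u` to a far ball is so
  -- heavy that its weighted midpoint is one.
  obtain ⟨u, hu⟩ := Finite.exists_max r
  by_contra! hcon
  obtain ⟨v, hv⟩ := hcon u
  obtain ⟨D, hD0, hD1, hD2⟩ := exists_levels G hG.preconnected {u} (by simp)
  obtain ⟨γ, hγm, hγD, hγa⟩ := exists_level_path G D hD2 (D v) v rfl
  set m := D v
  have hγ0 : γ 0 = u := by simpa using (hD0 (γ 0)).1 (hγD 0 (Nat.zero_le _))
  set F : ℕ → ℝ := fun x => ∑ l ∈ Finset.range x, r (γ l) with hF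
  have hFs : ∀ x, F (x + 1) = F x + r (γ x) := fun x => Finset.sum_range_succ _ _
  have hFm : Monotone F := monotone_nat_of_le_succ fun x => by rw [hFs]; linarith [hr (γ x)]
  have hF0 : F 0 = 0 := by simp [hF]
  have hpath := dist_path_le r dist hself htri γ m (fun l hl => hadj _ _ (hγa l hl))
  have h1 := hpath 0 m (Nat.zero_le _) le_rfl
  rw [hγm, hγ0] at h1
  change _ ≤ 2 * F (m + 1) - 2 * F 0 - r u at h1
  obtain ⟨E, hE0, hE1, hE2⟩ := exists_levels G hG.preconnected {x | ∃ l ≤ m, γ l = x}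
    ⟨u, 0, Nat.zero_le _, hγ0⟩
  have hγE : ∀ l < m + 1, E (γ l) = 0 := fun l hl => (hE0 _).2 ⟨l, by omega, rfl⟩
  have hγD' : ∀ l < m + 1, D (γ l) = l := fun l hl => hγD l (by omega)
  -- The second path is empty here. Together with `h1` and `hv` this leaves `r u < 0.17 * W`.
  have h2 : F (m + 1) ≤ 2 * W := by
    simpa using sum_path_le G r W hW D E hD1 hE1 γ γ (m + 1) 0 hγD' hγE (by simp)
  have hex : ∃ t, F (m + 1) / 2 ≤ F (t + 1) :=
    ⟨m, by linarith [hFm (Nat.zero_le (m + 1))]⟩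
  -- The weighted midpoint: the vertices before `γ t` and those after it each carry at most half of
  -- the total.
  set t := Nat.find hex with ht
  have ht1 : F (m + 1) / 2 ≤ F (t + 1) := Nat.find_spec hex
  have htm : t ≤ m := Nat.find_min' hex (by linarith [hFm (Nat.zero_le (m + 1))])
  have ht2 : F t ≤ F (m + 1) / 2 := by
    rcases Nat.eq_zero_or_pos t with h | h
    · rw [h]; linarith [hFm (Nat.zero_le (m + 1))]
    · have := Nat.find_min hex (m := t - 1) (by omega)
      rw [show t - 1 + 1 = t by omega] at this
      linarith
  have hmid : ∀ a ≤ m, dist (γ t) (γ a) + r (γ a) ≤ F (m + 1) + r u := by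
    intro a ha
    have hrt := hu (γ t)
    have hst := hFs t
    rcases le_total a t with h | h
    · have := hpath a t h htm
      change _ ≤ 2 * F (t + 1) - 2 * F a - r (γ a) at this
      rw [hsymm]
      have hFa : 0 ≤ F a := hF0 ▸ hFm (Nat.zero_le a)
      linarith
    · have := hpath t a h ha
      change _ ≤ 2 * F (a + 1) - 2 * F t - r (γ t) at this
      have := hFm (show a + 1 ≤ m + 1 by omega)
      linarith
  obtain ⟨w, hw⟩ := hcon (γ t)
  obtain ⟨η, hηm, hηE, hηa⟩ := exists_level_path G E hE2 (E w) w rfl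
  set n := E w
  obtain ⟨a, ham, ha⟩ := (hE0 (η 0)).1 (hηE 0 (Nat.zero_le _))
  -- The path `η` from `γ` to the far vertex `w` competes with `γ` for the same independent sets, so
  -- a heavy `γ` leaves little room for the detour.
  have h3 := sum_path_le G r W hW D E hD1 hE1 γ η (m + 1) (n + 1) hγD' hγE
    (fun l hl => hηE l (by omega))
  change F (m + 1) + _ ≤ _ at h3
  have h4 := dist_path_le r dist hself htri η n (fun l hl => hadj _ _ (hηa l hl)) 0 n
    (Nat.zero_le _) le_rfl
  -- Levels `0` and `1` are not controlled by `h3`. The radius at level `0` will be absorbed by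
  -- `h6`, and the one at level `1` is at most `r u`.
  have h5 : ∑ l ∈ Finset.range (n + 1), r (η l) ≤
      r (η 0) + r u + ∑ l ∈ Finset.range (n + 1) with 2 ≤ l, r (η l) := by
    rw [← Finset.sum_filter_add_sum_filter_not (Finset.range (n + 1)) (2 ≤ ·), add_comm]
    gcongr
    calc ∑ l ∈ Finset.range (n + 1) with ¬ 2 ≤ l, r (η l) ≤ ∑ l ∈ Finset.range 2, r (η l) := by
          refine Finset.sum_le_sum_of_subset_of_nonneg ?_ fun _ _ _ => hr _
          intro l hl
          simp only [Finset.mem_filter, Finset.mem_range] at hl ⊢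
          omega
      _ ≤ _ := by
          rw [Finset.sum_range_succ, Finset.sum_range_one]
          linarith [hu (η 1)]
  have h6 := hmid a ham
  rw [ha] at h6
  have h7 := htri (γ t) (η 0) w
  rw [hηm] at h4
  simp only [Finset.range_zero, Finset.sum_empty, mul_zero, sub_zero] at h4
  have h8 := hr u
  rw [hF0] at h1
  -- In total `dist (γ t) w + r w ≤ 4 * W - F (m + 1) + 3 * r u`. Since `2 * F (m + 1) > 3.83 * W +
  -- r u` and `r u < 0.17 * W`, this contradicts `hw`.
  linarith

/-! ### Families of balls -/

namespace Inst

variable (I : Inst)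

/-- A pair `(i, j)` stands for the ball around facility `i` with client `j` on its boundary. -/
abbrev Pair : Type := Fin I.nF × Fin I.nD

/-- The radius of a ball. -/
def rad (u : I.Pair) : ℝ := I.d u.1 u.2

open Classical in
/-- The clients in a ball. -/
noncomputable def ball (u : I.Pair) : Finset (Fin I.nD) :=
  Finset.univ.filter fun j => I.d u.1 j ≤ I.d u.1 u.2

variable {I}

theorem mem_ball {u : I.Pair} {j : Fin I.nD} : j ∈ I.ball u ↔ I.d u.1 j ≤ I.d u.1 u.2 := by
  simp [ball]

theorem self_mem_ball (u : I.Pair) : u.2 ∈ I.ball u := mem_ball.2 le_rfl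

theorem rad_nonneg (u : I.Pair) : 0 ≤ I.rad u := I.c_nonneg _ _

variable (I)

/-- Two clients lie in a common ball of the family. -/
def Linked (F : Finset I.Pair) (j j' : Fin I.nD) : Prop :=
  ∃ u ∈ F, j ∈ I.ball u ∧ j' ∈ I.ball u

/-- Every client lies in a ball of the family. -/
def Covers (F : Finset I.Pair) : Prop := ∀ j, ∃ u ∈ F, j ∈ I.ball u

/-- The balls of the family are pairwise disjoint. -/
def Packing (S : Finset I.Pair) : Prop :=
  ∀ u ∈ S, ∀ v ∈ S, u ≠ v → Disjoint (I.ball u) (I.ball v)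

/-- The number of connected components of the clients with respect to a family of balls. -/
noncomputable def numComp (F : Finset I.Pair) : ℕ :=
  Nat.card (Quotient (Relation.EqvGen.setoid (I.Linked F)))

end Inst

/-- The labels `f` are equal exactly on the classes of the equivalence relation generated by `r`. -/
def Labels {α β : Type*} (r : α → α → Prop) (f : α → β) : Prop :=
  ∀ x y, f x = f y ↔ Relation.EqvGen r x y

namespace Inst

variable {I : Inst}

theorem card_image_eq_numComp {F : Finset I.Pair} {β : Type*} [DecidableEq β] {f : Fin I.nD → β}
    (hf : Labels (I.Linked F) f) : (Finset.univ.image f).card = I.numComp F := by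
  classical
  have h : (Finset.univ.image f).card = Nat.card (Set.range f) := by
    rw [Nat.card_eq_card_toFinset]
    congr 1
    ext
    simp
  rw [h, numComp]
  refine (Nat.card_congr ?_).symm
  refine Equiv.ofBijective
    (Quotient.lift (s := Relation.EqvGen.setoid (I.Linked F)) (fun j => (⟨f j, j, rfl⟩ : Set.range f))
      fun a b h => Subtype.ext ((hf a b).2 h)) ⟨?_, ?_⟩
  · rintro ⟨a⟩ ⟨b⟩ h
    exact Quotient.sound ((hf a b).1 (congrArg Subtype.val h))
  · rintro ⟨_, j, rfl⟩
    exact ⟨Quotient.mk _ j, rfl⟩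

theorem exists_labels (F : Finset I.Pair) :
    ∃ f : Fin I.nD → Quotient (Relation.EqvGen.setoid (I.Linked F)), Labels (I.Linked F) f :=
  ⟨Quotient.mk _, fun _ _ => Quotient.eq⟩

theorem numComp_anti {F F' : Finset I.Pair} (h : F ⊆ F') : I.numComp F' ≤ I.numComp F := by
  have hm : ∀ a b, Relation.EqvGen (I.Linked F) a b → Relation.EqvGen (I.Linked F') a b :=
    fun a b hab => hab.mono fun _ _ ⟨u, hu, h'⟩ => ⟨u, h hu, h'⟩
  refine Nat.card_le_card_of_surjective
    (Quotient.lift (s := Relation.EqvGen.setoid (I.Linked F))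
      (fun j => (Quotient.mk (Relation.EqvGen.setoid (I.Linked F')) j))
      fun a b hab => Quotient.sound (hm a b hab)) ?_
  rintro ⟨j⟩
  exact ⟨Quotient.mk _ j, rfl⟩

/-- If every component meets a ball of `P`, then there are at most `P.card` components. -/
theorem numComp_le_card {F P : Finset I.Pair}
    (h : ∀ j, ∃ u ∈ P, ∃ j' ∈ I.ball u, Relation.EqvGen (I.Linked F) j j')
    (hP : ∀ u ∈ P, ∀ j ∈ I.ball u, Relation.EqvGen (I.Linked F) u.2 j) :
    I.numComp F ≤ P.card := by
  classical
  obtain ⟨f, hf⟩ := exists_labels F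
  rw [← card_image_eq_numComp hf]
  refine le_trans (Finset.card_le_card ?_) (Finset.card_image_le (s := P) (f := fun u => f u.2))
  intro l hl
  obtain ⟨j, -, rfl⟩ := Finset.mem_image.1 hl
  obtain ⟨u, hu, j', hj', hjj⟩ := h j
  refine Finset.mem_image.2 ⟨u, hu, ?_⟩
  rw [(hf j j').2 hjj]
  exact (hf _ _).2 (hP u hu j' hj')

theorem linked_of_mem {F : Finset I.Pair} {u : I.Pair} (hu : u ∈ F) {j j' : Fin I.nD}
    (hj : j ∈ I.ball u) (hj' : j' ∈ I.ball u) : Relation.EqvGen (I.Linked F) j j' :=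
  .rel _ _ ⟨u, hu, hj, hj'⟩

theorem numComp_le_of_covers {F P : Finset I.Pair} (hPF : P ⊆ F) (hP : I.Covers P) :
    I.numComp F ≤ P.card :=
  numComp_le_card (fun j => let ⟨u, hu, hj⟩ := hP j; ⟨u, hu, j, hj, .refl _⟩)
    fun _ hu _ hj => linked_of_mem (hPF hu) (self_mem_ball _) hj

/-- One component is served by one of its own centers. -/
theorem exists_component_center {F : Finset I.Pair} (hF : I.Covers F) {β : Type*} [DecidableEq β]
    {f : Fin I.nD → β} (hf : Labels (I.Linked F) f) (j₀ : Fin I.nD) :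
    ∃ S ⊆ F, (∀ u ∈ S, f u.2 = f j₀) ∧ I.Packing S ∧ ∃ u ∈ F, f u.2 = f j₀ ∧
      ∀ j, f j = f j₀ → I.d u.1 j ≤ 3.83 * ∑ v ∈ S, I.rad v := by
  classical
  let V := {u : I.Pair // u ∈ F ∧ f u.2 = f j₀}
  have hlab : ∀ u ∈ F, ∀ j ∈ I.ball u, f u.2 = f j := fun u hu j hj =>
    (hf _ _).2 (linked_of_mem hu (self_mem_ball u) hj)
  -- The intersection graph of the balls of the component; its independent sets are the packings.
  let G : SimpleGraph V :=
    { Adj := fun u v => u ≠ v ∧ ¬ Disjoint (I.ball u.1) (I.ball v.1)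
      symm := ⟨fun u v h => ⟨h.1.symm, fun h' => h.2 h'.symm⟩⟩
      loopless := ⟨fun u h => h.1 rfl⟩ }
  have hshare : ∀ (u v : V) (j : Fin I.nD), j ∈ I.ball u.1 → j ∈ I.ball v.1 → G.Reachable u v := by
    intro u v j hu hv
    by_cases h : u = v
    · rw [h]
    · exact SimpleGraph.Adj.reachable ⟨h, Finset.not_disjoint_iff.2 ⟨j, hu, hv⟩⟩
  -- Induction over the generated equivalence. The transitive case needs a ball around the
  -- intermediate client, which `hF` supplies.
  have hreach : ∀ j j', Relation.EqvGen (I.Linked F) j j' → f j = f j₀ →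
      ∀ u v : V, j ∈ I.ball u.1 → j' ∈ I.ball v.1 → G.Reachable u v := by
    intro j j' h
    induction h with
    | rel j j' h =>
      intro hj u v hu hv
      obtain ⟨w, hw, hwj, hwj'⟩ := h
      have hw' := (hlab w hw j hwj).trans hj
      exact (hshare u ⟨w, hw, hw'⟩ j hu hwj).trans (hshare ⟨w, hw, hw'⟩ v j' hwj' hv)
    | refl j => exact fun _ u v hu hv => hshare u v j hu hv
    | symm j j' h ih =>
      intro hj u v hu hv
      exact (ih (((hf _ _).2 h).trans hj) v u hv hu).symm
    | trans j k j' h h' ih ih' =>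
      intro hj u v hu hv
      have hk : f k = f j₀ := ((hf _ _).2 h).symm.trans hj
      obtain ⟨w, hw, hwk⟩ := hF k
      have hw' := (hlab w hw k hwk).trans hk
      exact (ih hj u ⟨w, hw, hw'⟩ hu hwk).trans (ih' hk ⟨w, hw, hw'⟩ v hwk hv)
  obtain ⟨u₀, hu₀, hju₀⟩ := hF j₀
  have hG : G.Connected := by
    have : Nonempty V := ⟨⟨u₀, hu₀, hlab u₀ hu₀ j₀ hju₀⟩⟩
    refine ⟨fun u v => ?_⟩
    exact hreach u.1.2 v.1.2 ((hf _ _).1 (u.2.2.trans v.2.2.symm)) u.2.2 u v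
      (self_mem_ball _) (self_mem_ball _)
  have hpow : ((Finset.univ : Finset (Finset V)).filter
      fun S => ∀ u ∈ S, ∀ v ∈ S, ¬ G.Adj u v).Nonempty := ⟨∅, by simp⟩
  -- The heaviest packing of the component provides the `W` of `exists_center`.
  obtain ⟨S, hS, hmax⟩ := Finset.exists_max_image _ (fun S => ∑ u ∈ S, I.rad u.1) hpow
  simp only [Finset.mem_filter, Finset.mem_univ, true_and] at hS hmax
  obtain ⟨u, hu⟩ := exists_center G hG (fun u => I.rad u.1) (fun u => rad_nonneg _)
    (fun u v => I.c (Sum.inl u.1.1) (Sum.inl v.1.1)) (fun _ => I.c_self _) (fun _ _ => I.c_symm _ _)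
    (fun _ _ _ => I.c_triangle _ _ _) (by
      intro u v h
      obtain ⟨j, hju, hjv⟩ := Finset.not_disjoint_iff.1 h.2
      have h1 := mem_ball.1 hju
      have h2 := mem_ball.1 hjv
      have h3 := I.c_triangle (Sum.inl u.1.1) (Sum.inr j) (Sum.inl v.1.1)
      rw [I.c_symm (Sum.inr j)] at h3
      exact h3.trans (add_le_add h1 h2)) _ hmax
  refine ⟨S.map ⟨Subtype.val, Subtype.val_injective⟩, ?_, ?_, ?_, u.1, u.2.1, u.2.2, ?_⟩
  · intro v hv
    obtain ⟨w, -, rfl⟩ := Finset.mem_map.1 hv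
    exact w.2.1
  · intro v hv
    obtain ⟨w, -, rfl⟩ := Finset.mem_map.1 hv
    exact w.2.2
  · intro v hv v' hv' hne
    obtain ⟨w, hw, rfl⟩ := Finset.mem_map.1 hv
    obtain ⟨w', hw', rfl⟩ := Finset.mem_map.1 hv'
    by_contra hd
    exact hS w hw w' hw' ⟨fun h => hne (by rw [h]), hd⟩
  · intro j hj
    obtain ⟨v, hv, hjv⟩ := hF j
    have h1 := hu ⟨v, hv, (hlab v hv j hjv).trans hj⟩
    have h2 := mem_ball.1 hjv
    have h3 := I.c_triangle (Sum.inl u.1.1) (Sum.inl v.1) (Sum.inr j)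
    rw [Finset.sum_map]
    simp only [rad, d, Function.Embedding.coeFn_mk] at *
    linarith

/-- A covering family contains a packing that bounds the cost of serving every component by its best
center. -/
theorem exists_packing_centers {F : Finset I.Pair} (hF : I.Covers F) {β : Type*} [DecidableEq β]
    {f : Fin I.nD → β} (hf : Labels (I.Linked F) f) :
    ∃ S ⊆ F, I.Packing S ∧ ∃ w : β → ℝ, (∀ l, 0 ≤ w l) ∧
      (∀ j₀, ∃ u ∈ F, f u.2 = f j₀ ∧ ∀ j, f j = f j₀ → I.d u.1 j ≤ w (f j₀)) ∧
      ∑ l ∈ Finset.univ.image f, w l ≤ 3.83 * ∑ v ∈ S, I.rad v := by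
  classical
  have hlab : ∀ u ∈ F, ∀ j ∈ I.ball u, f u.2 = f j := fun u hu j hj =>
    (hf _ _).2 (linked_of_mem hu (self_mem_ball u) hj)
  have hex : ∀ l : β, ∃ S ⊆ F, (∀ u ∈ S, f u.2 = l) ∧ I.Packing S ∧ ∀ j₀, f j₀ = l →
      ∃ u ∈ F, f u.2 = l ∧ ∀ j, f j = l → I.d u.1 j ≤ 3.83 * ∑ v ∈ S, I.rad v := by
    intro l
    by_cases hl : ∃ j₀, f j₀ = l
    · obtain ⟨j₀, rfl⟩ := hl
      obtain ⟨S, h1, h2, h3, h4⟩ := exists_component_center hF hf j₀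
      exact ⟨S, h1, h2, h3, fun _ _ => h4⟩
    · exact ⟨∅, by simp, by simp, by simp [Packing], fun j₀ h => (hl ⟨j₀, h⟩).elim⟩
  choose S hSF hSl hSP hSc using hex
  refine ⟨(Finset.univ.image f).biUnion S, ?_, ?_, fun l => 3.83 * ∑ v ∈ S l, I.rad v, ?_, ?_, ?_⟩
  · intro u hu
    obtain ⟨l, -, hl⟩ := Finset.mem_biUnion.1 hu
    exact hSF l hl
  · intro u hu v hv hne
    obtain ⟨l, -, hl⟩ := Finset.mem_biUnion.1 hu
    obtain ⟨l', -, hl'⟩ := Finset.mem_biUnion.1 hv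
    by_cases h : l = l'
    · subst h; exact hSP l u hl v hl' hne
    · rw [Finset.disjoint_left]
      intro j hj hj'
      apply h
      rw [← hSl l u hl, ← hSl l' v hl', hlab u (hSF l hl) j hj, hlab v (hSF l' hl') j hj']
  · exact fun l => mul_nonneg (by norm_num) (Finset.sum_nonneg fun _ _ => rad_nonneg _)
  · exact fun j₀ => hSc (f j₀) j₀ rfl
  · rw [Finset.sum_biUnion, Finset.mul_sum]
    intro l _ l' _ hne
    rw [Function.onFun, Finset.disjoint_left]
    intro u hu hu'
    exact hne ((hSl l u hu).symm.trans (hSl l' u hu'))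

/-! ### Packings, component counts and duality. -/

theorem sum_packing_le {S : Finset I.Pair} (hS : I.Packing S) {α : Fin I.nD → ℝ}
    (hα : ∀ j, 0 ≤ α j) : ∑ u ∈ S, ∑ j ∈ I.ball u, α j ≤ ∑ j, α j := by
  classical
  rw [← Finset.sum_biUnion fun u hu v hv hne => hS u hu v hv hne]
  exact Finset.sum_le_sum_of_subset_of_nonneg (Finset.subset_univ _) fun j _ _ => hα j

/-- Disjoint balls have distinct boundary clients. This caps the accumulated slack of a packing at
`I.nD * δ` and explains the step width `R / I.nD` of the multiplier. -/
theorem card_packing_le {S : Finset I.Pair} (hS : I.Packing S) : S.card ≤ I.nD := by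
  classical
  calc S.card ≤ (Finset.univ : Finset (Fin I.nD)).card := by
        refine Finset.card_le_card_of_injOn (fun u => u.2) (by simp) ?_
        intro u hu v hv huv
        by_contra hne
        exact Finset.disjoint_left.1 (hS u hu v hv hne) (self_mem_ball u)
          (by simp only at huv; rw [huv]; exact self_mem_ball v)
    _ = I.nD := by simp

/-- A packing of almost tight balls is paid for by the dual solution. -/
theorem sum_rad_packing_le {S : Finset I.Pair} (hS : I.Packing S) {α : Fin I.nD → ℝ}
    (hα : ∀ j, 0 ≤ α j) {lam δ : ℝ} (hδ : 0 ≤ δ)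
    (ht : ∀ u ∈ S, I.rad u + lam - ∑ j ∈ I.ball u, α j ≤ δ) :
    ∑ u ∈ S, I.rad u ≤ ∑ j, α j - S.card * lam + I.nD * δ := by
  have h1 : ∑ u ∈ S, I.rad u ≤ ∑ u ∈ S, (∑ j ∈ I.ball u, α j - lam + δ) :=
    Finset.sum_le_sum fun u hu => by linarith [ht u hu]
  rw [Finset.sum_add_distrib, Finset.sum_sub_distrib, Finset.sum_const, Finset.sum_const,
    nsmul_eq_mul, nsmul_eq_mul] at h1
  have h2 := sum_packing_le hS hα
  have h3 : (S.card : ℝ) * δ ≤ I.nD * δ :=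
    mul_le_mul_of_nonneg_right (by exact_mod_cast card_packing_le hS) hδ
  linarith

/-- Extending a given packing, rather than building a new one, lets the tight part of an arbitrary
packing survive in `S'`, whose size is bounded below by maximality. -/
theorem exists_maximal_packing {S T : Finset I.Pair} (hST : S ⊆ T) (hS : I.Packing S) :
    ∃ S', S ⊆ S' ∧ S' ⊆ T ∧ I.Packing S' ∧
      ∀ u ∈ T, ∃ v ∈ S', ¬ Disjoint (I.ball u) (I.ball v) := by
  classical
  obtain ⟨S', hS', hmax⟩ := Finset.exists_max_image
    (T.powerset.filter fun S' => S ⊆ S' ∧ I.Packing S') Finset.card ⟨S, by simp [hST, hS]⟩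
  simp only [Finset.mem_filter, Finset.mem_powerset] at hS' hmax
  refine ⟨S', hS'.2.1, hS'.1, hS'.2.2, fun u hu => ?_⟩
  by_contra! hcon
  have hnot : u ∉ S' := fun h => by
    have := hcon u h
    exact Finset.disjoint_left.1 this (self_mem_ball u) (self_mem_ball u)
  have := hmax (insert u S') ⟨Finset.insert_subset hu hS'.1,
    hS'.2.1.trans (Finset.subset_insert _ _), ?_⟩
  · rw [Finset.card_insert_of_notMem hnot] at this; omega
  · intro v hv w hw hne
    rcases Finset.mem_insert.1 hv with rfl | hv' <;> rcases Finset.mem_insert.1 hw with rfl | hw'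
    · exact (hne rfl).elim
    · exact hcon w hw'
    · exact (hcon v hv').symm
    · exact hS'.2.2 v hv' w hw' hne

/-- A maximal packing in `T`, together with `X`, meets all components of a covering family
`T ∪ X`. -/
theorem numComp_le_card_add {T X S : Finset I.Pair} [DecidableEq I.Pair] (hcov : I.Covers (T ∪ X))
    (hST : S ⊆ T) (hmax : ∀ u ∈ T, ∃ v ∈ S, ¬ Disjoint (I.ball u) (I.ball v)) :
    I.numComp (T ∪ X) ≤ S.card + X.card := by
  have hsub : S ∪ X ⊆ T ∪ X := Finset.union_subset_union_left hST
  refine (numComp_le_card (P := S ∪ X) ?_ ?_).trans (Finset.card_union_le _ _)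
  · intro j
    obtain ⟨u, hu, hj⟩ := hcov j
    rcases Finset.mem_union.1 hu with hT | hX
    · obtain ⟨v, hv, hd⟩ := hmax u hT
      obtain ⟨j', hj', hj''⟩ := Finset.not_disjoint_iff.1 hd
      exact ⟨v, Finset.mem_union_left _ hv, j', hj'', linked_of_mem hu hj hj'⟩
    · exact ⟨u, Finset.mem_union_right _ hX, j, hj, .refl _⟩
  · exact fun u hu j hj => linked_of_mem (hsub hu) (self_mem_ball u) hj

/-- The cost of a packing in `T ∪ X ∪ {b}` when the almost tight family `T` and `X` leave more than
`k` components. -/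
theorem sum_rad_le_of_lt_numComp {T X S : Finset I.Pair} [DecidableEq I.Pair] {b : I.Pair} {k : ℕ}
    (hcov : I.Covers (T ∪ X)) (hk : k < I.numComp (T ∪ X)) (hS : I.Packing S)
    (hSsub : S ⊆ insert b (T ∪ X)) {α : Fin I.nD → ℝ} (hα : ∀ j, 0 ≤ α j) {lam δ : ℝ}
    (hlam : 0 ≤ lam) (hδ : 0 ≤ δ) (ht : ∀ u ∈ T, I.rad u + lam - ∑ j ∈ I.ball u, α j ≤ δ) :
    ∑ u ∈ S, I.rad u ≤
      ∑ j, α j - (k - X.card : ℝ) * lam + ∑ u ∈ X, I.rad u + I.rad b + I.nD * δ := by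
  -- The balls of `S` in `T` are enlarged to a maximal packing, which has at least `k - X.card`
  -- members and is paid by `α`. The other balls of `S` lie in `insert b X` and are charged in full.
  obtain ⟨S', hSS', hS'T, hS', hmax⟩ := exists_maximal_packing (S := S ∩ T) (T := T)
    Finset.inter_subset_right fun u hu v hv =>
      hS u (Finset.mem_inter.1 hu).1 v (Finset.mem_inter.1 hv).1
  have hcard := numComp_le_card_add (X := X) hcov hS'T hmax
  have h1 := sum_rad_packing_le hS' hα hδ fun u hu => ht u (hS'T hu)
  have h2 : ∑ u ∈ S, I.rad u ≤ ∑ u ∈ S', I.rad u + (∑ u ∈ X, I.rad u + I.rad b) := by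
    calc ∑ u ∈ S, I.rad u ≤ ∑ u ∈ S' ∪ insert b X, I.rad u := by
          refine Finset.sum_le_sum_of_subset_of_nonneg ?_ fun _ _ _ => rad_nonneg _
          intro u hu
          have := hSsub hu
          simp only [Finset.mem_insert, Finset.mem_union] at this ⊢
          rcases this with h | h | h
          · exact Or.inr (Or.inl h)
          · exact Or.inl (hSS' (Finset.mem_inter.2 ⟨hu, h⟩))
          · exact Or.inr (Or.inr h)
      _ ≤ ∑ u ∈ S', I.rad u + ∑ u ∈ insert b X, I.rad u := by
          rw [← Finset.sum_union_inter]
          linarith [Finset.sum_nonneg fun u (_ : u ∈ S' ∩ insert b X) => rad_nonneg u]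
      _ ≤ _ := by
          by_cases hb : b ∈ X
          · rw [Finset.insert_eq_of_mem hb]; linarith [rad_nonneg b]
          · rw [Finset.sum_insert hb]; linarith
  have h3 : (k - X.card : ℝ) * lam ≤ S'.card * lam := by
    refine mul_le_mul_of_nonneg_right ?_ hlam
    have : (k : ℝ) ≤ S'.card + X.card := by exact_mod_cast (hk.trans_le hcard).le
    linarith
  linarith

/-- Weak duality. -/
theorem sum_dual_le {O : Finset I.Pair} {α : Fin I.nD → ℝ} (hα : ∀ j, 0 ≤ α j) {lam : ℝ}
    (hO : ∀ u ∈ O, 0 ≤ I.rad u + lam - ∑ j ∈ I.ball u, α j)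
    (hcov : ∀ j, α j ≠ 0 → ∃ u ∈ O, j ∈ I.ball u) :
    ∑ j, α j ≤ ∑ u ∈ O, I.rad u + O.card * lam := by
  classical
  calc ∑ j, α j ≤ ∑ j, ∑ u ∈ O, if j ∈ I.ball u then α j else 0 := by
        refine Finset.sum_le_sum fun j _ => ?_
        have hnn : ∀ u ∈ O, 0 ≤ if j ∈ I.ball u then α j else 0 := fun u _ => by
          split_ifs <;> simp [hα]
        by_cases h : α j = 0
        · rw [h]; simp
        · obtain ⟨u, hu, hju⟩ := hcov j h
          have := Finset.single_le_sum hnn hu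
          rwa [if_pos hju] at this
    _ = ∑ u ∈ O, ∑ j ∈ I.ball u, α j := by
        rw [Finset.sum_comm]
        refine Finset.sum_congr rfl fun u _ => ?_
        rw [← Finset.sum_filter]
        congr 1
        ext j
        simp
    _ ≤ ∑ u ∈ O, (I.rad u + lam) := Finset.sum_le_sum fun u hu => by linarith [hO u hu]
    _ = _ := by rw [Finset.sum_add_distrib, Finset.sum_const, nsmul_eq_mul]

end Inst

/-! ### The optimum -/

namespace Inst

variable {I : Inst}

theorem le_radius (σ : Fin I.nD → Fin I.nF) (j : Fin I.nD) : I.d (σ j) j ≤ I.radius σ (σ j) :=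
  le_ciSup (f := fun j' : {j' : Fin I.nD // σ j' = σ j} => I.d (σ j) j')
    (Set.finite_range _).bddAbove ⟨j, rfl⟩

theorem radius_nonneg (σ : Fin I.nD → Fin I.nF) (i : Fin I.nF) : 0 ≤ I.radius σ i :=
  Real.iSup_nonneg fun _ => I.c_nonneg _ _

theorem radius_le (σ : Fin I.nD → Fin I.nF) (i : Fin I.nF) {x : ℝ} (hx : 0 ≤ x)
    (h : ∀ j, σ j = i → I.d i j ≤ x) : I.radius σ i ≤ x :=
  Real.iSup_le (fun j => h j j.2) hx

theorem exists_opt (h : I.IsFeasible) : ∃ S σ, I.Feasible S σ ∧ I.cost S σ = I.opt := by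
  have hfin : {x | ∃ S σ, I.Feasible S σ ∧ x = I.cost S σ}.Finite := by
    refine (Set.finite_range fun p : Finset (Fin I.nF) × (Fin I.nD → Fin I.nF) =>
      I.cost p.1 p.2).subset ?_
    rintro x ⟨S, σ, -, rfl⟩
    exact ⟨(S, σ), rfl⟩
  obtain ⟨S, σ, hS⟩ := h
  have hne : {x | ∃ S σ, I.Feasible S σ ∧ x = I.cost S σ}.Nonempty := ⟨_, S, σ, hS, rfl⟩
  obtain ⟨T, τ, hT, heq⟩ := hne.csInf_mem hfin
  exact ⟨T, τ, hT, heq.symm⟩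

/-- The balls of an optimal solution. -/
theorem exists_opt_pairs (h : I.IsFeasible) :
    ∃ P : Finset I.Pair, I.Covers P ∧ P.card ≤ I.k ∧ P.card ≤ I.nF ∧ (∀ u ∈ P, I.L u.1 ≤ (I.ball u).card) ∧
      ∑ u ∈ P, I.rad u ≤ I.opt := by
  classical
  obtain ⟨S, σ, hS, hcost⟩ := exists_opt h
  have hfar : ∀ j₀ : Fin I.nD, ∃ j, σ j = σ j₀ ∧ ∀ j', σ j' = σ j₀ → I.d (σ j₀) j' ≤ I.d (σ j₀) j := by
    intro j₀
    obtain ⟨j, hj, hmax⟩ := Finset.exists_max_image (Finset.univ.filter fun j => σ j = σ j₀)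
      (fun j => I.d (σ j₀) j) ⟨j₀, by simp⟩
    exact ⟨j, (Finset.mem_filter.1 hj).2, fun j' hj' => hmax j' (by simp [hj'])⟩
  have hex : ∀ i ∈ Finset.univ.image σ, ∃ j, σ j = i ∧ ∀ j', σ j' = i → I.d i j' ≤ I.d i j := by
    intro i hi
    obtain ⟨j₀, -, rfl⟩ := Finset.mem_image.1 hi
    exact hfar j₀
  -- Without clients there is no default value for the choice of a farthest client below.
  rcases isEmpty_or_nonempty (Fin I.nD) with hD | hD
  · refine ⟨∅, fun j => isEmptyElim j, by simp, by simp, by simp, ?_⟩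
    rw [← hcost, Finset.sum_empty]
    exact Finset.sum_nonneg fun i _ => radius_nonneg σ i
  choose! g hg1 hg2 using hex
  have hinj : Function.Injective fun i : Fin I.nF => (i, g i) := fun a b hab => (Prod.ext_iff.1 hab).1
  -- Open facilities that serve nobody are dropped; their radii are nonnegative, so the cost does
  -- not increase.
  have hsub : Finset.univ.image σ ⊆ S := by
    intro i hi
    obtain ⟨j, -, rfl⟩ := Finset.mem_image.1 hi
    exact hS.mem j
  refine ⟨(Finset.univ.image σ).map ⟨_, hinj⟩, ?_, ?_, ?_, ?_, ?_⟩
  · intro j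
    have hj : σ j ∈ Finset.univ.image σ := Finset.mem_image_of_mem _ (Finset.mem_univ _)
    exact ⟨(σ j, g (σ j)), Finset.mem_map.2 ⟨σ j, hj, rfl⟩, mem_ball.2 (hg2 _ hj j rfl)⟩
  · rw [Finset.card_map]
    exact (Finset.card_le_card hsub).trans hS.card_le
  · rw [Finset.card_map]
    exact (Finset.card_le_univ _).trans_eq (Fintype.card_fin _)
  · intro u hu
    obtain ⟨i, hi, rfl⟩ := Finset.mem_map.1 hu
    refine (hS.lower i (hsub hi)).trans (Finset.card_le_card ?_)
    intro j hj
    exact mem_ball.2 (hg2 i hi j (Finset.mem_filter.1 hj).2)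
  · rw [Finset.sum_map, ← hcost, cost]
    refine (Finset.sum_le_sum fun i hi => ?_).trans
      (Finset.sum_le_sum_of_subset_of_nonneg hsub fun i _ _ => radius_nonneg σ i)
    have := le_radius σ (g i)
    rwa [hg1 i hi] at this

/-- The `m` largest balls of a family. -/
theorem exists_largest (P : Finset I.Pair) [DecidableEq I.Pair] (m : ℕ) :
    ∃ X ⊆ P, X.card ≤ m ∧ ∀ u ∈ P \ X, m * I.rad u ≤ ∑ v ∈ X, I.rad v := by
  -- Greedy choice of the largest balls. If fewer than `m` balls exist, `P \ X` is empty and nothing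
  -- is claimed.
  have key : ∃ X ⊆ P, X.card ≤ m ∧ (X.card = m ∨ P \ X = ∅) ∧
      ∀ u ∈ P \ X, ∀ v ∈ X, I.rad u ≤ I.rad v := by
    induction m with
    | zero => exact ⟨∅, by simp, by simp, by simp, by simp⟩
    | succ m ih =>
      obtain ⟨X, h1, h2, h3, h4⟩ := ih
      rcases (P \ X).eq_empty_or_nonempty with he | hne
      · exact ⟨X, h1, by omega, Or.inr he, h4⟩
      · obtain ⟨w, hw, hmax⟩ := Finset.exists_max_image (P \ X) I.rad hne
        have hX : X.card = m := h3.resolve_right hne.ne_empty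
        have hwX := (Finset.mem_sdiff.1 hw).2
        refine ⟨insert w X, Finset.insert_subset (Finset.mem_sdiff.1 hw).1 h1, ?_, Or.inl ?_, ?_⟩
        · rw [Finset.card_insert_of_notMem hwX]; omega
        · rw [Finset.card_insert_of_notMem hwX]; omega
        · intro u hu v hv
          have hu' : u ∈ P \ X := by
            simp only [Finset.mem_sdiff, Finset.mem_insert, not_or] at hu ⊢
            exact ⟨hu.1, hu.2.2⟩
          rcases Finset.mem_insert.1 hv with rfl | hv
          · exact hmax u hu'
          · exact h4 u hu' v hv
  obtain ⟨X, h1, h2, h3, h4⟩ := key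
  refine ⟨X, h1, h2, fun u hu => ?_⟩
  rcases h3 with h3 | h3
  · rw [← h3, ← nsmul_eq_mul, ← Finset.sum_const]
    exact Finset.sum_le_sum fun v hv => h4 u hu v hv
  · rw [h3] at hu; simp at hu

end Inst

/-! ### The input in memory -/

/-- The memory contains the instance. -/
structure Ctx (I : Inst) (s : Mem) : Prop where
  nF : s.nat 0 0 0 = I.nF
  nD : s.nat 1 0 0 = I.nD
  k : s.nat 2 0 0 = I.k
  L : ∀ i : Fin I.nF, s.nat 3 i 0 = I.L i
  d : ∀ (i : Fin I.nF) (j : Fin I.nD), s.real 1 i j = I.d i j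

theorem Ctx.agree {I : Inst} {s s' : Mem} {wn wr : List ℕ} (h : Ctx I s) (hag : Agree wn wr s s')
    (hn : ∀ x ∈ [0, 1, 2, 3], x ∉ wn := by decide) (hr : 1 ∉ wr := by decide) : Ctx I s' where
  nF := by rw [hag.nat 0 (hn 0 (by simp))]; exact h.nF
  nD := by rw [hag.nat 1 (hn 1 (by simp))]; exact h.nD
  k := by rw [hag.nat 2 (hn 2 (by simp))]; exact h.k
  L := by rw [hag.nat 3 (hn 3 (by simp))]; exact h.L
  d := by rw [hag.real 1 hr]; exact h.d

/-- The expression for `|F|`. -/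
def eF : NatExp := var 0
/-- The expression for `|D|`. -/
def eD : NatExp := var 1
/-- The expression for the distance of facility `i` and client `j`. -/
def ed (i j : NatExp) : RealExp := .get 1 i j

/-- The array `x` marks the members of `F`. -/
def Marks {I : Inst} (s : Mem) (x : ℕ) (F : Finset I.Pair) : Prop :=
  ∀ (i : Fin I.nF) (j : Fin I.nD), s.nat x i j = 1 ↔ (i, j) ∈ F

theorem Marks.agree {I : Inst} {s s' : Mem} {wn wr : List ℕ} {x : ℕ} {F : Finset I.Pair}
    (h : Marks s x F) (hag : Agree wn wr s s') (hx : x ∉ wn := by decide) : Marks s' x F := by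
  unfold Marks; rw [hag.nat x hx]; exact h

/-! ### Labelling the components -/

/-- The array `11` holds the labels `f`. -/
def LabMem {I : Inst} (s : Mem) (f : Fin I.nD → Fin I.nD) : Prop :=
  ∀ j : Fin I.nD, s.nat 11 j 0 = f j

theorem LabMem.agree {I : Inst} {s s' : Mem} {wn wr : List ℕ} {f : Fin I.nD → Fin I.nD}
    (h : LabMem s f) (hag : Agree wn wr s s') (hx : 11 ∉ wn := by decide) : LabMem s' f := by
  unfold LabMem; rw [hag.nat 11 hx]; exact h

/-- Identify the labels of the clients in the variables `51` and `52`. -/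
def mergeP : Prog :=
  .seq (setV 60 (.get 11 (var 51) (.const 0)))
    (.seq (setV 61 (.get 11 (var 52) (.const 0)))
      (forN 53 eD (.ite (natEq (.get 11 (var 53) (.const 0)) (var 61))
        (.natSet 11 (var 53) (.const 0) (var 60)) .skip)))

/-- Both labels are copied to scalar variables beforehand, because the loop overwrites the array
they come from. -/
theorem mergeP_spec {I : Inst} {M : ℕ} {s : Mem} (hD : I.nD ≤ M + 2) (hc : Ctx I s)
    {a b : Fin I.nD} (ha : s.nat 51 0 0 = a) (hb : s.nat 52 0 0 = b) {f : Fin I.nD → Fin I.nD}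
    (hf : LabMem s f) :
    Ends M 20 mergeP s fun s' => LabMem s' fun x => if f x = f b then f a else f x := by
  refine Ends.natSet_seq (Ends.natSet_seq ?_)
  refine Ends.exp (a := 7 + 5) ?_ (by norm_num)
  refine Ends.forFin (N := I.nD) (fun A s' => ∀ x : Fin I.nD,
    s'.nat 11 x 0 = if x ∈ A ∧ f x = f b then f a else f x) hD ?_ ?_ ?_ ?_
  · intro s' hag
    simp only [eD, var_eval, hag.nat 1 (by decide)]
    simpa using hc.nD
  · intro x
    simpa using hf x
  · intro i A hi s' hag hx hI
    have h60 : s'.nat 60 0 0 = f a := by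
      rw [hag.nat 60 (by decide)]; simp [ha, hf a]
    have h61 : s'.nat 61 0 0 = f b := by
      rw [hag.nat 61 (by decide)]; simp [hb, hf b]
    refine Ends.ite ?_ ?_
    · intro ht
      simp only [natEq_eval, get_eval, var_eval, const_eval, hx, h61, hI i, hi, false_and,
        if_false, Fin.val_inj] at ht
      refine Ends.natSet fun x => ?_
      simp only [var_eval, const_eval, hx, h60, Mem.setNat_nat_eq, and_true, Fin.val_inj,
        Finset.mem_insert]
      by_cases hxi : x = i
      · simp [hxi, ht]
      · simp [hxi, hI x]
    · intro ht
      simp only [natEq_eval, get_eval, var_eval, const_eval, hx, h61, hI i, hi, false_and,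
        if_false, Fin.val_inj] at ht
      refine Ends.skip fun x => ?_
      rw [hI x]
      by_cases hxi : x = i
      · simp [hxi, ht]
      · simp [hxi]
  · intro s' hag hI x
    rw [hI x]; simp

theorem eqvGen_lift {α : Type*} {r r' : α → α → Prop}
    (h : ∀ x y, r x y → Relation.EqvGen r' x y) {x y : α} (hxy : Relation.EqvGen r x y) :
    Relation.EqvGen r' x y := by
  induction hxy with
  | rel x y hr => exact h x y hr
  | refl x => exact .refl x
  | symm x y _ ih => exact ih.symm
  | trans x y z _ _ ih ih' => exact ih.trans _ _ _ ih'

theorem Labels.congr {α β : Type*} {r r' : α → α → Prop} {f : α → β} (hf : Labels r f)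
    (h : ∀ x y, r x y → Relation.EqvGen r' x y) (h' : ∀ x y, r' x y → Relation.EqvGen r x y) :
    Labels r' f := fun x y =>
  (hf x y).trans ⟨eqvGen_lift h, eqvGen_lift h'⟩

theorem Labels.merge {α β : Type*} [DecidableEq β] {r : α → α → Prop} {f : α → β}
    (hf : Labels r f) (a b : α) :
    Labels (fun x y => r x y ∨ (x = a ∧ y = b)) fun x => if f x = f b then f a else f x := by
  set r' : α → α → Prop := fun x y => r x y ∨ (x = a ∧ y = b)
  have hm : ∀ {x y}, f x = f y → Relation.EqvGen r' x y := fun h =>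
    ((hf _ _).1 h).mono fun _ _ => Or.inl
  have hab : Relation.EqvGen r' a b := .rel _ _ (Or.inr ⟨rfl, rfl⟩)
  intro x y
  constructor
  · intro h
    by_cases hx : f x = f b <;> by_cases hy : f y = f b <;> simp only [hx, hy, if_true, if_false] at h
    · exact hm (hx.trans hy.symm)
    · exact ((hm hx).trans _ _ _ hab.symm).trans _ _ _ (hm h)
    · exact (hm h).trans _ _ _ (hab.trans _ _ _ (hm hy.symm))
    · exact hm h
  · intro h
    induction h with
    | rel x y h =>
      rcases h with h | ⟨rfl, rfl⟩
      · simp only [(hf x y).2 (.rel _ _ h)]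
      · simp
    | refl x => rfl
    | symm x y _ ih => exact ih.symm
    | trans x y z _ _ ih ih' => exact ih.trans ih'

/-- Label the components of the marked family. -/
def labelP : Prog :=
  .seq (forN 50 eD (.natSet 11 (var 50) (.const 0) (var 50)))
    (forPairs 50 51 eF eD (.ite (natEq (.get 10 (var 50) (var 51)) (.const 1))
      (forN 52 eD (.ite (.realLe (ed (var 50) (var 52)) (ed (var 50) (var 51))) mergeP .skip))
      .skip))

/-- Each ball is merged as a star around its boundary client, which generates the same equivalence
as linking all its pairs. Idempotence of `f` makes the labels representatives, so that components
are counted by the fixed points of `f`. -/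
theorem labelP_spec {I : Inst} {M : ℕ} {s : Mem} (hF : I.nF ≤ M + 2) (hD : I.nD ≤ M + 2)
    (hc : Ctx I s) {F : Finset I.Pair} (hm : Marks s 10 F) :
    Ends M 40 labelP s fun s' => ∃ f : Fin I.nD → Fin I.nD, LabMem s' f ∧ (∀ j, f (f j) = f j) ∧
      Labels (I.Linked F) f := by
  classical
  refine Ends.seq (Q := fun s' => LabMem (I := I) s' id) ?_ ?_
  · refine Ends.exp (a := 6 + 5) ?_ (by norm_num)
    refine Ends.forFin (N := I.nD) (fun A s' => ∀ x ∈ A, s'.nat 11 x 0 = x) hD ?_ (by simp) ?_ ?_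
    · intro s' hag
      exact (hc.agree hag).nD
    · intro i A hi s' hag hx hI
      refine Ends.natSet fun x hxA => ?_
      simp only [var_eval, const_eval, hx, Mem.setNat_nat_eq, and_true, Fin.val_inj]
      split_ifs with h
      · rw [h]
      · exact hI x ((Finset.mem_insert.1 hxA).resolve_left h)
    · intro s' hag hI x
      exact hI x (Finset.mem_univ _)
  intro s₁ hag₁ hlab
  replace hc := hc.agree hag₁
  replace hm := hm.agree hag₁
  refine Ends.exp (a := 27 + 10) ?_ (by norm_num)
  refine Ends.forPairs (N := I.nF) (K := I.nD) (fun A s' => ∃ f : Fin I.nD → Fin I.nD, LabMem s' f ∧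
    (∀ j, f (f j) = f j) ∧ Labels (I.Linked (F ∩ A)) f) hF hD ?_ ?_ ?_ ?_
  · intro s' hag
    exact ⟨(hc.agree hag).nF, (hc.agree hag).nD⟩
  · refine ⟨id, hlab, fun _ => rfl, fun x y => ⟨fun h => by cases h; exact .refl _, fun h => ?_⟩⟩
    induction h with
    | rel x y h => obtain ⟨u, hu, -⟩ := h; simp at hu
    | refl x => rfl
    | symm x y _ ih => exact ih.symm
    | trans x y z _ _ ih ih' => exact ih.trans ih'
  · intro i j A hij s₂ hag₂ hi hj hI
    have hc₂ := hc.agree hag₂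
    have hm₂ := hm.agree hag₂
    refine Ends.ite ?_ ?_
    · intro ht
      simp only [natEq_eval, get_eval, var_eval, const_eval, hi, hj, hm₂ i j] at ht
      obtain ⟨f₀, hf₀, hid₀, hl₀⟩ := hI
      refine Ends.forFin (N := I.nD) (fun B s' => ∃ f : Fin I.nD → Fin I.nD, LabMem s' f ∧
        (∀ j, f (f j) = f j) ∧ Labels (fun x y => I.Linked (F ∩ A) x y ∨
          (x = j ∧ y ∈ B ∧ y ∈ I.ball (i, j))) f) hD ?_ ?_ ?_ ?_
      · intro s' hag
        exact (hc₂.agree hag).nD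
      · exact ⟨f₀, hf₀, hid₀, by simpa using hl₀⟩
      · intro x B hx s₃ hag₃ hx3 hI₃
        obtain ⟨f, hf, hid, hl⟩ := hI₃
        have hc₃ := hc₂.agree hag₃
        have hi₃ : s₃.nat 50 0 0 = i := by rw [hag₃.nat 50 (by decide), hi]
        have hj₃ : s₃.nat 51 0 0 = j := by rw [hag₃.nat 51 (by decide), hj]
        refine Ends.ite ?_ ?_
        · intro ht₃
          simp only [realLe_eval, ed, rget_eval, var_eval, hi₃, hj₃, hx3, hc₃.d] at ht₃
          refine (mergeP_spec hD hc₃ hj₃ hx3 hf).imp fun s' _ h => ⟨_, h, ?_, ?_⟩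
          · intro y
            by_cases hy : f y = f x
            · simp [hy, hid]
            · simp [hy, hid]
          · refine (hl.merge j x).congr ?_ ?_
            · rintro y z ((h | ⟨h1, h2, h3⟩) | ⟨rfl, rfl⟩)
              · exact .rel _ _ (Or.inl h)
              · exact .rel _ _ (Or.inr ⟨h1, Finset.mem_insert_of_mem h2, h3⟩)
              · exact .rel _ _ (Or.inr ⟨rfl, Finset.mem_insert_self _ _, Inst.mem_ball.2 ht₃⟩)
            · rintro y z (h | ⟨h1, h2, h3⟩)
              · exact .rel _ _ (Or.inl (Or.inl h))
              · rcases Finset.mem_insert.1 h2 with rfl | h2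
                · exact .rel _ _ (Or.inr ⟨h1, rfl⟩)
                · exact .rel _ _ (Or.inl (Or.inr ⟨h1, h2, h3⟩))
        · intro ht₃
          simp only [realLe_eval, ed, rget_eval, var_eval, hi₃, hj₃, hx3, hc₃.d] at ht₃
          refine Ends.skip ⟨f, hf, hid, hl.congr ?_ ?_⟩
          · rintro y z (h | ⟨h1, h2, h3⟩)
            · exact .rel _ _ (Or.inl h)
            · exact .rel _ _ (Or.inr ⟨h1, Finset.mem_insert_of_mem h2, h3⟩)
          · rintro y z (h | ⟨h1, h2, h3⟩)
            · exact .rel _ _ (Or.inl h)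
            · rcases Finset.mem_insert.1 h2 with rfl | h2
              · exact (ht₃ (Inst.mem_ball.1 h3)).elim
              · exact .rel _ _ (Or.inr ⟨h1, h2, h3⟩)
      · rintro s' - ⟨f, hf, hid, hl⟩
        refine ⟨f, hf, hid, hl.congr ?_ ?_⟩
        · rintro y z (⟨u, hu, h⟩ | ⟨rfl, -, h⟩)
          · refine .rel _ _ ⟨u, ?_, h⟩
            simp only [Finset.mem_inter, Finset.mem_insert] at hu ⊢
            exact ⟨hu.1, Or.inr hu.2⟩
          · exact .rel _ _ ⟨(i, y), by simp [ht], Inst.self_mem_ball (i, y), h⟩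
        · rintro y z ⟨u, hu, hy, hz⟩
          simp only [Finset.mem_inter, Finset.mem_insert] at hu
          rcases hu with ⟨hu, rfl | huA⟩
          · refine .trans _ j _ (.symm _ _ (.rel _ _ (Or.inr ⟨rfl, by simp, hy⟩)))
              (.rel _ _ (Or.inr ⟨rfl, by simp, hz⟩))
          · exact .rel _ _ (Or.inl ⟨u, Finset.mem_inter.2 ⟨hu, huA⟩, hy, hz⟩)
    · intro ht
      simp only [natEq_eval, get_eval, var_eval, const_eval, hi, hj, hm₂ i j] at ht
      refine Ends.skip ?_
      rwa [Finset.inter_insert_of_notMem ht]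
  · rintro s' - hI
    simpa using hI

/-! ### Choosing a center for every component -/

/-- Store in the real variable `10` how far the clients with the label in variable `54` are from the
facility in variable `55`. -/
def eccP : Prog :=
  .seq (setR 10 (.ofNat (.const 0)))
    (forN 57 eD (.ite (.and (natEq (.get 11 (var 57) (.const 0)) (var 54))
        (.not (.realLe (ed (var 55) (var 57)) (rvar 10))))
      (setR 10 (ed (var 55) (var 57))) .skip))

/-- The result is characterised as a least upper bound. The running maximum starts at `0`, hence the
restriction to `0 ≤ w`. -/
theorem eccP_spec {I : Inst} {M : ℕ} {s : Mem} (hD : I.nD ≤ M + 2) (hc : Ctx I s)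
    {f : Fin I.nD → Fin I.nD} (hf : LabMem s f) {l : Fin I.nD} {i : Fin I.nF}
    (hl : s.nat 54 0 0 = l) (hi : s.nat 55 0 0 = i) :
    Ends M 20 eccP s fun s' => (∀ j, f j = l → I.d i j ≤ s'.real 10 0 0) ∧
      ∀ w, 0 ≤ w → (∀ j, f j = l → I.d i j ≤ w) → s'.real 10 0 0 ≤ w := by
  refine Ends.realSet_seq ?_
  refine Ends.exp (a := 7 + 5) ?_ (by norm_num)
  refine Ends.forFin (N := I.nD) (fun A s' => (∀ j ∈ A, f j = l → I.d i j ≤ s'.real 10 0 0) ∧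
      ∀ w, 0 ≤ w → (∀ j, f j = l → I.d i j ≤ w) → s'.real 10 0 0 ≤ w) hD ?_ ?_ ?_ ?_
  · intro s' hag
    simp only [eD, var_eval, hag.nat 1 (by decide)]
    simpa using hc.nD
  · exact ⟨by simp, fun w hw _ => by simpa using hw⟩
  · intro j A hj s' hag hx hI
    have hd : ∀ (i : Fin I.nF) (j : Fin I.nD), s'.real 1 i j = I.d i j := by
      rw [hag.real 1 (by decide)]; simpa using hc.d
    have hl' : s'.nat 54 0 0 = l := by rw [hag.nat 54 (by decide)]; simpa using hl
    have hi' : s'.nat 55 0 0 = i := by rw [hag.nat 55 (by decide)]; simpa using hi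
    have hf' : LabMem s' f := by
      intro x; rw [hag.nat 11 (by decide)]; simpa using hf x
    refine Ends.ite ?_ ?_
    · intro ht
      simp only [and_eval, natEq_eval, get_eval, var_eval, const_eval, hx, hf' j, hl', Fin.val_inj,
        not_eval, realLe_eval, ed, rget_eval, hi', rvar_eval, hd, not_le] at ht
      refine Ends.realSet ?_
      simp only [var_eval, const_eval, hx, hi', ed, rget_eval, hd, Mem.setReal_real_self]
      refine ⟨fun j' hj' hfj' => ?_, fun w hw h => h j ht.1⟩
      rcases Finset.mem_insert.1 hj' with rfl | hj'
      · exact le_rfl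
      · exact (hI.1 j' hj' hfj').trans ht.2.le
    · intro ht
      simp only [and_eval, natEq_eval, get_eval, var_eval, const_eval, hx, hf' j, hl', Fin.val_inj,
        not_eval, realLe_eval, ed, rget_eval, hi', rvar_eval, hd, not_and, not_not] at ht
      refine Ends.skip ⟨fun j' hj' hfj' => ?_, hI.2⟩
      rcases Finset.mem_insert.1 hj' with rfl | hj'
      · exact ht hfj'
      · exact hI.1 j' hj' hfj'
  · exact fun s' _ hI => ⟨fun j => hI.1 j (Finset.mem_univ _), hI.2⟩

/-- Facility `i` is a best center for the clients with label `l`, among the centers of balls of `F`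
with this label, and serves them within distance `v`. -/
structure BestCenter {I : Inst} (F : Finset I.Pair) (f : Fin I.nD → Fin I.nD) (l : Fin I.nD)
    (i : Fin I.nF) (v : ℝ) : Prop where
  mem : ∃ j, (i, j) ∈ F ∧ f j = l
  le : ∀ j, f j = l → I.d i j ≤ v
  min : ∀ u ∈ F, f u.2 = l → ∀ w, 0 ≤ w → (∀ j, f j = l → I.d u.1 j ≤ w) → v ≤ w

/-- Find a best center for the label in variable `54`; variable `62` tells whether there is one. -/
def bestP : Prog :=
  .seq (setV 62 (.const 0))
    (forPairs 55 56 eF eD (.ite (.and (natEq (.get 10 (var 55) (var 56)) (.const 1))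
        (natEq (.get 11 (var 56) (.const 0)) (var 54)))
      (.seq eccP (.ite (.and (natEq (var 62) (.const 1)) (.realLe (rvar 11) (rvar 10))) .skip
        (.seq (setR 11 (rvar 10)) (.seq (.natSet 12 (var 54) (.const 0) (var 55))
          (setV 62 (.const 1))))))
      .skip))

/-- The array `12` is written, so the frame rule says nothing about it; the last clause protects the
centers chosen for other labels. -/
theorem bestP_spec {I : Inst} {M : ℕ} {s : Mem} (hF : I.nF ≤ M + 2) (hD : I.nD ≤ M + 2)
    (hc : Ctx I s) {F : Finset I.Pair} (hm : Marks s 10 F)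
    {f : Fin I.nD → Fin I.nD} (hf : LabMem s f) {l : Fin I.nD} (hl : s.nat 54 0 0 = l) :
    Ends M 40 bestP s fun s' =>
      ((s'.nat 62 0 0 = 1 ∧ ∃ i : Fin I.nF, s'.nat 12 l 0 = i ∧ BestCenter F f l i (s'.real 11 0 0)) ∨
        (s'.nat 62 0 0 = 0 ∧ ∀ u ∈ F, f u.2 ≠ l)) ∧
      ∀ l' : Fin I.nD, l' ≠ l → s'.nat 12 l' 0 = s.nat 12 l' 0 := by
  classical
  refine Ends.natSet_seq ?_
  refine Ends.exp (a := 25 + 10) ?_ (by norm_num)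
  refine Ends.forPairs (N := I.nF) (K := I.nD) (fun A s' =>
      ((s'.nat 62 0 0 = 1 ∧ ∃ i : Fin I.nF, s'.nat 12 l 0 = i ∧
          BestCenter (F ∩ A) f l i (s'.real 11 0 0)) ∨
        (s'.nat 62 0 0 = 0 ∧ ∀ u ∈ F ∩ A, f u.2 ≠ l)) ∧
      ∀ l' : Fin I.nD, l' ≠ l → s'.nat 12 l' 0 = s.nat 12 l' 0) hF hD ?_ ?_ ?_ ?_
  · intro s' hag
    simp only [eF, eD, var_eval, hag.nat 0 (by decide), hag.nat 1 (by decide)]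
    simpa using ⟨hc.nF, hc.nD⟩
  · exact ⟨Or.inr (by simp), by simp⟩
  · intro i j A hij s₁ hag hi hj hI
    have hc₁ : Ctx I s₁ := Ctx.agree (s := s.setNat 62 0 0 0) ⟨hc.nF, hc.nD, hc.k, hc.L, hc.d⟩ hag
    have hm₁ : Marks s₁ 10 F := Marks.agree (s := s.setNat 62 0 0 0) hm hag
    have hf₁ : LabMem s₁ f := LabMem.agree (s := s.setNat 62 0 0 0) hf hag
    have hl₁ : s₁.nat 54 0 0 = l := by rw [hag.nat 54 (by decide)]; simpa using hl
    refine Ends.ite ?_ ?_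
    · intro ht
      simp only [and_eval, natEq_eval, get_eval, var_eval, const_eval, hi, hj, hm₁ i j, hf₁ j, hl₁,
        Fin.val_inj] at ht
      have hins : F ∩ insert (i, j) A = insert (i, j) (F ∩ A) :=
        Finset.inter_insert_of_mem ht.1
      rw [hins]
      refine Ends.seq ((eccP_spec hD hc₁ hf₁ hl₁ hi).exp (b := 23) (by norm_num)) ?_
      intro s₂ hag₂ hecc
      have h62 : s₂.nat 62 = s₁.nat 62 := hag₂.nat 62 (by decide)
      have h12 : s₂.nat 12 = s₁.nat 12 := hag₂.nat 12 (by decide)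
      have h11 : s₂.real 11 = s₁.real 11 := hag₂.real 11 (by decide)
      have hl₂ : s₂.nat 54 0 0 = l := by rw [hag₂.nat 54 (by decide), hl₁]
      have hi₂ : s₂.nat 55 0 0 = i := by rw [hag₂.nat 55 (by decide), hi]
      refine Ends.ite ?_ ?_
      · intro ht₂
        simp only [and_eval, natEq_eval, var_eval, const_eval, realLe_eval, rvar_eval, h62, h11] at ht₂
        refine Ends.skip ⟨Or.inl ⟨by rw [h62, ht₂.1], ?_⟩, by rw [h12]; exact hI.2⟩
        rcases hI.1 with ⟨-, i', h1, h2⟩ | ⟨h, -⟩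
        · rw [h11, h12]
          refine ⟨i', h1, ?_, h2.le, ?_⟩
          · obtain ⟨j', h, h'⟩ := h2.mem
            exact ⟨j', Finset.mem_insert_of_mem h, h'⟩
          · intro u hu hul w hw hwle
            rcases Finset.mem_insert.1 hu with rfl | hu
            · exact ht₂.2.trans (hecc.2 w hw hwle)
            · exact h2.min u hu hul w hw hwle
        · rw [h] at ht₂; simp at ht₂
      · intro ht₂
        simp only [and_eval, natEq_eval, var_eval, const_eval, realLe_eval, rvar_eval, h62, h11,
          not_and, not_le] at ht₂
        refine Ends.realSet_seq (Ends.natSet_seq (Ends.natSet ?_))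
        simp only [var_eval, const_eval, rvar_eval, Mem.setReal_nat, hl₂, hi₂]
        refine ⟨Or.inl ⟨by simp, i, by simp, ⟨j, Finset.mem_insert_self _ _, ht.2⟩, ?_, ?_⟩, ?_⟩
        · simpa using hecc.1
        · simp only [Mem.setNat_real, Mem.setReal_real_self]
          intro u hu hul w hw hwle
          rcases Finset.mem_insert.1 hu with rfl | hu
          · exact hecc.2 w hw hwle
          · rcases hI.1 with ⟨h1, i', -, h2⟩ | ⟨-, h⟩
            · exact (ht₂ h1).le.trans (h2.min u hu hul w hw hwle)
            · exact (h u hu hul).elim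
        · intro l' hl'
          have := hI.2 l' hl'
          simpa [Mem.setNat_nat_eq, Fin.val_inj, hl', h12] using this
    · intro ht
      simp only [and_eval, natEq_eval, get_eval, var_eval, const_eval, hi, hj, hm₁ i j, hf₁ j, hl₁,
        Fin.val_inj, not_and] at ht
      refine Ends.skip ⟨?_, hI.2⟩
      by_cases hF' : (i, j) ∈ F
      · rw [Finset.inter_insert_of_mem hF']
        rcases hI.1 with ⟨h1, i', h2, h3⟩ | ⟨h1, h2⟩
        · refine Or.inl ⟨h1, i', h2, ?_, h3.le, ?_⟩
          · obtain ⟨j', h, h'⟩ := h3.mem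
            exact ⟨j', Finset.mem_insert_of_mem h, h'⟩
          · intro u hu hul
            rcases Finset.mem_insert.1 hu with rfl | hu
            · exact (ht hF' hul).elim
            · exact h3.min u hu hul
        · refine Or.inr ⟨h1, fun u hu => ?_⟩
          rcases Finset.mem_insert.1 hu with rfl | hu
          · exact ht hF'
          · exact h2 u hu
      · rw [Finset.inter_insert_of_notMem hF']
        exact hI.1
  · intro s' _ hI
    simpa using hI

/-- Choose the centers. The variables `63` and `64` hold the number of components and whether all of
them have a center, the real variable `9` the sum of their radii. -/
def centersP : Prog :=
  .seq (setV 63 (.const 0)) (.seq (setV 64 (.const 1)) (.seq (setR 9 (.ofNat (.const 0)))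
    (forN 54 eD (.ite (natEq (.get 11 (var 54) (.const 0)) (var 54))
      (.seq (setV 63 (.add (var 63) (.const 1))) (.seq bestP
        (.ite (natEq (var 62) (.const 1)) (setR 9 (.add (rvar 9) (rvar 11))) (setV 64 (.const 0)))))
      .skip))))

/-- Only fixed points of `f` are treated, one per component. The family need not cover, so a
component may contain no boundary client of a marked ball; variable `64` then becomes `0`. -/
theorem centersP_spec {I : Inst} {M : ℕ} {s : Mem} (hF : I.nF ≤ M + 2) (hD : I.nD ≤ M + 2)
    (hc : Ctx I s) {F : Finset I.Pair} (hm : Marks s 10 F)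
    {f : Fin I.nD → Fin I.nD} (hf : LabMem s f) :
    Ends M 60 centersP s fun s' => s'.nat 63 0 0 = (Finset.univ.filter fun l => f l = l).card ∧
      ((s'.nat 64 0 0 = 1 ∧ ∃ e : Fin I.nD → ℝ,
          s'.real 9 0 0 = ∑ l ∈ Finset.univ.filter (fun l => f l = l), e l ∧
          ∀ l, f l = l → ∃ i : Fin I.nF, s'.nat 12 l 0 = i ∧ BestCenter F f l i (e l)) ∨
        (s'.nat 64 0 0 = 0 ∧ ∃ l, f l = l ∧ ∀ u ∈ F, f u.2 ≠ l)) := by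
  classical
  refine Ends.natSet_seq (Ends.natSet_seq (Ends.realSet_seq ?_))
  refine Ends.exp (a := 50 + 5) ?_ (by norm_num)
  refine Ends.forFin (N := I.nD) (fun A s' =>
      s'.nat 63 0 0 = (A.filter fun l => f l = l).card ∧
      ((s'.nat 64 0 0 = 1 ∧ ∃ e : Fin I.nD → ℝ,
          s'.real 9 0 0 = ∑ l ∈ A.filter (fun l => f l = l), e l ∧
          ∀ l ∈ A, f l = l → ∃ i : Fin I.nF, s'.nat 12 l 0 = i ∧ BestCenter F f l i (e l)) ∨
        (s'.nat 64 0 0 = 0 ∧ ∃ l, f l = l ∧ ∀ u ∈ F, f u.2 ≠ l))) hD ?_ ?_ ?_ ?_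
  · intro s' hag
    simp only [eD, var_eval, hag.nat 1 (by decide)]
    simpa using hc.nD
  · exact ⟨by simp, Or.inl ⟨by simp, fun _ => 0, by simp, by simp⟩⟩
  · intro l A hlA s₁ hag hl hI
    have hc₁ : Ctx I s₁ := Ctx.agree (s := ((s.setNat 63 0 0 0).setNat 64 0 0 1).setReal 9 0 0 (0:ℕ))
      ⟨hc.nF, hc.nD, hc.k, hc.L, hc.d⟩ hag
    have hm₁ : Marks s₁ 10 F :=
      Marks.agree (s := ((s.setNat 63 0 0 0).setNat 64 0 0 1).setReal 9 0 0 (0:ℕ)) hm hag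
    have hf₁ : LabMem s₁ f :=
      LabMem.agree (s := ((s.setNat 63 0 0 0).setNat 64 0 0 1).setReal 9 0 0 (0:ℕ)) hf hag
    refine Ends.ite ?_ ?_
    · intro ht
      simp only [natEq_eval, get_eval, var_eval, const_eval, hl, hf₁ l, Fin.val_inj] at ht
      have hfil : (insert l A).filter (fun l => f l = l) = insert l (A.filter fun l => f l = l) := by
        rw [Finset.filter_insert, if_pos ht]
      have hnot : l ∉ A.filter fun l => f l = l := fun h => hlA (Finset.mem_filter.1 h).1
      refine Ends.natSet_seq ?_
      set s₂ := s₁.setNat 63 0 0 (s₁.nat 63 0 0 + 1) with hs₂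
      change Ends M 48 _ s₂ _
      refine Ends.seq ((bestP_spec (s := s₂) hF hD ⟨hc₁.nF, hc₁.nD, hc₁.k, hc₁.L, hc₁.d⟩ hm₁ hf₁
        (l := l) hl).exp (by norm_num)) ?_
      intro s₃ hag₃ h₃
      have h63 : s₃.nat 63 0 0 = s₁.nat 63 0 0 + 1 := by
        rw [hag₃.nat 63 (by decide)]; simp [hs₂]
      have h64 : s₃.nat 64 = s₁.nat 64 := by
        rw [hag₃.nat 64 (by decide)]; simp [hs₂]
      have h9 : s₃.real 9 = s₁.real 9 := by
        rw [hag₃.real 9 (by decide)]; simp [hs₂]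
      have h12 : ∀ l' : Fin I.nD, l' ≠ l → s₃.nat 12 l' 0 = s₁.nat 12 l' 0 := fun l' h => by
        rw [h₃.2 l' h]; simp [hs₂]
      have hcnt : s₃.nat 63 0 0 = ((insert l A).filter fun l => f l = l).card := by
        rw [h63, hI.1, hfil, Finset.card_insert_of_notMem hnot]
      refine Ends.ite ?_ ?_
      · intro ht₃
        simp only [natEq_eval, var_eval, const_eval] at ht₃
        refine Ends.realSet ?_
        simp only [const_eval, radd_eval, rvar_eval, Mem.setReal_nat, Mem.setReal_real_self, h64]
        refine ⟨hcnt, ?_⟩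
        rcases hI.2 with ⟨hv, e, he, hctr⟩ | h
        · rcases h₃.1 with ⟨-, i, hi, hbest⟩ | ⟨h0, -⟩
          · refine Or.inl ⟨hv, Function.update e l (s₃.real 11 0 0), ?_, ?_⟩
            · rw [hfil, Finset.sum_insert hnot, h9, he]
              simp only [Function.update_self]
              rw [add_comm]
              congr 1
              refine Finset.sum_congr rfl fun x hx => ?_
              rw [Function.update_of_ne]
              rintro rfl
              exact hnot hx
            · intro l' hl' hfl'
              by_cases h : l' = l
              · subst h
                exact ⟨i, hi, by simpa using hbest⟩
              · obtain ⟨i', hi', hb'⟩ := hctr l' ((Finset.mem_insert.1 hl').resolve_left h) hfl'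
                exact ⟨i', by rw [h12 l' h, hi'], by rwa [Function.update_of_ne h]⟩
          · omega
        · exact Or.inr h
      · intro ht₃
        simp only [natEq_eval, var_eval, const_eval] at ht₃
        refine Ends.natSet ⟨?_, Or.inr ⟨by simp, ?_⟩⟩
        · simpa using hcnt
        · rcases h₃.1 with ⟨h1, -⟩ | ⟨-, h⟩
          · exact (ht₃ h1).elim
          · exact ⟨l, ht, h⟩
    · intro ht
      simp only [natEq_eval, get_eval, var_eval, const_eval, hl, hf₁ l, Fin.val_inj] at ht
      have hfil : (insert l A).filter (fun l => f l = l) = A.filter fun l => f l = l := by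
        rw [Finset.filter_insert, if_neg ht]
      refine Ends.skip ?_
      rw [hfil]
      refine ⟨hI.1, hI.2.imp_left ?_⟩
      rintro ⟨hv, e, he, hctr⟩
      refine ⟨hv, e, he, fun l' hl' hfl' => ?_⟩
      rcases Finset.mem_insert.1 hl' with rfl | hl'
      · exact (ht hfl').elim
      · exact hctr l' hl' hfl'
  · intro s' _ hI
    refine ⟨hI.1, hI.2.imp_left ?_⟩
    rintro ⟨hv, e, he, hctr⟩
    exact ⟨hv, e, he, fun l => hctr l (Finset.mem_univ _)⟩

/-! ### Evaluating a family of balls -/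

/-- The recorded solution, if there is one, is feasible and costs at most the real variable `5`. -/
def Sol (I : Inst) (s : Mem) : Prop :=
  s.nat 13 0 0 = 1 → ∃ S σ, Outputs I s S σ ∧ I.Feasible S σ ∧ I.cost S σ ≤ s.real 5 0 0

/-- A solution of cost at most `V` is recorded. -/
def Good (V : ℝ) (s : Mem) : Prop := s.nat 13 0 0 = 1 ∧ s.real 5 0 0 ≤ V

theorem Good.mono {V V' : ℝ} {s : Mem} (h : Good V s) (hV : V ≤ V') : Good V' s :=
  ⟨h.1, h.2.trans hV⟩

theorem Good.agree {V : ℝ} {s s' : Mem} {wn wr : List ℕ} (h : Good V s) (hag : Agree wn wr s s')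
    (hn : 13 ∉ wn := by decide) (hr : 5 ∉ wr := by decide) : Good V s' := by
  unfold Good; rw [hag.nat 13 hn, hag.real 5 hr]; exact h

theorem Sol.agree {I : Inst} {s s' : Mem} {wn wr : List ℕ} (h : Sol I s) (hag : Agree wn wr s s')
    (hn : ∀ x ∈ [4, 5, 13], x ∉ wn := by decide) (hr : 5 ∉ wr := by decide) : Sol I s' := by
  unfold Sol Outputs
  rw [hag.nat 13 (hn 13 (by simp)), hag.real 5 hr, hag.nat 4 (hn 4 (by simp)),
    hag.nat 5 (hn 5 (by simp))]
  exact h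

theorem image_eq_filter {α : Type*} [Fintype α] [DecidableEq α] {f : α → α}
    (hid : ∀ j, f (f j) = f j) : Finset.univ.image f = Finset.univ.filter fun l => f l = l := by
  ext l
  simp only [Finset.mem_image, Finset.mem_univ, true_and, Finset.mem_filter]
  exact ⟨fun ⟨j, h⟩ => by rw [← h, hid], fun h => ⟨l, h⟩⟩

/-- Serving every component by a center of one of its balls is feasible. -/
theorem feasible_of_centers {I : Inst} {F : Finset I.Pair} (hL : ∀ u ∈ F, I.L u.1 ≤ (I.ball u).card)
    {f : Fin I.nD → Fin I.nD} (hid : ∀ j, f (f j) = f j) (hf : Labels (I.Linked F) f)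
    {e : Fin I.nD → ℝ} {σ : Fin I.nD → Fin I.nF} (hσ : ∀ j j', f j = f j' → σ j = σ j')
    (hbest : ∀ j, BestCenter F f (f j) (σ j) (e (f j)))
    (hk : (Finset.univ.filter fun l => f l = l).card ≤ I.k) :
    I.Feasible (Finset.univ.image σ) σ ∧
      I.cost (Finset.univ.image σ) σ ≤ ∑ l ∈ Finset.univ.filter (fun l => f l = l), e l := by
  classical
  have hσf : ∀ j, σ (f j) = σ j := fun j => hσ _ _ (hid j)
  have hmem : ∀ j, f j ∈ Finset.univ.filter fun l => f l = l := fun j => by simp [hid]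
  have he : ∀ l ∈ Finset.univ.filter (fun l => f l = l), 0 ≤ e l := by
    intro l hl
    have hl' : f l = l := (Finset.mem_filter.1 hl).2
    have := (hbest l).le l rfl
    rw [hl'] at this
    exact (I.c_nonneg _ _).trans this
  have himg : Finset.univ.image σ = (Finset.univ.filter fun l => f l = l).image σ := by
    ext i
    simp only [Finset.mem_image, Finset.mem_univ, true_and]
    exact ⟨fun ⟨j, h⟩ => ⟨f j, hmem j, by rw [hσf, h]⟩, fun ⟨j, _, h⟩ => ⟨j, h⟩⟩
  refine ⟨⟨?_, fun j => Finset.mem_image_of_mem _ (Finset.mem_univ _), ?_⟩, ?_⟩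
  · rw [himg]
    exact Finset.card_image_le.trans hk
  · intro i hi
    obtain ⟨j, -, rfl⟩ := Finset.mem_image.1 hi
    obtain ⟨j₀, hj₀, hfj₀⟩ := (hbest j).mem
    -- All clients of the ball that justified this center lie in its component and are thus assigned
    -- to it.
    refine (hL _ hj₀).trans (Finset.card_le_card fun x hx => ?_)
    have : f x = f j := by
      rw [← hfj₀]
      exact (hf _ _).2 (Inst.linked_of_mem hj₀ hx (Inst.self_mem_ball _))
    simp [hσ x j this]
  · have hmaps : ∀ l ∈ Finset.univ.filter (fun l => f l = l), σ l ∈ Finset.univ.image σ :=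
      fun l _ => Finset.mem_image_of_mem _ (Finset.mem_univ _)
    -- Several components may share a facility; its radius is then a maximum, bounded by the sum of
    -- their values.
    rw [← Finset.sum_fiberwise_of_maps_to hmaps]
    refine Finset.sum_le_sum fun i _ => ?_
    have hnn : ∀ l ∈ (Finset.univ.filter fun l => f l = l).filter fun l => σ l = i, 0 ≤ e l :=
      fun l hl => he l (Finset.mem_filter.1 hl).1
    refine Inst.radius_le σ i (Finset.sum_nonneg hnn) fun j hj => ?_
    subst hj
    refine ((hbest j).le j rfl).trans (Finset.single_le_sum hnn ?_)
    exact Finset.mem_filter.2 ⟨hmem j, hσf j⟩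

/-- Record the solution that serves every component by the chosen center. -/
def recordP : Prog :=
  .seq (setR 5 (rvar 9)) (.seq (setV 13 (.const 1))
    (.seq (forN 58 eF (.natSet 4 (var 58) (.const 0) (.const 0)))
      (forN 58 eD (.seq (.natSet 5 (var 58) (.const 0) (.get 12 (.get 11 (var 58) (.const 0)) (.const 0)))
        (.natSet 4 (.get 12 (.get 11 (var 58) (.const 0)) (.const 0)) (.const 0) (.const 1))))))

theorem recordP_spec {I : Inst} {M : ℕ} {s : Mem} (hF : I.nF ≤ M + 2) (hD : I.nD ≤ M + 2)
    (hc : Ctx I s) {f : Fin I.nD → Fin I.nD} (hf : LabMem s f) {σ : Fin I.nD → Fin I.nF}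
    (hσ : ∀ j, s.nat 12 (f j) 0 = σ j) :
    Ends M 30 recordP s fun s' => s'.nat 13 0 0 = 1 ∧ s'.real 5 0 0 = s.real 9 0 0 ∧
      Outputs I s' (Finset.univ.image σ) σ := by
  classical
  refine Ends.realSet_seq (Ends.natSet_seq ?_)
  set s₁ := (s.setReal 5 0 0 (s.real 9 0 0)).setNat 13 0 0 1 with hs₁
  change Ends M 28 _ s₁ _
  have hc₁ : Ctx I s₁ := ⟨hc.nF, hc.nD, hc.k, hc.L, hc.d⟩
  have hf₁ : LabMem s₁ f := hf
  have hσ₁ : ∀ j, s₁.nat 12 (f j) 0 = σ j := hσ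
  have h13 : s₁.nat 13 0 0 = 1 := by simp [hs₁]
  have h5 : s₁.real 5 0 0 = s.real 9 0 0 := by simp [hs₁]
  clear_value s₁
  -- A previously recorded solution may have left ones in array `4`.
  refine Ends.seq (Q := fun s' => ∀ i : Fin I.nF, s'.nat 4 i 0 = 0) ?_ ?_
  · refine Ends.exp (a := 6 + 5) ?_ (by norm_num)
    refine Ends.forFin (N := I.nF) (fun A s' => ∀ x ∈ A, s'.nat 4 x 0 = 0) hF ?_ (by simp) ?_ ?_
    · exact fun s' hag => (hc₁.agree hag).nF
    · intro i A hi s' hag hx hI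
      refine Ends.natSet fun x hxA => ?_
      simp only [var_eval, const_eval, hx, Mem.setNat_nat_eq, and_true, Fin.val_inj]
      split_ifs with h
      · rfl
      · exact hI x ((Finset.mem_insert.1 hxA).resolve_left h)
    · exact fun s' _ hI x => hI x (Finset.mem_univ _)
  intro s₂ hag₂ h4
  replace hc₁ := hc₁.agree hag₂
  replace hf₁ := hf₁.agree hag₂
  rw [← hag₂.nat 12 (by decide)] at hσ₁
  rw [← hag₂.nat 13 (by decide)] at h13
  rw [← hag₂.real 5 (by decide)] at h5
  refine Ends.exp (a := 7 + 5) ?_ (by norm_num)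
  refine Ends.forFin (N := I.nD) (fun A s' => (∀ i : Fin I.nF, s'.nat 4 i 0 = 1 ↔ i ∈ A.image σ) ∧
    ∀ j ∈ A, s'.nat 5 j 0 = σ j) hD ?_ (by simp [h4]) ?_ ?_
  · exact fun s' hag => (hc₁.agree hag).nD
  · intro j A hj s₃ hag hx hI
    have hf₃ := hf₁.agree hag
    have hσ₃ := hσ₁
    rw [← hag.nat 12 (by decide)] at hσ₃
    refine Ends.natSet_seq (Ends.natSet ?_)
    simp only [get_eval, var_eval, const_eval, hx, hf₃ j, hσ₃ j, Mem.setNat_nat_ne, ne_eq,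
      not_false_eq_true, Nat.reduceEqDiff, Mem.setNat_nat_eq, and_true,
      Fin.val_inj]
    refine ⟨fun i => ?_, fun j' hj' => ?_⟩
    · rw [Finset.image_insert, Finset.mem_insert, ← hI.1 i]
      split_ifs with h
      · simp [h]
      · simp [h]
    · split_ifs with h
      · rw [h]
      · exact hI.2 j' ((Finset.mem_insert.1 hj').resolve_left h)
  · intro s' hag hI
    refine ⟨?_, ?_, fun i => (hI.1 i).symm, fun j => hI.2 j (Finset.mem_univ _)⟩
    · rw [hag.nat 13 (by decide), h13]
    · rw [hag.real 5 (by decide), h5]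

/-- Evaluate the marked family and record its solution if it is the best one so far. -/
def evaluateP : Prog :=
  .seq labelP (.seq centersP
    (.ite (.and (natEq (var 64) (.const 1)) (.and (.natLe (var 63) (var 2))
        (.not (.and (natEq (var 13) (.const 1)) (.realLe (rvar 5) (rvar 9))))))
      recordP .skip))

/-- Correctness of the record and its monotonicity hold for every family of allowed balls, so wrong
guesses do no harm; only the guarantee requires covering and few components. -/
theorem evaluateP_spec {I : Inst} {M : ℕ} {s : Mem} (hF : I.nF ≤ M + 2) (hD : I.nD ≤ M + 2)
    (hc : Ctx I s) {F : Finset I.Pair} (hm : Marks s 10 F)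
    (hL : ∀ u ∈ F, I.L u.1 ≤ (I.ball u).card) (hsol : Sol I s) :
    Ends M 70 evaluateP s fun s' => Sol I s' ∧ (∀ V, Good V s → Good V s') ∧
      (I.Covers F → I.numComp F ≤ I.k →
        ∃ S ⊆ F, I.Packing S ∧ Good (3.83 * ∑ u ∈ S, I.rad u) s') := by
  classical
  refine Ends.seq ((labelP_spec hF hD hc hm).exp (by norm_num)) ?_
  rintro s₁ hag₁ ⟨f, hf, hid, hlab⟩
  refine Ends.seq ((centersP_spec hF hD (hc.agree hag₁) (hm.agree hag₁) hf).exp (by norm_num)) ?_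
  rintro s₂ hag₂ ⟨hcnt, hctr⟩
  have hc₂ := (hc.agree hag₁).agree hag₂
  have hf₂ := hf.agree hag₂
  have hsol₂ : Sol I s₂ := (hsol.agree hag₁).agree hag₂
  have hgood₂ : ∀ V, Good V s → Good V s₂ := fun V h => (h.agree hag₁).agree hag₂
  have hcard : (Finset.univ.filter fun l => f l = l).card = I.numComp F := by
    rw [← image_eq_filter hid, Inst.card_image_eq_numComp hlab]
  have htot : I.Covers F → s₂.nat 64 0 0 = 1 ∧
      ∃ S ⊆ F, I.Packing S ∧ s₂.real 9 0 0 ≤ 3.83 * ∑ u ∈ S, I.rad u := by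
    intro hcov
    rcases hctr with ⟨hv, e, he, hbest⟩ | ⟨-, l, hl, hno⟩
    · refine ⟨hv, ?_⟩
      obtain ⟨S, hSF, hS, w, hw0, hw, hsum⟩ := Inst.exists_packing_centers hcov hlab
      refine ⟨S, hSF, hS, le_trans ?_ hsum⟩
      rw [he, image_eq_filter hid]
      refine Finset.sum_le_sum fun l hl => ?_
      have hl' : f l = l := (Finset.mem_filter.1 hl).2
      obtain ⟨i, -, hb⟩ := hbest l hl'
      obtain ⟨u, hu, hul, hle⟩ := hw l
      rw [hl'] at hul hle
      exact hb.min u hu hul _ (hw0 l) hle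
    · obtain ⟨u, hu, hju⟩ := hcov l
      refine (hno u hu ?_).elim
      rw [← hl]
      exact (hlab _ _).2 (Inst.linked_of_mem hu (Inst.self_mem_ball u) hju)
  refine Ends.exp (a := 40) (Ends.ite ?_ ?_) (by norm_num)
  · intro ht
    simp only [and_eval, natEq_eval, var_eval, const_eval, natLe_eval, not_eval, realLe_eval,
      rvar_eval, hc₂.k, hcnt, not_and, not_le] at ht
    rcases hctr with ⟨-, e, he, hbest⟩ | ⟨h0, -⟩
    · have hbest' := fun j => hbest (f j) (hid j)
      choose σ hσ hb using hbest'
      have hσ' : ∀ j j', f j = f j' → σ j = σ j' := fun j j' h =>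
        Fin.ext (by rw [← hσ j, ← hσ j', h])
      obtain ⟨hfeas, hcost⟩ := feasible_of_centers hL hid hlab hσ' hb ht.2.1
      refine ((recordP_spec hF hD hc₂ hf₂ hσ).exp (by norm_num)).imp ?_
      rintro s' - ⟨h13, h5, hout⟩
      refine ⟨fun _ => ⟨_, σ, hout, hfeas, ?_⟩, ?_, ?_⟩
      · rw [h5, he]; exact hcost
      · intro V hV
        have hV₂ := hgood₂ V hV
        exact ⟨h13, by rw [h5]; exact (ht.2.2 hV₂.1).le.trans hV₂.2⟩
      · intro hcov _
        obtain ⟨-, S, hSF, hS, hle⟩ := htot hcov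
        exact ⟨S, hSF, hS, h13, by rw [h5]; exact hle⟩
    · omega
  · intro ht
    simp only [and_eval, natEq_eval, var_eval, const_eval, natLe_eval, not_eval, realLe_eval,
      rvar_eval, hc₂.k, hcnt, hcard] at ht
    refine Ends.skip ⟨hsol₂, hgood₂, fun hcov hk => ?_⟩
    obtain ⟨h64, S, hSF, hS, hle⟩ := htot hcov
    -- The other two conditions hold, so nothing was recorded only because an earlier solution is at
    -- least as good.
    have hb : s₂.nat 13 0 0 = 1 ∧ s₂.real 5 0 0 ≤ s₂.real 9 0 0 := by
      by_contra h
      exact ht ⟨h64, hk, h⟩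
    exact ⟨S, hSF, hS, hb.1, hb.2.trans hle⟩

/-! ### The dual solution -/

namespace Inst

variable (I : Inst)

/-- The slack of the dual constraint of a ball. -/
noncomputable def slack (lam : ℝ) (α : Fin I.nD → ℝ) (u : I.Pair) : ℝ :=
  I.rad u + lam - ∑ j ∈ I.ball u, α j

/-- The tight balls of `A`. -/
noncomputable def tight (A : Finset I.Pair) (lam : ℝ) (α : Fin I.nD → ℝ) : Finset I.Pair :=
  A.filter fun u => I.slack lam α u ≤ 0

variable {I}

theorem mem_tight {A : Finset I.Pair} {lam : ℝ} {α : Fin I.nD → ℝ} {u : I.Pair} :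
    u ∈ I.tight A lam α ↔ u ∈ A ∧ I.slack lam α u ≤ 0 := by
  simp [tight]

theorem slack_anti {lam : ℝ} {α α' : Fin I.nD → ℝ} (h : ∀ j, α j ≤ α' j) (u : I.Pair) :
    I.slack lam α' u ≤ I.slack lam α u := by
  unfold slack
  linarith [Finset.sum_le_sum fun j (_ : j ∈ I.ball u) => h j]

theorem slack_update (lam : ℝ) (α : Fin I.nD → ℝ) (j : Fin I.nD) (x : ℝ) (u : I.Pair) :
    I.slack lam (Function.update α j (α j + x)) u =
      if I.d u.1 j ≤ I.d u.1 u.2 then I.slack lam α u - x else I.slack lam α u := by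
  classical
  unfold slack
  have h : ∀ j', Function.update α j (α j + x) j' = α j' + if j' = j then x else 0 := by
    intro j'
    by_cases h : j' = j
    · subst h; simp
    · simp [h]
  simp only [h, Finset.sum_add_distrib, Finset.sum_ite_eq', mem_ball]
  split_ifs <;> ring

end Inst

/-- The array `4` of reals holds the slacks of the dual solution `α`, which is feasible for the
balls of `A`. -/
structure DualMem {I : Inst} (A : Finset I.Pair) (lam : ℝ) (α : Fin I.nD → ℝ) (s : Mem) : Prop where
  nonneg : ∀ j, 0 ≤ α j
  mem : ∀ (i : Fin I.nF) (j : Fin I.nD), s.real 4 i j = I.slack lam α (i, j)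
  feas : ∀ u ∈ A, 0 ≤ I.slack lam α u

theorem DualMem.agree {I : Inst} {s s' : Mem} {wn wr : List ℕ} {A : Finset I.Pair} {lam : ℝ}
    {α : Fin I.nD → ℝ} (h : DualMem A lam α s) (hag : Agree wn wr s s')
    (hr : 4 ∉ wr := by decide) : DualMem A lam α s' :=
  ⟨h.nonneg, by rw [hag.real 4 hr]; exact h.mem, h.feas⟩

/-! ### Raising the dual variables on the machine. -/

/-- Find the least slack of a ball of the array `9` around the client in variable `73`. -/
def minP : Prog :=
  forPairs 74 75 eF eD (.ite (.and (natEq (.get 9 (var 74) (var 75)) (.const 1))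
      (.and (.realLe (ed (var 74) (var 73)) (ed (var 74) (var 75)))
        (.not (.and (natEq (var 65) (.const 1)) (.realLe (rvar 8) (.get 4 (var 74) (var 75)))))))
    (.seq (setR 8 (.get 4 (var 74) (var 75))) (setV 65 (.const 1))) .skip)

theorem minP_spec {I : Inst} {M : ℕ} {s : Mem} (hF : I.nF ≤ M + 2) (hD : I.nD ≤ M + 2)
    (hc : Ctx I s) {A : Finset I.Pair} (hA : Marks s 9 A) {lam : ℝ} {α : Fin I.nD → ℝ}
    (hα : DualMem A lam α s) {j : Fin I.nD} (hj : s.nat 73 0 0 = j) (h0 : s.nat 65 0 0 = 0) :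
    Ends M 30 minP s fun s' =>
      (s'.nat 65 0 0 = 1 ∧ (∃ u ∈ A, j ∈ I.ball u ∧ I.slack lam α u = s'.real 8 0 0) ∧
        ∀ u ∈ A, j ∈ I.ball u → s'.real 8 0 0 ≤ I.slack lam α u) ∨
      (s'.nat 65 0 0 = 0 ∧ ∀ u ∈ A, j ∉ I.ball u) := by
  classical
  refine Ends.exp (a := 10 + 10) ?_ (by norm_num)
  refine Ends.forPairs (N := I.nF) (K := I.nD) (fun B s' =>
      (s'.nat 65 0 0 = 1 ∧ (∃ u ∈ A, j ∈ I.ball u ∧ I.slack lam α u = s'.real 8 0 0) ∧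
        ∀ u ∈ B, u ∈ A → j ∈ I.ball u → s'.real 8 0 0 ≤ I.slack lam α u) ∨
      (s'.nat 65 0 0 = 0 ∧ ∀ u ∈ B, u ∈ A → j ∉ I.ball u)) hF hD ?_ ?_ ?_ ?_
  · exact fun s' hag => ⟨(hc.agree hag).nF, (hc.agree hag).nD⟩
  · exact Or.inr ⟨h0, by simp⟩
  · intro i j' B hB s₁ hag hi hj' hI
    have hc₁ := hc.agree hag
    have hA₁ := hA.agree hag
    have hα₁ := hα.agree hag
    have hj₁ : s₁.nat 73 0 0 = j := by rw [hag.nat 73 (by decide), hj]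
    refine Ends.ite ?_ ?_
    · intro ht
      simp only [and_eval, natEq_eval, get_eval, var_eval, const_eval, hi, hj', hA₁ i j', realLe_eval,
        ed, rget_eval, hj₁, hc₁.d, not_eval, rvar_eval, hα₁.mem, not_and, not_le] at ht
      refine Ends.realSet_seq (Ends.natSet ?_)
      simp only [rget_eval, var_eval, const_eval, hi, hj', hα₁.mem, Mem.setNat_nat_self,
        Mem.setNat_real, Mem.setReal_real_self]
      refine Or.inl ⟨trivial, ⟨(i, j'), ht.1, Inst.mem_ball.2 ht.2.1, rfl⟩, ?_⟩
      intro u hu huA hju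
      rcases Finset.mem_insert.1 hu with rfl | hu
      · exact le_rfl
      · rcases hI with ⟨h1, -, h2⟩ | ⟨-, h2⟩
        · exact (ht.2.2 h1).le.trans (h2 u hu huA hju)
        · exact (h2 u hu huA hju).elim
    · intro ht
      simp only [and_eval, natEq_eval, get_eval, var_eval, const_eval, hi, hj', hA₁ i j', realLe_eval,
        ed, rget_eval, hj₁, hc₁.d, not_eval, rvar_eval, hα₁.mem] at ht
      refine Ends.skip ?_
      rcases hI with ⟨h1, h2, h3⟩ | ⟨h1, h2⟩
      · refine Or.inl ⟨h1, h2, fun u hu huA hju => ?_⟩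
        rcases Finset.mem_insert.1 hu with rfl | hu
        · by_contra h
          exact ht ⟨huA, Inst.mem_ball.1 hju, fun h' => h h'.2⟩
        · exact h3 u hu huA hju
      · refine Or.inr ⟨h1, fun u hu huA hju => ?_⟩
        rcases Finset.mem_insert.1 hu with rfl | hu
        · exact ht ⟨huA, Inst.mem_ball.1 hju, fun h => by omega⟩
        · exact h2 u hu huA hju
  · intro s' _ hI
    simpa using hI

/-- Raise the dual variable of the client in variable `73` by the real variable `8`. -/
def subP : Prog :=
  forPairs 74 75 eF eD (.ite (.realLe (ed (var 74) (var 73)) (ed (var 74) (var 75)))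
    (.realSet 4 (var 74) (var 75) (.sub (.get 4 (var 74) (var 75)) (rvar 8))) .skip)

theorem subP_spec {I : Inst} {M : ℕ} {s : Mem} (hF : I.nF ≤ M + 2) (hD : I.nD ≤ M + 2)
    (hc : Ctx I s) {lam : ℝ} {α : Fin I.nD → ℝ}
    (hα : ∀ (i : Fin I.nF) (j : Fin I.nD), s.real 4 i j = I.slack lam α (i, j))
    {j : Fin I.nD} (hj : s.nat 73 0 0 = j) :
    Ends M 30 subP s fun s' => ∀ (i : Fin I.nF) (j' : Fin I.nD),
      s'.real 4 i j' = I.slack lam (Function.update α j (α j + s.real 8 0 0)) (i, j') := by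
  classical
  refine Ends.exp (a := 10 + 10) ?_ (by norm_num)
  refine Ends.forPairs (N := I.nF) (K := I.nD) (fun B s' => ∀ (i : Fin I.nF) (j' : Fin I.nD),
      s'.real 4 i j' = if (i, j') ∈ B then
        I.slack lam (Function.update α j (α j + s.real 8 0 0)) (i, j') else I.slack lam α (i, j'))
      hF hD ?_ ?_ ?_ ?_
  · exact fun s' hag => ⟨(hc.agree hag).nF, (hc.agree hag).nD⟩
  · simpa using hα
  · intro i j' B hB s₁ hag hi hj' hI
    have hc₁ := hc.agree hag
    have hj₁ : s₁.nat 73 0 0 = j := by rw [hag.nat 73 (by decide), hj]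
    have h8 : s₁.real 8 0 0 = s.real 8 0 0 := by rw [hag.real 8 (by decide)]
    refine Ends.ite ?_ ?_
    · intro ht
      simp only [realLe_eval, ed, rget_eval, var_eval, hi, hj', hj₁, hc₁.d] at ht
      refine Ends.realSet fun i₂ j₂ => ?_
      simp only [var_eval, hi, hj', rsub_eval, rget_eval, rvar_eval, h8, Mem.setReal_real_eq,
        Fin.val_inj, hI i j', hB, if_false]
      by_cases h : i₂ = i ∧ j₂ = j'
      · obtain ⟨rfl, rfl⟩ := h
        simp [Inst.slack_update, ht]
      · have : (i₂, j₂) ≠ (i, j') := fun h' => h (by simpa using h')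
        rw [if_neg h, hI i₂ j₂]
        simp [this]
    · intro ht
      simp only [realLe_eval, ed, rget_eval, var_eval, hi, hj', hj₁, hc₁.d] at ht
      refine Ends.skip fun i₂ j₂ => ?_
      rw [hI i₂ j₂]
      by_cases h : (i₂, j₂) = (i, j')
      · obtain ⟨rfl, rfl⟩ := Prod.ext_iff.1 h
        simp only [Finset.mem_insert, true_or, if_true, Inst.slack_update]
        simp only at ht hB ⊢
        rw [if_neg hB, if_neg ht]
      · simp [h]
  · intro s' _ hI i x
    simpa using hI i x

/-- Raise the dual variables of the clients that are not marked in array `8` as far as possible. -/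
def raiseP : Prog :=
  forN 73 eD (.ite (natEq (.get 8 (var 73) (.const 0)) (.const 1)) .skip
    (.seq (setV 65 (.const 0)) (.seq minP (.ite (natEq (var 65) (.const 1)) subP .skip))))

/-- Raising a client by the least slack of the balls around it keeps all slacks nonnegative and
makes one of these balls tight. Later raises only lower slacks, so one pass over the clients
suffices. Clients with `cov` are skipped; for the guess this keeps their dual variables zero. -/
theorem raiseP_spec {I : Inst} {M : ℕ} {s : Mem} (hF : I.nF ≤ M + 2) (hD : I.nD ≤ M + 2)
    (hc : Ctx I s) {A : Finset I.Pair} (hA : Marks s 9 A) {cov : Fin I.nD → Prop}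
    (hcov : ∀ j : Fin I.nD, s.nat 8 j 0 = 1 ↔ cov j) {lam : ℝ} {α : Fin I.nD → ℝ}
    (hα : DualMem A lam α s) :
    Ends M 50 raiseP s fun s' => ∃ α', DualMem A lam α' s' ∧ (∀ j, α j ≤ α' j) ∧
      (∀ j, cov j → α' j = α j) ∧
      ∀ j, ¬ cov j → (∃ u ∈ A, j ∈ I.ball u) → ∃ u ∈ I.tight A lam α', j ∈ I.ball u := by
  classical
  refine Ends.exp (a := 40 + 5) ?_ (by norm_num)
  refine Ends.forFin (N := I.nD) (fun B s' => ∃ α', DualMem A lam α' s' ∧ (∀ j, α j ≤ α' j) ∧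
      (∀ j, cov j → α' j = α j) ∧
      ∀ j ∈ B, ¬ cov j → (∃ u ∈ A, j ∈ I.ball u) → ∃ u ∈ I.tight A lam α', j ∈ I.ball u) hD
    ?_ ?_ ?_ ?_ (fun _ _ _ ⟨α', h, h'⟩ => ⟨α', ⟨h.nonneg, h.mem, h.feas⟩, h'⟩)
  · exact fun s' hag => (hc.agree hag).nD
  · exact ⟨α, hα, fun _ => le_rfl, fun _ _ => rfl, by simp⟩
  · rintro j B hjB s₁ hag hj ⟨α₁, hα₁, hle, hfix, htight⟩
    have hc₁ := hc.agree hag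
    have hA₁ := hA.agree hag
    have hcov₁ := hcov
    rw [← hag.nat 8 (by decide)] at hcov₁
    refine Ends.ite ?_ ?_
    · intro ht
      simp only [natEq_eval, get_eval, var_eval, const_eval, hj, hcov₁ j] at ht
      refine Ends.skip ⟨α₁, hα₁, hle, hfix, fun j' hj' hn => ?_⟩
      rcases Finset.mem_insert.1 hj' with rfl | hj'
      · exact (hn ht).elim
      · exact htight j' hj' hn
    · intro ht
      simp only [natEq_eval, get_eval, var_eval, const_eval, hj, hcov₁ j] at ht
      refine Ends.natSet_seq ?_
      set s₂ := s₁.setNat 65 0 0 0 with hs₂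
      change Ends M 38 _ s₂ _
      have hc₂ : Ctx I s₂ := ⟨hc₁.nF, hc₁.nD, hc₁.k, hc₁.L, hc₁.d⟩
      have hα₂ : DualMem A lam α₁ s₂ := ⟨hα₁.nonneg, hα₁.mem, hα₁.feas⟩
      refine Ends.seq ((minP_spec hF hD hc₂ (A := A) hA₁ hα₂ (j := j) hj (by simp [hs₂])).exp
        (by norm_num)) ?_
      intro s₃ hag₃ h₃
      have hα₃ := hα₂.agree hag₃
      refine Ends.ite ?_ ?_
      · intro ht₃
        simp only [natEq_eval, var_eval, const_eval] at ht₃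
        rcases h₃ with ⟨-, ⟨u, huA, hju, hu⟩, hmin⟩ | ⟨h, -⟩
        · have hx : 0 ≤ s₃.real 8 0 0 := by rw [← hu]; exact hα₁.feas u huA
          refine ((subP_spec hF hD (hc₂.agree hag₃) hα₃.mem (j := j) ?_).exp (by norm_num)).imp ?_
          · rw [hag₃.nat 73 (by decide)]; exact hj
          intro s₄ _ h₄
          set α₂ := Function.update α₁ j (α₁ j + s₃.real 8 0 0) with hα₂def
          have hle₂ : ∀ j', α₁ j' ≤ α₂ j' := by
            intro j'
            by_cases h : j' = j
            · subst h; simp [hα₂def, hx]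
            · simp [hα₂def, h]
          refine ⟨α₂, ⟨fun j' => (hα₁.nonneg j').trans (hle₂ j'), h₄, ?_⟩,
            fun j' => (hle j').trans (hle₂ j'), ?_, ?_⟩
          · intro v hv
            rw [hα₂def, Inst.slack_update]
            split_ifs with h
            · linarith [hmin v hv (Inst.mem_ball.2 h)]
            · exact hα₁.feas v hv
          · intro j' hj'
            have : j' ≠ j := by rintro rfl; exact ht hj'
            rw [hα₂def, Function.update_of_ne this, hfix j' hj']
          · intro j' hj' hn hex
            rcases Finset.mem_insert.1 hj' with rfl | hj'
            · refine ⟨u, Inst.mem_tight.2 ⟨huA, ?_⟩, hju⟩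
              rw [hα₂def, Inst.slack_update, if_pos (Inst.mem_ball.1 hju), hu]
              simp
            · obtain ⟨v, hv, hjv⟩ := htight j' hj' hn hex
              have hv' := Inst.mem_tight.1 hv
              exact ⟨v, Inst.mem_tight.2 ⟨hv'.1, (Inst.slack_anti hle₂ v).trans hv'.2⟩, hjv⟩
        · omega
      · intro ht₃
        simp only [natEq_eval, var_eval, const_eval] at ht₃
        rcases h₃ with ⟨h, -⟩ | ⟨-, hno⟩
        · exact (ht₃ h).elim
        · refine Ends.skip ⟨α₁, hα₃, hle, hfix, fun j' hj' hn hex => ?_⟩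
          rcases Finset.mem_insert.1 hj' with rfl | hj'
          · obtain ⟨u, hu, hju⟩ := hex
            exact (hno u hu hju).elim
          · exact htight j' hj' hn hex
  · rintro s' _ ⟨α', h1, h2, h3, h4⟩
    exact ⟨α', h1, h2, h3, fun j => h4 j (Finset.mem_univ _)⟩

/-- Allow the balls of the array `6` whose radius is at most the real variable `6`, and set
the slacks for the zero dual solution. -/
def setupP : Prog :=
  forPairs 70 71 eF eD (.seq (.ite (.and (natEq (.get 6 (var 70) (var 71)) (.const 1))
      (.realLe (ed (var 70) (var 71)) (rvar 6)))
      (.natSet 9 (var 70) (var 71) (.const 1)) (.natSet 9 (var 70) (var 71) (.const 0)))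
    (.realSet 4 (var 70) (var 71) (ed (var 70) (var 71))))

theorem setupP_spec {I : Inst} {M : ℕ} {s : Mem} (hF : I.nF ≤ M + 2) (hD : I.nD ≤ M + 2)
    (hc : Ctx I s) {K : Finset I.Pair} (hK : Marks s 6 K) :
    Ends M 30 setupP s fun s' => Marks s' 9 (K.filter fun u => I.rad u ≤ s.real 6 0 0) ∧
      DualMem (K.filter fun u => I.rad u ≤ s.real 6 0 0) 0 0 s' := by
  classical
  have hsl : ∀ u : I.Pair, I.slack 0 0 u = I.rad u := fun u => by simp [Inst.slack]
  refine Ends.exp (a := 10 + 10) ?_ (by norm_num)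
  refine Ends.forPairs (N := I.nF) (K := I.nD) (fun B s' => ∀ u ∈ B,
      (s'.nat 9 u.1 u.2 = 1 ↔ u ∈ K ∧ I.rad u ≤ s.real 6 0 0) ∧ s'.real 4 u.1 u.2 = I.rad u)
      hF hD ?_ (by simp) ?_ ?_
  · exact fun s' hag => ⟨(hc.agree hag).nF, (hc.agree hag).nD⟩
  · intro i j B hB s₁ hag hi hj hI
    have hc₁ := hc.agree hag
    have hK₁ := hK.agree hag
    have h6 : s₁.real 6 0 0 = s.real 6 0 0 := by rw [hag.real 6 (by decide)]
    refine Ends.seq (Q := fun s' => ∀ u ∈ insert (i, j) B,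
      (s'.nat 9 u.1 u.2 = 1 ↔ u ∈ K ∧ I.rad u ≤ s.real 6 0 0)) ?_ ?_
    · have key : ∀ v : ℕ, (v = 1 ↔ (i, j) ∈ K ∧ I.rad (i, j) ≤ s.real 6 0 0) →
          ∀ u ∈ insert (i, j) B, ((s₁.setNat 9 i j v).nat 9 u.1 u.2 = 1 ↔
            u ∈ K ∧ I.rad u ≤ s.real 6 0 0) := by
        intro v hv u hu
        rw [Mem.setNat_nat_eq]
        by_cases h : u = (i, j)
        · subst h; simpa using hv
        · have h' : ¬ ((u.1 : ℕ) = i ∧ (u.2 : ℕ) = j) := fun h' =>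
            h (Prod.ext (Fin.ext h'.1) (Fin.ext h'.2))
          rw [if_neg h']
          exact (hI u ((Finset.mem_insert.1 hu).resolve_left h)).1
      refine Ends.ite ?_ ?_
      · intro ht
        simp only [and_eval, natEq_eval, get_eval, var_eval, const_eval, hi, hj, hK₁ i j, realLe_eval,
          ed, rget_eval, hc₁.d, rvar_eval, h6] at ht
        refine Ends.natSet ?_
        simp only [var_eval, const_eval, hi, hj]
        exact key 1 ⟨fun _ => ht, fun _ => rfl⟩
      · intro ht
        simp only [and_eval, natEq_eval, get_eval, var_eval, const_eval, hi, hj, hK₁ i j, realLe_eval,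
          ed, rget_eval, hc₁.d, rvar_eval, h6] at ht
        refine Ends.natSet ?_
        simp only [var_eval, const_eval, hi, hj]
        exact key 0 ⟨fun h => by simp at h, fun h => (ht h).elim⟩
    · intro s₂ hag₂ h₂
      have h70 : s₂.nat 70 0 0 = i := by rw [hag₂.nat 70 (by decide), hi]
      have h71 : s₂.nat 71 0 0 = j := by rw [hag₂.nat 71 (by decide), hj]
      refine Ends.realSet fun u hu => ⟨h₂ u hu, ?_⟩
      simp only [var_eval, ed, rget_eval, h70, h71, (hc₁.agree hag₂).d, Mem.setReal_real_eq,
        Fin.val_inj]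
      by_cases h : u = (i, j)
      · subst h; simp [Inst.rad]
      · have h' : ¬ (u.1 = i ∧ u.2 = j) := fun h' => h (Prod.ext h'.1 h'.2)
        rw [if_neg h', hag₂.real 4 (by decide)]
        exact (hI u ((Finset.mem_insert.1 hu).resolve_left h)).2
  · intro s' _ hI
    refine ⟨fun i j => ?_, fun _ => le_rfl, fun i j => ?_, fun u _ => ?_⟩
    · simpa using (hI (i, j) (Finset.mem_univ _)).1
    · rw [hsl]; exact (hI (i, j) (Finset.mem_univ _)).2
    · rw [hsl]; exact Inst.rad_nonneg u

/-- Mark in the array `10` the balls of the array `7` and the tight balls of the array `9`. -/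
def resetP : Prog :=
  forPairs 70 71 eF eD (.ite (.and (.not (natEq (.get 7 (var 70) (var 71)) (.const 1)))
      (.not (.and (natEq (.get 9 (var 70) (var 71)) (.const 1))
        (.realLe (.get 4 (var 70) (var 71)) (.ofNat (.const 0))))))
    (.natSet 10 (var 70) (var 71) (.const 0)) (.natSet 10 (var 70) (var 71) (.const 1)))

/-- Raising the multiplier gives slack back to tight balls, and not all of them become tight again;
the marks of the latter are removed here. -/
theorem resetP_spec {I : Inst} {M : ℕ} {s : Mem} (hF : I.nF ≤ M + 2)
    (hD : I.nD ≤ M + 2) (hc : Ctx I s) {X A : Finset I.Pair} (hX : Marks s 7 X) (hA : Marks s 9 A)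
    {lam : ℝ} {α : Fin I.nD → ℝ} (hα : DualMem A lam α s) :
    Ends M 30 resetP s fun s' => Marks s' 10 (I.tight A lam α ∪ X) := by
  refine Ends.exp (a := 10 + 10) ?_ (by norm_num)
  refine Ends.forPairs (N := I.nF) (K := I.nD) (fun B s' => ∀ u ∈ B,
      (s'.nat 10 u.1 u.2 = 1 ↔ u ∈ I.tight A lam α ∪ X)) hF hD ?_ (by simp) ?_ ?_
  · exact fun s' hag => ⟨(hc.agree hag).nF, (hc.agree hag).nD⟩
  · intro i j B hB s₁ hag hi hj hI
    have hX₁ := hX.agree hag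
    have hA₁ := hA.agree hag
    have hα₁ := hα.agree hag
    have key : ∀ v : ℕ, (v = 1 ↔ (i, j) ∈ I.tight A lam α ∪ X) →
        ∀ u ∈ insert (i, j) B, ((s₁.setNat 10 i j v).nat 10 u.1 u.2 = 1 ↔
          u ∈ I.tight A lam α ∪ X) := by
      intro v hv u hu
      rw [Mem.setNat_nat_eq]
      by_cases h : u = (i, j)
      · subst h; simpa using hv
      · have h' : ¬ ((u.1 : ℕ) = i ∧ (u.2 : ℕ) = j) := fun h' =>
          h (Prod.ext (Fin.ext h'.1) (Fin.ext h'.2))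
        rw [if_neg h']
        exact hI u ((Finset.mem_insert.1 hu).resolve_left h)
    refine Ends.ite ?_ ?_
    · intro ht
      simp only [and_eval, not_eval, natEq_eval, get_eval, var_eval, const_eval, hi, hj, hX₁ i j,
        hA₁ i j, realLe_eval, rget_eval, hα₁.mem, rofNat_eval, Nat.cast_zero] at ht
      refine Ends.natSet ?_
      simp only [var_eval, const_eval, hi, hj]
      refine key 0 ⟨fun h => by simp at h, fun h => ?_⟩
      rcases Finset.mem_union.1 h with h | h
      · exact (ht.2 (Inst.mem_tight.1 h)).elim
      · exact (ht.1 h).elim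
    · intro ht
      simp only [and_eval, not_eval, natEq_eval, get_eval, var_eval, const_eval, hi, hj, hX₁ i j,
        hA₁ i j, realLe_eval, rget_eval, hα₁.mem, rofNat_eval, Nat.cast_zero] at ht
      refine Ends.natSet ?_
      simp only [var_eval, const_eval, hi, hj]
      refine key 1 ⟨fun _ => ?_, fun _ => rfl⟩
      rw [Finset.mem_union, Inst.mem_tight]
      tauto
  · intro s' _ hI i j
    exact hI (i, j) (Finset.mem_univ _)

/-- Add the real variable `6` divided by the number of clients to all slacks. -/
def bumpP : Prog :=
  forPairs 70 71 eF eD (.realSet 4 (var 70) (var 71)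
    (.add (.get 4 (var 70) (var 71)) (.divNat (rvar 6) eD)))

theorem bumpP_spec {I : Inst} {M : ℕ} {s : Mem} (hF : I.nF ≤ M + 2)
    (hD : I.nD ≤ M + 2) (hc : Ctx I s) {A : Finset I.Pair} {lam : ℝ} {α : Fin I.nD → ℝ}
    (hα : DualMem A lam α s) (hR : 0 ≤ s.real 6 0 0) :
    Ends M 30 bumpP s fun s' => DualMem A (lam + s.real 6 0 0 / I.nD) α s' := by
  classical
  have hsl : ∀ u : I.Pair, I.slack (lam + s.real 6 0 0 / I.nD) α u =
      I.slack lam α u + s.real 6 0 0 / I.nD := fun u => by unfold Inst.slack; ring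
  refine Ends.exp (a := 10 + 10) ?_ (by norm_num)
  refine Ends.forPairs (N := I.nF) (K := I.nD) (fun B s' => ∀ u : I.Pair,
      s'.real 4 u.1 u.2 = if u ∈ B then I.slack (lam + s.real 6 0 0 / I.nD) α u
        else I.slack lam α u) hF hD ?_ ?_ ?_ ?_
  · exact fun s' hag => ⟨(hc.agree hag).nF, (hc.agree hag).nD⟩
  · exact fun u => by simpa using hα.mem u.1 u.2
  · intro i j B hB s₁ hag hi hj hI
    have h6 : s₁.real 6 0 0 = s.real 6 0 0 := by rw [hag.real 6 (by decide)]
    have hD₁ := (hc.agree hag).nD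
    have hij := hI (i, j)
    rw [if_neg hB] at hij
    refine Ends.realSet fun u => ?_
    simp only [var_eval, hi, hj, radd_eval, rget_eval, rdiv_eval, rvar_eval, h6, eD, hD₁,
      Mem.setReal_real_eq, hij]
    by_cases h : u = (i, j)
    · subst h; simp [hsl]
    · have h' : ¬ ((u.1 : ℕ) = i ∧ (u.2 : ℕ) = j) := fun h' =>
        h (Prod.ext (Fin.ext h'.1) (Fin.ext h'.2))
      rw [if_neg h', hI u]
      simp [h]
  · intro s' _ hI
    refine ⟨hα.nonneg, fun i j => by simpa using hI (i, j), fun u hu => ?_⟩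
    rw [hsl]
    have := hα.feas u hu
    positivity

/-! ### The search for a fixed guess -/

namespace Inst

variable (I : Inst)

/-- The balls that contain enough clients for their center. -/
noncomputable def allowed : Finset I.Pair := Finset.univ.filter fun u => I.L u.1 ≤ (I.ball u).card

/-- The allowed balls of radius at most `R`. -/
noncomputable def small (R : ℝ) : Finset I.Pair := I.allowed.filter fun u => I.rad u ≤ R

/-- `P` is the family of balls of a solution, `X` is a part of it, and the other balls have radius at
most `R`. -/
structure Guess (X : Finset I.Pair) (R : ℝ) (P : Finset I.Pair) : Prop where
  covers : I.Covers P
  card_k : P.card ≤ I.k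
  card_nF : P.card ≤ I.nF
  lower : ∀ u ∈ P, I.L u.1 ≤ (I.ball u).card
  sub : X ⊆ P
  rad_le : ∀ u ∈ P, u ∉ X → I.rad u ≤ R

/-- The cost guaranteed for a guess. -/
noncomputable def target (X : Finset I.Pair) (R : ℝ) (P : Finset I.Pair) : ℝ :=
  3.83 * (∑ u ∈ P, I.rad u + 2 * if P ⊆ X then 0 else R)

variable {I} {X P : Finset I.Pair} {R lam : ℝ} {α : Fin I.nD → ℝ}

theorem mem_allowed {u : I.Pair} : u ∈ I.allowed ↔ I.L u.1 ≤ (I.ball u).card := by simp [allowed]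

theorem mem_small {u : I.Pair} : u ∈ I.small R ↔ u ∈ I.allowed ∧ I.rad u ≤ R := by simp [small]

theorem Guess.mem_small (h : I.Guess X R P) {u : I.Pair} (hu : u ∈ P) (hX : u ∉ X) :
    u ∈ I.small R := Inst.mem_small.2 ⟨mem_allowed.2 (h.lower u hu), h.rad_le u hu hX⟩

/-- The dual solution is bounded by the balls that are not guessed. -/
theorem Guess.sum_dual_le (h : I.Guess X R P) (hα : ∀ j, 0 ≤ α j)
    (hf : ∀ u ∈ I.small R, 0 ≤ I.slack lam α u) (h0 : ∀ j, (∃ u ∈ X, j ∈ I.ball u) → α j = 0) :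
    ∑ j, α j ≤ ∑ u ∈ P, I.rad u - ∑ u ∈ X, I.rad u + (P.card - X.card : ℝ) * lam := by
  have h1 := Inst.sum_dual_le (O := P \ X) hα (lam := lam)
    (fun u hu => hf u (h.mem_small (Finset.mem_sdiff.1 hu).1 (Finset.mem_sdiff.1 hu).2)) (by
      intro j hj
      obtain ⟨u, hu, hju⟩ := h.covers j
      exact ⟨u, Finset.mem_sdiff.2 ⟨hu, fun hX => hj (h0 j ⟨u, hX, hju⟩)⟩, hju⟩)
  rw [← Finset.sum_sdiff_eq_sub h.sub]
  rw [Finset.card_sdiff_of_subset h.sub, Nat.cast_sub (Finset.card_le_card h.sub)] at h1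
  exact h1

/-- A client outside the guessed balls lies in a remaining ball of `P`, which is allowed and small,
so the greedy raise has produced a tight ball around it. -/
theorem Guess.covers_tight (h : I.Guess X R P)
    (ht : ∀ j, ¬ (∃ u ∈ X, j ∈ I.ball u) → (∃ u ∈ I.small R, j ∈ I.ball u) →
      ∃ u ∈ I.tight (I.small R) lam α, j ∈ I.ball u) :
    I.Covers (I.tight (I.small R) lam α ∪ X) := by
  intro j
  by_cases hj : ∃ u ∈ X, j ∈ I.ball u
  · obtain ⟨u, hu, hju⟩ := hj
    exact ⟨u, Finset.mem_union_right _ hu, hju⟩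
  · obtain ⟨u, hu, hju⟩ := h.covers j
    obtain ⟨v, hv, hjv⟩ := ht j hj ⟨u, h.mem_small hu fun hX => hj ⟨u, hX, hju⟩, hju⟩
    exact ⟨v, Finset.mem_union_left _ hv, hjv⟩

/-- The cost of the first family, where the Lagrange multiplier is zero. -/
theorem Guess.sum_rad_le (h : I.Guess X R P) (hα : ∀ j, 0 ≤ α j)
    (hf : ∀ u ∈ I.small R, 0 ≤ I.slack 0 α u) (h0 : ∀ j, (∃ u ∈ X, j ∈ I.ball u) → α j = 0)
    {S : Finset I.Pair} (hS : I.Packing S) (hsub : S ⊆ I.tight (I.small R) 0 α ∪ X) :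
    ∑ u ∈ S, I.rad u ≤ ∑ u ∈ P, I.rad u := by
  have h1 := h.sum_dual_le hα hf h0
  have h2 := sum_rad_packing_le (S := S \ X)
    (fun u hu v hv => hS u (Finset.mem_sdiff.1 hu).1 v (Finset.mem_sdiff.1 hv).1) hα le_rfl
    (lam := 0) (by
      intro u hu
      have hu' := Finset.mem_sdiff.1 hu
      exact (mem_tight.1 ((Finset.mem_union.1 (hsub hu'.1)).resolve_right hu'.2)).2)
  have h3 : ∑ u ∈ S, I.rad u ≤ ∑ u ∈ S \ X, I.rad u + ∑ u ∈ X, I.rad u := by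
    rw [← Finset.sum_union Finset.sdiff_disjoint]
    refine Finset.sum_le_sum_of_subset_of_nonneg ?_ fun _ _ _ => rad_nonneg _
    intro u hu
    by_cases hX : u ∈ X <;> simp [hu, hX]
  simp only [mul_zero, add_zero, sub_zero] at h1 h2
  linarith

/-- The cost of the family that brings the number of components down to `k`. -/
theorem Guess.sum_rad_le_add (h : I.Guess X R P) (hα : ∀ j, 0 ≤ α j) (hlam : 0 ≤ lam)
    (hf : ∀ u ∈ I.small R, 0 ≤ I.slack lam α u) (h0 : ∀ j, (∃ u ∈ X, j ∈ I.ball u) → α j = 0)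
    {S T : Finset I.Pair} {b : I.Pair} (hS : I.Packing S) (hsub : S ⊆ insert b (T ∪ X))
    (hcov : I.Covers (T ∪ X)) (hk : I.k < I.numComp (T ∪ X)) {δ : ℝ} (hδ : 0 ≤ δ)
    (hT : ∀ u ∈ T, I.slack lam α u ≤ δ) (hb : I.rad b ≤ R) (hR : I.nD * δ = R) :
    ∑ u ∈ S, I.rad u ≤ ∑ u ∈ P, I.rad u + 2 * R := by
  have h1 := h.sum_dual_le hα hf h0
  have h2 := sum_rad_le_of_lt_numComp hcov hk hS hsub hα hlam hδ hT
  -- Weak duality charges `lam` for `P.card - X.card` balls, while the packing gains it `I.k -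
  -- X.card` times. The summands `2 * R` are `I.rad b` and `I.nD * δ`.
  have h3 : (P.card - X.card : ℝ) * lam ≤ (I.k - X.card : ℝ) * lam := by
    refine mul_le_mul_of_nonneg_right ?_ hlam
    have : (P.card : ℝ) ≤ I.k := by exact_mod_cast h.card_k
    linarith
  linarith

/-- For a large Lagrange multiplier there are at most `k` components. -/
theorem Guess.numComp_le (h : I.Guess X R P) (hα : ∀ j, 0 ≤ α j) (hR : 0 < R)
    (hlam : lam = (I.nF + 1) * R)
    (hf : ∀ u ∈ I.small R, 0 ≤ I.slack lam α u) (h0 : ∀ j, (∃ u ∈ X, j ∈ I.ball u) → α j = 0)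
    (hcov : I.Covers (I.tight (I.small R) lam α ∪ X)) :
    I.numComp (I.tight (I.small R) lam α ∪ X) ≤ I.k := by
  by_contra! hk
  have h1 := h.sum_dual_le hα hf h0
  obtain ⟨S, -, hST, hS, hmax⟩ := exists_maximal_packing (S := ∅) (T := I.tight (I.small R) lam α)
    (by simp) (by simp [Packing])
  have hcard := numComp_le_card_add (X := X) hcov hST hmax
  have h2 := sum_rad_packing_le hS hα le_rfl fun u hu => (mem_tight.1 (hST hu)).2
  have h3 : 0 ≤ ∑ u ∈ S, I.rad u := Finset.sum_nonneg fun _ _ => rad_nonneg _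
  have hlam0 : 0 ≤ lam := by rw [hlam]; positivity
  -- One ball more than in `P \ X` is paid for, so the weight of `S` is at most `I.nF * R - lam`,
  -- which is negative.
  have h4 : (P.card - X.card + 1 : ℝ) * lam ≤ S.card * lam := by
    refine mul_le_mul_of_nonneg_right ?_ hlam0
    have h5 : (P.card : ℝ) ≤ I.k := by exact_mod_cast h.card_k
    have h6 : (I.k : ℝ) + 1 ≤ S.card + X.card := by exact_mod_cast hk.trans_le hcard
    linarith
  have h5 : ∑ u ∈ P, I.rad u - ∑ u ∈ X, I.rad u ≤ I.nF * R := by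
    rw [← Finset.sum_sdiff_eq_sub h.sub]
    calc ∑ u ∈ P \ X, I.rad u ≤ ∑ u ∈ P \ X, R := Finset.sum_le_sum fun u hu =>
          h.rad_le u (Finset.mem_sdiff.1 hu).1 (Finset.mem_sdiff.1 hu).2
      _ = (P \ X).card * R := by rw [Finset.sum_const, nsmul_eq_mul]
      _ ≤ I.nF * R := by
        refine mul_le_mul_of_nonneg_right ?_ hR.le
        exact_mod_cast (Finset.card_le_card Finset.sdiff_subset).trans h.card_nF
  rw [mul_zero] at h2
  nlinarith

end Inst

/-- What is known after a family `F` was evaluated: the target is reached or `F` has too many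
components. -/
def Progress {I : Inst} (X : Finset I.Pair) (R : ℝ) (F : Finset I.Pair) (s : Mem) : Prop :=
  ∀ P, I.Guess X R P → Good (I.target X R P) s ∨ (¬ P ⊆ X ∧ 0 < R ∧ I.k < I.numComp F)

/-- Add the tight balls one by one and evaluate all families that occur. -/
def sweepP : Prog :=
  forPairs 70 71 eF eD (.seq (.ite (.and (natEq (.get 9 (var 70) (var 71)) (.const 1))
      (.realLe (.get 4 (var 70) (var 71)) (.ofNat (.const 0))))
      (.natSet 10 (var 70) (var 71) (.const 1)) .skip) evaluateP)

/-- `T` is the family tight before the round, with slack at most `δ` now. Starting from more than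
`k` components, the first addition that leaves at most `k` differs from a family with too many
components by one ball, so `Guess.sum_rad_le_add` applies. If this never happens, the new tight
family has too many components as well. -/
theorem sweepP_spec {I : Inst} {M : ℕ} {s : Mem} (hF : I.nF ≤ M + 2) (hD : I.nD ≤ M + 2)
    (hc : Ctx I s) {X T : Finset I.Pair} {R lam δ : ℝ} {α : Fin I.nD → ℝ}
    (hA : Marks s 9 (I.small R)) (hm : Marks s 10 (T ∪ X)) (hα : DualMem (I.small R) lam α s)
    (h0 : ∀ j, (∃ u ∈ X, j ∈ I.ball u) → α j = 0) (hlam : 0 ≤ lam) (hδ : 0 ≤ δ)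
    (hR : I.nD * δ = R) (hTA : T ⊆ I.allowed) (hXA : X ⊆ I.allowed)
    (hT : ∀ u ∈ T, I.slack lam α u ≤ δ) (hsol : Sol I s)
    (hcov : ∀ P, I.Guess X R P → I.Covers (T ∪ X)) (hprog : Progress X R (T ∪ X) s) :
    Ends M 90 sweepP s fun s' => Sol I s' ∧ (∀ V, Good V s → Good V s') ∧
      Progress X R (I.tight (I.small R) lam α ∪ X) s' := by
  classical
  refine Ends.exp (a := 71 + 10) ?_ (by norm_num)
  set T' := I.tight (I.small R) lam α with hT'
  refine Ends.forPairs (N := I.nF) (K := I.nD) (fun B s' => Sol I s' ∧ (∀ V, Good V s → Good V s') ∧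
      Marks s' 10 (T ∪ (T' ∩ B) ∪ X) ∧ Progress X R (T ∪ (T' ∩ B) ∪ X) s') hF hD ?_ ?_ ?_ ?_
  · exact fun s' hag => ⟨(hc.agree hag).nF, (hc.agree hag).nD⟩
  · exact ⟨hsol, fun _ h => h, by simpa using hm, by simpa using hprog⟩
  · rintro i j B hB s₁ hag hi hj ⟨hsol₁, hgood₁, hm₁, hprog₁⟩
    have hc₁ := hc.agree hag
    have hA₁ := hA.agree hag
    have hα₁ := hα.agree hag
    refine Ends.seq (Q := fun s' => Marks s' 10 (T ∪ (T' ∩ insert (i, j) B) ∪ X)) ?_ ?_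
    · refine Ends.exp (a := 8) (Ends.ite ?_ ?_) (by norm_num)
      · intro ht
        simp only [and_eval, natEq_eval, get_eval, var_eval, const_eval, hi, hj, hA₁ i j,
          realLe_eval, rget_eval, hα₁.mem, rofNat_eval, Nat.cast_zero] at ht
        rw [Finset.inter_insert_of_mem (Inst.mem_tight.2 ht)]
        refine Ends.natSet fun i' j' => ?_
        have := hm₁ i' j'
        simp only [var_eval, const_eval, hi, hj, Mem.setNat_nat_eq, Fin.val_inj, Finset.mem_union,
          Finset.mem_insert, Prod.mk.injEq] at this ⊢
        split_ifs with h
        · simp [h]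
        · rw [this]; tauto
      · intro ht
        simp only [and_eval, natEq_eval, get_eval, var_eval, const_eval, hi, hj, hA₁ i j,
          realLe_eval, rget_eval, hα₁.mem, rofNat_eval, Nat.cast_zero] at ht
        rw [Finset.inter_insert_of_notMem (fun h => ht (Inst.mem_tight.1 h))]
        exact Ends.skip hm₁
    · intro s₂ hag₂ hm₂
      have hL : ∀ u ∈ T ∪ (T' ∩ insert (i, j) B) ∪ X, I.L u.1 ≤ (I.ball u).card := by
        intro u hu
        rw [← Inst.mem_allowed]
        simp only [Finset.mem_union, Finset.mem_inter] at hu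
        rcases hu with (hu | hu) | hu
        · exact hTA hu
        · exact (Inst.mem_small.1 (Inst.mem_tight.1 hu.1).1).1
        · exact hXA hu
      refine (evaluateP_spec hF hD (hc₁.agree hag₂) hm₂ hL (hsol₁.agree hag₂)).imp ?_
      rintro s₃ hag₃ ⟨hsol₃, hgood₃, hbest⟩
      refine ⟨hsol₃, fun V hV => hgood₃ V ((hgood₁ V hV).agree hag₂), hm₂.agree hag₃, ?_⟩
      intro P hP
      rcases hprog₁ P hP with hg | ⟨hPX, hR0, hk⟩
      · exact Or.inl (hgood₃ _ (hg.agree hag₂))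
      by_cases hk' : I.k < I.numComp (T ∪ (T' ∩ insert (i, j) B) ∪ X)
      · exact Or.inr ⟨hPX, hR0, hk'⟩
      left
      -- Otherwise nothing was added in this iteration and the number of components could not have
      -- dropped.
      have hmem : (i, j) ∈ T' := by
        by_contra hn
        rw [Finset.inter_insert_of_notMem hn] at hk'
        exact hk' hk
      have hcov₁ : ∀ Y : Finset I.Pair, T ∪ X ⊆ Y → I.Covers Y := fun Y hY j' => by
        obtain ⟨u, hu, hj'⟩ := hcov P hP j'
        exact ⟨u, hY hu, hj'⟩
      obtain ⟨S, hSF, hS, hg⟩ := hbest (hcov₁ _ (by intro u; simp; tauto)) (not_lt.1 hk')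
      refine hg.mono ?_
      rw [Inst.target, if_neg hPX]
      refine mul_le_mul_of_nonneg_left ?_ (by norm_num)
      refine hP.sum_rad_le_add (T := T ∪ (T' ∩ B)) (b := (i, j)) hα.nonneg hlam hα.feas h0 hS ?_
        (hcov₁ _ (by intro u; simp; tauto)) hk hδ ?_ ?_ hR
      · rw [Finset.inter_insert_of_mem hmem] at hSF
        refine hSF.trans ?_
        intro u
        simp only [Finset.mem_union, Finset.mem_insert]
        tauto
      · intro u hu
        rcases Finset.mem_union.1 hu with hu | hu
        · exact hT u hu
        · exact (Inst.mem_tight.1 (Finset.mem_inter.1 hu).1).2.trans hδ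
      · exact (Inst.mem_small.1 (Inst.mem_tight.1 hmem).1).2
  · rintro s' _ ⟨h1, h2, -, h4⟩
    refine ⟨h1, h2, fun P hP => (h4 P hP).imp_right fun ⟨h5, h6, h7⟩ => ⟨h5, h6, h7.trans_le ?_⟩⟩
    -- The sweep ends with `T ∪ T' ∪ X`; without the old balls `T` there are at least as many
    -- components.
    exact Inst.numComp_anti (by intro u; simp; tauto)

/-! ### Rounds and the complete search for one guess. -/

/-- One round: raise the Lagrange multiplier and the dual variables, and evaluate the families. -/
def roundP : Prog := .seq bumpP (.seq raiseP (.seq sweepP resetP))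

/-- Search for a solution for the guess in array `7` and the real variable `6`. -/
def processP : Prog :=
  .seq setupP (.seq raiseP (.seq resetP (.seq evaluateP (forN 76 (var 19) roundP))))

/-- The state between two rounds. -/
structure RoundInv {I : Inst} (X : Finset I.Pair) (R lam : ℝ) (s₀ s : Mem) (α : Fin I.nD → ℝ) :
    Prop where
  dual : DualMem (I.small R) lam α s
  zero : ∀ j, (∃ u ∈ X, j ∈ I.ball u) → α j = 0
  marks : Marks s 10 (I.tight (I.small R) lam α ∪ X)
  sol : Sol I s
  good : ∀ V, Good V s₀ → Good V s
  covers : ∀ P, I.Guess X R P → I.Covers (I.tight (I.small R) lam α ∪ X)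
  progress : Progress X R (I.tight (I.small R) lam α ∪ X) s

/-- The sweep starts from the marks of the previous round but uses the new slacks: the increase `R /
I.nD` of the multiplier bounds the slack of every formerly tight ball, since raising `α` only
reduces it. -/
theorem roundP_spec {I : Inst} {M : ℕ} {s₀ s : Mem} (hF : I.nF ≤ M + 2) (hD : I.nD ≤ M + 2)
    (hD0 : 0 < I.nD) (hc : Ctx I s) {X : Finset I.Pair} {R lam : ℝ} {α : Fin I.nD → ℝ}
    (hX : Marks s 7 X) (hXA : X ⊆ I.allowed)
    (h8 : ∀ j : Fin I.nD, s.nat 8 j 0 = 1 ↔ ∃ u ∈ X, j ∈ I.ball u)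
    (hA : Marks s 9 (I.small R)) (hR : s.real 6 0 0 = R) (hR0 : 0 ≤ R) (hlam : 0 ≤ lam)
    (hI : RoundInv X R lam s₀ s α) :
    Ends M 95 roundP s fun s' => ∃ α', RoundInv X R (lam + R / I.nD) s₀ s' α' := by
  have hδ : 0 ≤ R / I.nD := by positivity
  refine Ends.seq ((bumpP_spec hF hD hc hI.dual (by rw [hR]; exact hR0)).exp (by norm_num)) ?_
  intro s₁ hag₁ hα₁
  rw [hR] at hα₁
  have hc₁ := hc.agree hag₁
  have hA₁ := hA.agree hag₁
  rw [← hag₁.nat 8 (by decide)] at h8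
  refine Ends.seq ((raiseP_spec hF hD hc₁ hA₁ h8 hα₁).exp (by norm_num)) ?_
  rintro s₂ hag₂ ⟨α', hα', hle, hfix, htight⟩
  have hzero : ∀ j, (∃ u ∈ X, j ∈ I.ball u) → α' j = 0 := fun j hj => by
    rw [hfix j hj, hI.zero j hj]
  have hc₂ := hc₁.agree hag₂
  have hA₂ := hA₁.agree hag₂
  refine Ends.seq ((sweepP_spec (T := I.tight (I.small R) lam α) (δ := R / I.nD) hF hD hc₂ hA₂
    ((hI.marks.agree hag₁).agree hag₂) hα' hzero (by positivity) hδ ?_ ?_ hXA ?_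
    ((hI.sol.agree hag₁).agree hag₂) hI.covers ?_).exp (by norm_num)) ?_
  · have : (I.nD : ℝ) ≠ 0 := by exact_mod_cast hD0.ne'
    field_simp
  · exact fun u hu => (Inst.mem_small.1 (Inst.mem_tight.1 hu).1).1
  · intro u hu
    refine (Inst.slack_anti hle u).trans ?_
    have := (Inst.mem_tight.1 hu).2
    unfold Inst.slack at this ⊢
    linarith
  · exact fun P hP => (hI.progress P hP).imp_left fun h => (h.agree hag₁).agree hag₂
  rintro s₃ hag₃ ⟨hsol₃, hgood₃, hprog₃⟩
  have hα₃ := hα'.agree hag₃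
  refine ((resetP_spec hF hD (hc₂.agree hag₃) (((hX.agree hag₁).agree hag₂).agree hag₃)
    (hA₂.agree hag₃) hα₃).exp (by norm_num)).imp ?_
  intro s₄ hag₄ hm₄
  exact ⟨α', hα₃.agree hag₄, hzero, hm₄, hsol₃.agree hag₄,
    fun V hV => (hgood₃ V (((hI.good V hV).agree hag₁).agree hag₂)).agree hag₄,
    fun P hP => hP.covers_tight htight, fun P hP => (hprog₃ P hP).imp_left fun h => h.agree hag₄⟩

/-- The `(I.nF + 1) * I.nD` rounds bring the multiplier to `(I.nF + 1) * R`, where too many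
components are impossible by `Guess.numComp_le`; hence the target was reached on the way. -/
theorem processP_spec {I : Inst} {M : ℕ} {s : Mem} (hn : I.nF + I.nD ≤ M + 2) (hD0 : 0 < I.nD)
    (hc : Ctx I s) {X : Finset I.Pair} (h6 : Marks s 6 I.allowed) (hX : Marks s 7 X)
    (hXA : X ⊆ I.allowed) (h8 : ∀ j : Fin I.nD, s.nat 8 j 0 = 1 ↔ ∃ u ∈ X, j ∈ I.ball u)
    (h19 : s.nat 19 0 0 = (I.nF + 1) * I.nD) (hR0 : 0 ≤ s.real 6 0 0) (hsol : Sol I s) :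
    Ends M 110 processP s fun s' => Sol I s' ∧ (∀ V, Good V s → Good V s') ∧
      ∀ P, I.Guess X (s.real 6 0 0) P → Good (I.target X (s.real 6 0 0) P) s' := by
  have hF : I.nF ≤ M + 2 := by omega
  have hD : I.nD ≤ M + 2 := by omega
  set R := s.real 6 0 0 with hR
  refine Ends.seq ((setupP_spec hF hD hc h6).exp (by norm_num)) ?_
  rintro s₁ hag₁ ⟨hA₁, hα₁⟩
  change Marks s₁ 9 (I.small R) at hA₁
  change DualMem (I.small R) 0 0 s₁ at hα₁
  have hc₁ := hc.agree hag₁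
  rw [← hag₁.nat 8 (by decide)] at h8
  refine Ends.seq ((raiseP_spec hF hD hc₁ hA₁ h8 hα₁).exp (by norm_num)) ?_
  rintro s₂ hag₂ ⟨α, hα, -, hfix, htight⟩
  have hzero : ∀ j, (∃ u ∈ X, j ∈ I.ball u) → α j = 0 := hfix
  have hc₂ := hc₁.agree hag₂
  have hA₂ := hA₁.agree hag₂
  have hX₂ := (hX.agree hag₁).agree hag₂
  refine Ends.seq ((resetP_spec hF hD hc₂ hX₂ hA₂ hα).exp (by norm_num)) ?_
  intro s₃ hag₃ hm₃
  have hc₃ := hc₂.agree hag₃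
  have hsol₃ := ((hsol.agree hag₁).agree hag₂).agree hag₃
  refine Ends.seq ((evaluateP_spec hF hD hc₃ hm₃ ?_ hsol₃).exp (by norm_num)) ?_
  · intro u hu
    rw [← Inst.mem_allowed]
    rcases Finset.mem_union.1 hu with hu | hu
    · exact (Inst.mem_small.1 (Inst.mem_tight.1 hu).1).1
    · exact hXA hu
  rintro s₄ hag₄ ⟨hsol₄, hgood₄, hbest⟩
  have hc₄ := hc₃.agree hag₄
  have hA₄ := (hA₂.agree hag₃).agree hag₄
  have hX₄ := (hX₂.agree hag₃).agree hag₄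
  rw [← hag₂.nat 8 (by decide), ← hag₃.nat 8 (by decide), ← hag₄.nat 8 (by decide)] at h8
  have h19' : s₄.nat 19 0 0 = (I.nF + 1) * I.nD := by
    rw [hag₄.nat 19 (by decide), hag₃.nat 19 (by decide), hag₂.nat 19 (by decide),
      hag₁.nat 19 (by decide), h19]
  have hR₄ : s₄.real 6 0 0 = R := by
    rw [hag₄.real 6 (by decide), hag₃.real 6 (by decide), hag₂.real 6 (by decide),
      hag₁.real 6 (by decide)]
  have hstart : RoundInv X R ((0 : ℕ) * (R / I.nD)) s s₄ α := by
    rw [Nat.cast_zero, zero_mul]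
    refine ⟨(hα.agree hag₃).agree hag₄, hzero, hm₃.agree hag₄, hsol₄, fun V hV =>
      hgood₄ V (((hV.agree hag₁).agree hag₂).agree hag₃), fun P hP => hP.covers_tight htight, ?_⟩
    intro P hP
    by_cases hk : I.numComp (I.tight (I.small R) 0 α ∪ X) ≤ I.k
    · left
      obtain ⟨S, hSF, hS, hg⟩ := hbest (hP.covers_tight htight) hk
      refine hg.mono ?_
      refine mul_le_mul_of_nonneg_left ?_ (by norm_num)
      have h1 := hP.sum_rad_le hα.nonneg hα.feas hzero hS hSF
      have h2 : 0 ≤ if P ⊆ X then 0 else R := by split_ifs <;> simp [hR0]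
      linarith
    · right
      -- In both cases to be excluded all of `P` belongs to the evaluated family, which then has at
      -- most `I.k` components. For `R = 0` the unguessed balls have radius `0` and so nonpositive
      -- slack.
      refine ⟨fun hPX => hk ?_, lt_of_le_of_ne hR0 fun hR' => hk ?_, not_le.1 hk⟩
      · refine (Inst.numComp_le_of_covers (P := P) ?_ hP.covers).trans hP.card_k
        exact hPX.trans Finset.subset_union_right
      · refine (Inst.numComp_le_of_covers (P := P) ?_ hP.covers).trans hP.card_k
        intro u hu
        by_cases hX : u ∈ X
        · exact Finset.mem_union_right _ hX
        · refine Finset.mem_union_left _ (Inst.mem_tight.2 ⟨hP.mem_small hu hX, ?_⟩)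
          have h1 := hP.rad_le u hu hX
          have h2 : 0 ≤ ∑ j ∈ I.ball u, α j := Finset.sum_nonneg fun j _ => hα.nonneg j
          unfold Inst.slack
          linarith
  refine Ends.exp (a := 95 + 2 + 4) ?_ (by norm_num)
  refine Ends.forN (N := (I.nF + 1) * I.nD)
    (fun t s' => ∃ α, RoundInv X R (t * (R / I.nD)) s s' α) ?_ ?_ ⟨α, hstart⟩ ?_ ?_
    (fun _ _ _ ⟨α, h⟩ => ⟨α, ⟨h.dual.nonneg, h.dual.mem, h.dual.feas⟩, h.zero, h.marks, h.sol, h.good,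
      h.covers, h.progress⟩)
  · rw [pow_two]
    exact Nat.mul_le_mul (by omega) hD
  · intro s' hag
    rw [var_eval, hag.nat 19 (by decide), h19']
  · rintro t ht s' hag - ⟨α', hα'⟩
    refine (roundP_spec hF hD hD0 (hc₄.agree hag) (hX₄.agree hag) hXA ?_ (hA₄.agree hag) ?_ hR0
      (by positivity) hα').imp ?_
    · rw [hag.nat 8 (by decide)]; exact h8
    · rw [hag.real 6 (by decide), hR₄]
    · rintro s'' - ⟨α'', h⟩
      refine ⟨α'', ?_⟩
      have : ((t + 1 : ℕ) : ℝ) * (R / I.nD) = t * (R / I.nD) + R / I.nD := by push_cast; ring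
      rwa [this]
  · rintro s' - ⟨α', h⟩
    refine ⟨h.sol, h.good, fun P hP => ?_⟩
    rcases h.progress P hP with hg | ⟨-, hR', hk⟩
    · exact hg
    · refine absurd hk (not_lt.2 ?_)
      refine hP.numComp_le h.dual.nonneg hR' ?_ h.dual.feas h.zero (h.covers P hP)
      have : (I.nD : ℝ) ≠ 0 := by exact_mod_cast hD0.ne'
      push_cast
      field_simp

/-! ### Enumerating the guesses -/

/-- Mark the allowed balls in array `6`. -/
def allowedP : Prog :=
  forPairs 20 21 eF eD (.seq (setV 15 (.const 0))
    (.seq (forN 22 eD (.ite (.realLe (ed (var 20) (var 22)) (ed (var 20) (var 21)))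
        (setV 15 (.add (var 15) (.const 1))) .skip))
      (.ite (.natLe (.get 3 (var 20) (.const 0)) (var 15))
        (.natSet 6 (var 20) (var 21) (.const 1)) (.natSet 6 (var 20) (var 21) (.const 0)))))

theorem allowedP_spec {I : Inst} {M : ℕ} {s : Mem} (hF : I.nF ≤ M + 2) (hD : I.nD ≤ M + 2)
    (hc : Ctx I s) : Ends M 50 allowedP s fun s' => Marks s' 6 I.allowed := by
  classical
  refine Ends.exp (a := 30 + 10) ?_ (by norm_num)
  refine Ends.forPairs (N := I.nF) (K := I.nD) (fun B s' => ∀ u ∈ B,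
      (s'.nat 6 u.1 u.2 = 1 ↔ u ∈ I.allowed)) hF hD ?_ (by simp) ?_ ?_
  · exact fun s' hag => ⟨(hc.agree hag).nF, (hc.agree hag).nD⟩
  · intro i j B hB s₁ hag hi hj hI
    have hc₁ := hc.agree hag
    refine Ends.natSet_seq ?_
    set s₂ := s₁.setNat 15 0 0 0 with hs₂
    change Ends M 29 _ s₂ _
    have hc₂ : Ctx I s₂ := ⟨hc₁.nF, hc₁.nD, hc₁.k, hc₁.L, hc₁.d⟩
    have hi₂ : s₂.nat 20 0 0 = i := hi
    have hj₂ : s₂.nat 21 0 0 = j := hj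
    have hI₂ : ∀ u ∈ B, (s₂.nat 6 u.1 u.2 = 1 ↔ u ∈ I.allowed) := hI
    have h15 : s₂.nat 15 0 0 = 0 := by simp [hs₂]
    clear_value s₂
    refine Ends.seq (Q := fun s' => s'.nat 15 0 0 = (I.ball (i, j)).card) ?_ ?_
    · refine Ends.exp (a := 10 + 5) ?_ (by norm_num)
      refine Ends.forFin (N := I.nD) (fun A s' => s'.nat 15 0 0 =
        (A.filter fun j' => I.d i j' ≤ I.d i j).card) hD ?_ (by simpa using h15) ?_ ?_
      · exact fun s' hag => (hc₂.agree hag).nD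
      · intro j' A hj' s₃ hag₃ hx hI₃
        have hc₃ := hc₂.agree hag₃
        have hi₃ : s₃.nat 20 0 0 = i := by rw [hag₃.nat 20 (by decide), hi₂]
        have hj₃ : s₃.nat 21 0 0 = j := by rw [hag₃.nat 21 (by decide), hj₂]
        refine Ends.ite ?_ ?_
        · intro ht
          simp only [realLe_eval, ed, rget_eval, var_eval, hi₃, hj₃, hx, hc₃.d] at ht
          refine Ends.natSet ?_
          rw [Finset.filter_insert, if_pos ht, Finset.card_insert_of_notMem
            (fun h => hj' (Finset.mem_filter.1 h).1)]
          simp [hI₃]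
        · intro ht
          simp only [realLe_eval, ed, rget_eval, var_eval, hi₃, hj₃, hx, hc₃.d] at ht
          refine Ends.skip ?_
          rw [Finset.filter_insert, if_neg ht, hI₃]
      · intro s' _ h
        rw [h]
        rfl
    · intro s₃ hag₃ h15'
      have hc₃ := hc₂.agree hag₃
      have hi₃ : s₃.nat 20 0 0 = i := by rw [hag₃.nat 20 (by decide), hi₂]
      have hj₃ : s₃.nat 21 0 0 = j := by rw [hag₃.nat 21 (by decide), hj₂]
      rw [← hag₃.nat 6 (by decide)] at hI₂
      have key : ∀ v : ℕ, (v = 1 ↔ (i, j) ∈ I.allowed) →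
          ∀ u ∈ insert (i, j) B, ((s₃.setNat 6 i j v).nat 6 u.1 u.2 = 1 ↔ u ∈ I.allowed) := by
        intro v hv u hu
        rw [Mem.setNat_nat_eq]
        by_cases h : u = (i, j)
        · subst h; simpa using hv
        · have h' : ¬ ((u.1 : ℕ) = i ∧ (u.2 : ℕ) = j) := fun h' =>
            h (Prod.ext (Fin.ext h'.1) (Fin.ext h'.2))
          rw [if_neg h']
          exact hI₂ u ((Finset.mem_insert.1 hu).resolve_left h)
      refine Ends.ite ?_ ?_
      · intro ht
        simp only [natLe_eval, get_eval, var_eval, const_eval, hi₃, hc₃.L, h15'] at ht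
        refine Ends.natSet ?_
        simp only [var_eval, const_eval, hi₃, hj₃]
        exact key 1 ⟨fun _ => Inst.mem_allowed.2 ht, fun _ => rfl⟩
      · intro ht
        simp only [natLe_eval, get_eval, var_eval, const_eval, hi₃, hc₃.L, h15'] at ht
        refine Ends.natSet ?_
        simp only [var_eval, const_eval, hi₃, hj₃]
        exact key 0 ⟨fun h => by simp at h, fun h => (ht (Inst.mem_allowed.1 h)).elim⟩
  · exact fun s' _ hI i j => hI (i, j) (Finset.mem_univ _)

/-- Compute `⌈1 / ε⌉` in variable `14`. -/
def ceilP : Prog :=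
  .seq (setV 14 (.const 0)) (.while (.not (.realLe (.ofNat (.const 1)) (.mulNat (rvar 0) (var 14))))
    (setV 14 (.add (var 14) (.const 1))))

/-- There is no rounding operation, so the program counts up to the first `i` with `1 ≤ ε * i`. The
number `N` of rounds is bounded by `(M + 2) ^ N`, which puts `⌈1 / ε⌉₊` into the exponent. -/
theorem ceilP_spec {M : ℕ} {s : Mem} {ε : ℝ} (hε : 0 < ε) (h0 : s.real 0 0 0 = ε) :
    Ends M (⌈1 / ε⌉₊ + 9) ceilP s fun s' => s'.nat 14 0 0 = ⌈1 / ε⌉₊ := by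
  refine Ends.natSet_seq ?_
  refine Ends.exp (a := 6 + ⌈1 / ε⌉₊ + 2) ?_ (by omega)
  have hiff : ∀ i : ℕ, 1 ≤ ε * i ↔ ⌈1 / ε⌉₊ ≤ i := fun i => by
    rw [Nat.ceil_le, div_le_iff₀ hε, mul_comm]
  refine Ends.while (N := ⌈1 / ε⌉₊) (fun i s' => s'.nat 14 0 0 = i ∧ i ≤ ⌈1 / ε⌉₊) ?_ ?_ ?_ ?_ ?_
  · exact (Nat.lt_pow_self (by omega)).le
  · exact ⟨by simp, Nat.zero_le _⟩
  · rintro i s' hag ⟨hi, hle⟩ hb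
    have h0' : s'.real 0 0 0 = ε := by rw [hag.real 0 (by decide)]; simpa using h0
    simp only [not_eval, realLe_eval, rofNat_eval, const_eval, Nat.cast_one, rmul_eval, rvar_eval,
      var_eval, h0', hi, not_not, hiff] at hb
    rw [hi]
    exact le_antisymm hle hb
  · rintro i s' hag ⟨hi, hle⟩ hb
    have h0' : s'.real 0 0 0 = ε := by rw [hag.real 0 (by decide)]; simpa using h0
    simp only [not_eval, realLe_eval, rofNat_eval, const_eval, Nat.cast_one, rmul_eval, rvar_eval,
      var_eval, h0', hi, hiff, not_le] at hb
    exact hb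
  · rintro i s' hag ⟨hi, hle⟩ hb
    have h0' : s'.real 0 0 0 = ε := by rw [hag.real 0 (by decide)]; simpa using h0
    simp only [not_eval, realLe_eval, rofNat_eval, const_eval, Nat.cast_one, rmul_eval, rvar_eval,
      var_eval, h0', hi, hiff, not_le] at hb
    exact Ends.natSet ⟨by simp [hi], hb⟩

/-- Multiply variable `17` by variable `16`. -/
def mulP : Prog :=
  .seq (setV 18 (.const 0)) (.seq (forN 20 (var 16) (setV 18 (.add (var 18) (var 17))))
    (setV 17 (var 18)))

theorem mulP_spec {M b : ℕ} {s : Mem} (hb : s.nat 16 0 0 = b) (hbM : b ≤ M + 2) :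
    Ends M 20 mulP s fun s' => s'.nat 17 0 0 = s.nat 17 0 0 * b := by
  refine Ends.natSet_seq ?_
  refine Ends.seq (Q := fun s' => s'.nat 18 0 0 = s.nat 17 0 0 * b) ?_ ?_
  · refine Ends.exp (a := 6 + 1 + 4) ?_ (by norm_num)
    refine Ends.forN (N := b) (fun i s' => s'.nat 18 0 0 = s.nat 17 0 0 * i) (by simpa using hbM) ?_
      (by simp) ?_ (fun _ _ h => h)
    · intro s' hag
      rw [var_eval, hag.nat 16 (by decide)]
      simpa using hb
    · intro i _ s' hag _ hI
      have h17 : s'.nat 17 0 0 = s.nat 17 0 0 := by rw [hag.nat 17 (by decide)]; simp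
      refine Ends.natSet ?_
      simp [hI, h17, Nat.mul_succ]
  · intro s' hag h
    exact Ends.natSet (by simpa using h)

/-- Compute the number of guesses in variable `17`. -/
def powP : Prog := .seq (setV 17 (.const 1)) (forN 21 (var 14) (.seq mulP mulP))

theorem powP_spec {M b m : ℕ} {s : Mem} (hb : s.nat 16 0 0 = b) (hbM : b ≤ M + 2)
    (hm : s.nat 14 0 0 = m) : Ends M (m + 30) powP s fun s' => s'.nat 17 0 0 = (b * b) ^ m := by
  refine Ends.natSet_seq ?_
  refine Ends.exp (a := 21 + m + 4) ?_ (by omega)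
  refine Ends.forN (N := m) (fun i s' => s'.nat 17 0 0 = (b * b) ^ i)
    (Nat.lt_pow_self (by omega)).le ?_ (by simp) ?_ (fun _ _ h => h)
  · intro s' hag
    rw [var_eval, hag.nat 14 (by decide)]
    simpa using hm
  · intro i _ s₁ hag _ hI
    have hb₁ : s₁.nat 16 0 0 = b := by rw [hag.nat 16 (by decide)]; simpa using hb
    refine Ends.seq (mulP_spec hb₁ hbM) ?_
    intro s₂ hag₂ h₂
    refine (mulP_spec (b := b) (by rw [hag₂.nat 16 (by decide), hb₁]) hbM).imp ?_
    intro s₃ _ h₃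
    rw [h₃, h₂, hI, pow_succ, mul_assoc]

/-- Compute the number of rounds in variable `19`. -/
def countP : Prog :=
  .seq (setV 19 (.const 0)) (forN 20 (.add eF (.const 1)) (setV 19 (.add (var 19) eD)))

theorem countP_spec {I : Inst} {M : ℕ} {s : Mem} (hF : I.nF + 1 ≤ M + 2) (hc : Ctx I s) :
    Ends M 20 countP s fun s' => s'.nat 19 0 0 = (I.nF + 1) * I.nD := by
  refine Ends.natSet_seq ?_
  refine Ends.exp (a := 6 + 1 + 4) ?_ (by norm_num)
  refine Ends.forN (N := I.nF + 1) (fun i s' => s'.nat 19 0 0 = i * I.nD) (by simpa using hF) ?_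
    (by simp) ?_ (fun _ _ h => h)
  · intro s' hag
    simp only [eF, add_eval, var_eval, const_eval, hag.nat 0 (by decide)]
    simpa using hc.nF
  · intro i _ s' hag _ hI
    have h1 : s'.nat 1 0 0 = I.nD := by rw [hag.nat 1 (by decide)]; simpa using hc.nD
    refine Ends.natSet ?_
    simp [hI, h1, eD, Nat.succ_mul]

/-! ### Guesses as numbers to the base `I.n`. -/

namespace Inst

variable (I : Inst)

/-- The ball encoded by the last two digits of `x` to the base `|F| + |D|`, if it is allowed. -/
noncomputable def digit (x : ℕ) : Finset I.Pair :=
  I.allowed.filter fun u => (u.1 : ℕ) = x % I.n ∧ (u.2 : ℕ) = x / I.n % I.n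

/-- The family of balls encoded by the last `2 * m` digits of `x`. -/
noncomputable def decode : ℕ → ℕ → Finset I.Pair
  | 0, _ => ∅
  | m + 1, x => I.digit x ∪ decode m (x / I.n / I.n)

variable {I}

theorem mem_digit {x : ℕ} {u : I.Pair} : u ∈ I.digit x ↔
    u ∈ I.allowed ∧ (u.1 : ℕ) = x % I.n ∧ (u.2 : ℕ) = x / I.n % I.n := by simp [digit]

theorem decode_subset (m x : ℕ) : I.decode m x ⊆ I.allowed := by
  induction m generalizing x with
  | zero => simp [decode]
  | succ m ih => exact Finset.union_subset (fun u hu => (mem_digit.1 hu).1) (ih _)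

theorem digits_lt {a b x' m B : ℕ} (ha : a < B) (hb : b < B) (hx : x' < (B * B) ^ m) :
    a + B * (b + B * x') < (B * B) ^ (m + 1) := by
  have h2 : B * (b + B * x' + 1) ≤ B * (B * (x' + 1)) :=
    Nat.mul_le_mul_left _ (by rw [Nat.mul_succ]; omega)
  have h3 : B * (B * (x' + 1)) ≤ B * (B * (B * B) ^ m) :=
    Nat.mul_le_mul_left _ (Nat.mul_le_mul_left _ hx)
  have h4 : (B * B) ^ (m + 1) = B * (B * (B * B) ^ m) := by ring
  rw [Nat.mul_succ] at h2
  omega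

/-- Two digits encode one ball. Families with fewer than `m` balls are padded with digit pairs that
encode no ball. -/
theorem exists_decode (hD : 0 < I.nD) (m : ℕ) : ∀ X ⊆ I.allowed, X.card ≤ m →
    ∃ x < (I.n * I.n) ^ m, I.decode m x = X := by
  induction m with
  | zero =>
    intro X _ hX
    exact ⟨0, by simp, by simpa [decode, eq_comm] using hX⟩
  | succ m ih =>
    have key : ∀ a b x', a < I.n → b < I.n → x' < (I.n * I.n) ^ m →
        a + I.n * (b + I.n * x') < (I.n * I.n) ^ (m + 1) ∧
        I.decode (m + 1) (a + I.n * (b + I.n * x')) =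
          (I.allowed.filter fun u => (u.1 : ℕ) = a ∧ (u.2 : ℕ) = b) ∪ I.decode m x' := by
      intro a b x' ha hb hx
      have hn : 0 < I.n := by omega
      have h1 : (a + I.n * (b + I.n * x')) / I.n = b + I.n * x' := by
        rw [Nat.add_mul_div_left _ _ hn, Nat.div_eq_of_lt ha, zero_add]
      have h2 : (b + I.n * x') / I.n = x' := by
        rw [Nat.add_mul_div_left _ _ hn, Nat.div_eq_of_lt hb, zero_add]
      refine ⟨digits_lt ha hb hx, ?_⟩
      rw [decode, digit, h1, h2, Nat.add_mul_mod_self_left, Nat.add_mul_mod_self_left,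
        Nat.mod_eq_of_lt ha, Nat.mod_eq_of_lt hb]
    intro X hXA hX
    rcases X.eq_empty_or_nonempty with rfl | ⟨u, hu⟩
    · obtain ⟨x', hx', hdec⟩ := ih ∅ hXA (by simp)
      -- `I.nF` is a legal digit because there are clients, but it is not the index of a facility.
      obtain ⟨h1, h2⟩ := key I.nF 0 x' (by unfold n; omega) (by unfold n; omega) hx'
      refine ⟨_, h1, ?_⟩
      rw [h2, hdec, Finset.union_empty, Finset.filter_eq_empty_iff]
      intro u _ h
      have := u.1.2
      omega
    · obtain ⟨x', hx', hdec⟩ := ih (X.erase u) ((Finset.erase_subset _ _).trans hXA)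
        (by rw [Finset.card_erase_of_mem hu]; omega)
      have hu1 := u.1.2
      have hu2 := u.2.2
      obtain ⟨h1, h2⟩ := key u.1 u.2 x' (by unfold n; omega) (by unfold n; omega) hx'
      refine ⟨_, h1, ?_⟩
      have : (I.allowed.filter fun v => (v.1 : ℕ) = u.1 ∧ (v.2 : ℕ) = u.2) = {u} := by
        ext v
        simp only [Finset.mem_filter, Finset.mem_singleton]
        constructor
        · exact fun h => Prod.ext (Fin.ext h.2.1) (Fin.ext h.2.2)
        · rintro rfl
          exact ⟨hXA hu, rfl, rfl⟩
      rw [h2, hdec, this, ← Finset.insert_eq, Finset.insert_erase hu]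

end Inst

/-! ### Decoding a guess on the machine. -/

/-- Divide variable `33` by variable `16`; the quotient goes to variable `35`, the remainder stays in
variable `33`. -/
def divP : Prog :=
  .seq (setV 35 (.const 0)) (.while (.natLe (var 16) (var 33))
    (.seq (setV 33 (.sub (var 33) (var 16))) (setV 35 (.add (var 35) (.const 1)))))

/-- Division is repeated subtraction, which takes up to `x` rounds; this is affordable since the
number of guesses itself has the order of the largest code. -/
theorem divP_spec {M b x c : ℕ} {s : Mem} (hb : s.nat 16 0 0 = b) (hb0 : 0 < b)
    (hx : s.nat 33 0 0 = x) (hxc : x ≤ (M + 2) ^ c) :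
    Ends M (c + 12) divP s fun s' => s'.nat 33 0 0 = x % b ∧ s'.nat 35 0 0 = x / b := by
  refine Ends.natSet_seq ?_
  refine Ends.exp (a := 7 + c + 2) ?_ (by omega)
  refine Ends.while (N := x) (fun i s' => s'.nat 35 0 0 = i ∧ s'.nat 33 0 0 + b * i = x) hxc ?_ ?_ ?_ ?_
  · simpa using hx
  · rintro i s' hag ⟨hi, hr⟩ ht
    have h16 : s'.nat 16 0 0 = b := by rw [hag.nat 16 (by decide)]; simpa using hb
    simp only [natLe_eval, var_eval, h16, not_le] at ht
    rw [← hr, Nat.add_mul_mod_self_left, Nat.mod_eq_of_lt ht, Nat.add_mul_div_left _ _ hb0,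
      Nat.div_eq_of_lt ht, zero_add]
    exact ⟨rfl, hi⟩
  · rintro i s' hag ⟨hi, hr⟩ ht
    have h16 : s'.nat 16 0 0 = b := by rw [hag.nat 16 (by decide)]; simpa using hb
    simp only [natLe_eval, var_eval, h16] at ht
    have : i ≤ b * i := Nat.le_mul_of_pos_left i hb0
    omega
  · rintro i s' hag ⟨hi, hr⟩ ht
    have h16 : s'.nat 16 0 0 = b := by rw [hag.nat 16 (by decide)]; simpa using hb
    simp only [natLe_eval, var_eval, h16] at ht
    refine Ends.natSet_seq (Ends.natSet ?_)
    simp only [const_eval, sub_eval, add_eval, var_eval, h16, Mem.setNat_nat_self, ne_eq,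
      Nat.reduceEqDiff, not_false_eq_true, Mem.setNat_nat_ne, hi, Nat.mul_succ, true_and]
    omega

/-- Mark the ball encoded by the last two digits of variable `33` and remove these digits. -/
def digitP : Prog :=
  .seq divP (.seq (setV 36 (var 33)) (.seq (setV 33 (var 35)) (.seq divP (.seq (setV 37 (var 33))
    (.seq (setV 33 (var 35))
      (.ite (.and (.not (.natLe eF (var 36))) (.and (.not (.natLe eD (var 37)))
          (natEq (.get 6 (var 36) (var 37)) (.const 1))))
        (.natSet 7 (var 36) (var 37) (.const 1)) .skip))))))

theorem digitP_spec {I : Inst} {M x c : ℕ} {s : Mem} (hn : 0 < I.n) (hc : Ctx I s)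
    (h16 : s.nat 16 0 0 = I.n) (h6 : Marks s 6 I.allowed) {X : Finset I.Pair} (hX : Marks s 7 X)
    (hx : s.nat 33 0 0 = x) (hxc : x ≤ (M + 2) ^ c) :
    Ends M (c + 20) digitP s fun s' => Marks s' 7 (X ∪ I.digit x) ∧
      s'.nat 33 0 0 = x / I.n / I.n := by
  refine Ends.seq ((divP_spec h16 hn hx hxc).exp (by omega)) ?_
  rintro s₁ hag₁ ⟨h33, h35⟩
  refine Ends.natSet_seq (Ends.natSet_seq ?_)
  set s₂ := (s₁.setNat 36 0 0 (s₁.nat 33 0 0)).setNat 33 0 0 (s₁.nat 35 0 0) with hs₂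
  change Ends M (c + 17) _ s₂ _
  have hc₁ := hc.agree hag₁
  have hc₂ : Ctx I s₂ := ⟨hc₁.nF, hc₁.nD, hc₁.k, hc₁.L, hc₁.d⟩
  have h6₂ : Marks s₂ 6 I.allowed := by
    have := h6.agree hag₁
    exact this
  have hX₂ : Marks s₂ 7 X := by
    have := hX.agree hag₁
    exact this
  have h16₂ : s₂.nat 16 0 0 = I.n := by
    change s₁.nat 16 0 0 = _
    rw [hag₁.nat 16 (by decide), h16]
  have h36 : s₂.nat 36 0 0 = x % I.n := by simp [hs₂, h33]
  have h33₂ : s₂.nat 33 0 0 = x / I.n := by simp [hs₂, h35]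
  clear_value s₂
  refine Ends.seq ((divP_spec (c := c) h16₂ hn h33₂ ((Nat.div_le_self _ _).trans hxc)).exp
    (by omega)) ?_
  rintro s₃ hag₃ ⟨h33₃, h35₃⟩
  refine Ends.natSet_seq (Ends.natSet_seq ?_)
  set s₄ := (s₃.setNat 37 0 0 (s₃.nat 33 0 0)).setNat 33 0 0 (s₃.nat 35 0 0) with hs₄
  change Ends M (c + 14) _ s₄ _
  have hc₃ := hc₂.agree hag₃
  have hc₄ : Ctx I s₄ := ⟨hc₃.nF, hc₃.nD, hc₃.k, hc₃.L, hc₃.d⟩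
  have h6₄ : Marks s₄ 6 I.allowed := by
    have := h6₂.agree hag₃
    exact this
  have hX₄ : Marks s₄ 7 X := by
    have := hX₂.agree hag₃
    exact this
  have h36₄ : s₄.nat 36 0 0 = x % I.n := by
    change s₃.nat 36 0 0 = _
    rw [hag₃.nat 36 (by decide), h36]
  have h37 : s₄.nat 37 0 0 = x / I.n % I.n := by simp [hs₄, h33₃]
  have h33₄ : s₄.nat 33 0 0 = x / I.n / I.n := by simp [hs₄, h35₃]
  clear_value s₄
  refine Ends.ite ?_ ?_
  · intro ht
    simp only [and_eval, not_eval, natLe_eval, eF, eD, var_eval, const_eval, hc₄.nF, hc₄.nD, h36₄,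
      h37, natEq_eval, get_eval, not_le] at ht
    obtain ⟨h1, h2, h3⟩ := ht
    have hmem : ((⟨x % I.n, h1⟩, ⟨x / I.n % I.n, h2⟩) : I.Pair) ∈ I.allowed :=
      (h6₄ ⟨x % I.n, h1⟩ ⟨x / I.n % I.n, h2⟩).1 h3
    refine Ends.natSet ⟨fun i j => ?_, by simpa using h33₄⟩
    simp only [var_eval, const_eval, h36₄, h37, Mem.setNat_nat_eq, Finset.mem_union, Inst.mem_digit]
    split_ifs with h
    · refine ⟨fun _ => Or.inr ⟨?_, h⟩, fun _ => rfl⟩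
      convert hmem using 2
      · exact Fin.ext h.1
      · exact Fin.ext h.2
    · rw [hX₄ i j]
      tauto
  · intro ht
    simp only [and_eval, not_eval, natLe_eval, eF, eD, var_eval, const_eval, hc₄.nF, hc₄.nD, h36₄,
      h37, natEq_eval, get_eval, not_le] at ht
    refine Ends.skip ⟨fun i j => ?_, h33₄⟩
    rw [hX₄ i j, Finset.mem_union, Inst.mem_digit]
    refine ⟨Or.inl, fun h => h.resolve_right ?_⟩
    rintro ⟨hA, h1, h2⟩
    simp only at h1 h2
    refine ht ⟨h1 ▸ i.2, h2 ▸ j.2, ?_⟩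
    rw [← h1, ← h2]
    exact (h6₄ i j).2 hA

/-- Mark in array `8` the clients in balls of the array `7`. -/
def coverP : Prog :=
  forN 70 eD (.seq (.natSet 8 (var 70) (.const 0) (.const 0))
    (forPairs 71 72 eF eD (.ite (.and (natEq (.get 7 (var 71) (var 72)) (.const 1))
        (.realLe (ed (var 71) (var 70)) (ed (var 71) (var 72))))
      (.natSet 8 (var 70) (.const 0) (.const 1)) .skip)))

theorem coverP_spec {I : Inst} {M : ℕ} {s : Mem} (hF : I.nF ≤ M + 2) (hD : I.nD ≤ M + 2)
    (hc : Ctx I s) {X : Finset I.Pair} (hX : Marks s 7 X) :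
    Ends M 40 coverP s fun s' => ∀ j : Fin I.nD, s'.nat 8 j 0 = 1 ↔ ∃ u ∈ X, j ∈ I.ball u := by
  classical
  refine Ends.exp (a := 30 + 5) ?_ (by norm_num)
  refine Ends.forFin (N := I.nD) (fun A s' => ∀ j ∈ A, s'.nat 8 j 0 = 1 ↔ ∃ u ∈ X, j ∈ I.ball u) hD
    ?_ (by simp) ?_ (fun s' _ h j => h j (Finset.mem_univ _))
  · exact fun s' hag => (hc.agree hag).nD
  intro j A hj s₁ hag₁ hx hI
  have hc₁ := hc.agree hag₁
  have hX₁ := hX.agree hag₁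
  refine Ends.natSet_seq ?_
  set s₂ := s₁.setNat 8 (s₁.nat 70 0 0) 0 0 with hs₂
  change Ends M 29 _ s₂ _
  have hc₂ : Ctx I s₂ := ⟨hc₁.nF, hc₁.nD, hc₁.k, hc₁.L, hc₁.d⟩
  have hX₂ : Marks s₂ 7 X := hX₁
  have hx₂ : s₂.nat 70 0 0 = j := hx
  have h8 : s₂.nat 8 j 0 = 0 := by rw [hs₂, hx]; simp
  have hI₂ : ∀ j' ∈ A, s₂.nat 8 j' 0 = 1 ↔ ∃ u ∈ X, j' ∈ I.ball u := by
    intro j' hj'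
    have hne : j' ≠ j := by rintro rfl; exact hj hj'
    rw [hs₂, hx, Mem.setNat_nat_eq, if_neg (by simpa [Fin.val_inj] using hne)]
    exact hI j' hj'
  clear_value s₂
  refine Ends.exp (a := 15 + 10) ?_ (by norm_num)
  refine Ends.forPairs (N := I.nF) (K := I.nD) (fun B s' =>
    (∀ j' ∈ A, s'.nat 8 j' 0 = 1 ↔ ∃ u ∈ X, j' ∈ I.ball u) ∧
      (s'.nat 8 j 0 = 1 ↔ ∃ u ∈ X ∩ B, j ∈ I.ball u)) hF hD ?_ ?_ ?_ ?_
  · exact fun s' hag => ⟨(hc₂.agree hag).nF, (hc₂.agree hag).nD⟩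
  · exact ⟨hI₂, by simp [h8]⟩
  · rintro i j₀ B hB s₃ hag₃ hi hj₀ ⟨hI₃, hj₃⟩
    have hc₃ := hc₂.agree hag₃
    have hX₃ := hX₂.agree hag₃
    have hx₃ : s₃.nat 70 0 0 = j := by rw [hag₃.nat 70 (by decide), hx₂]
    refine Ends.ite ?_ ?_
    · intro ht
      simp only [and_eval, natEq_eval, get_eval, var_eval, const_eval, hi, hj₀, hX₃ i j₀, realLe_eval,
        ed, rget_eval, hx₃, hc₃.d] at ht
      refine Ends.natSet ⟨fun j' hj' => ?_, ?_⟩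
      · have hne : j' ≠ j := by rintro rfl; exact hj hj'
        simp only [var_eval, const_eval, hx₃, Mem.setNat_nat_eq, Fin.val_inj, hne, false_and, if_false]
        exact hI₃ j' hj'
      · simp only [var_eval, const_eval, hx₃, Mem.setNat_nat_self, true_iff]
        exact ⟨(i, j₀), by simp [ht.1], Inst.mem_ball.2 ht.2⟩
    · intro ht
      simp only [and_eval, natEq_eval, get_eval, var_eval, const_eval, hi, hj₀, hX₃ i j₀, realLe_eval,
        ed, rget_eval, hx₃, hc₃.d] at ht
      refine Ends.skip ⟨hI₃, hj₃.trans ⟨?_, ?_⟩⟩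
      · rintro ⟨u, hu, hju⟩
        simp only [Finset.mem_inter] at hu
        exact ⟨u, by simp [hu.1, hu.2], hju⟩
      · rintro ⟨u, hu, hju⟩
        simp only [Finset.mem_inter, Finset.mem_insert] at hu
        rcases hu with ⟨huX, rfl | huB⟩
        · exact (ht ⟨huX, Inst.mem_ball.1 hju⟩).elim
        · exact ⟨u, Finset.mem_inter.2 ⟨huX, huB⟩, hju⟩
  · rintro s' _ ⟨h1, h2⟩ x hx
    rcases Finset.mem_insert.1 hx with rfl | hx
    · simpa using h2
    · exact h1 x hx

/-- Decode the guess in variable `30`. -/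
def decodeP : Prog :=
  .seq (forPairs 70 71 eF eD (.natSet 7 (var 70) (var 71) (.const 0)))
    (.seq (setV 33 (var 30)) (.seq (forN 34 (var 14) digitP) coverP))

/-- After `q` rounds the marked balls and the `m - q` digit pairs left in variable `33` together
still encode the guess. Of the `3 * m` in the exponent, `2 * m` bounds the code in the divisions and
`m` the number of rounds. -/
theorem decodeP_spec {I : Inst} {M x m : ℕ} {s : Mem} (hnM : I.n ≤ M + 2) (hn : 0 < I.n)
    (hc : Ctx I s) (h16 : s.nat 16 0 0 = I.n) (h6 : Marks s 6 I.allowed)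
    (h14 : s.nat 14 0 0 = m) (hx : s.nat 30 0 0 = x) (hxc : x ≤ (M + 2) ^ (2 * m)) :
    Ends M (3 * m + 60) decodeP s fun s' => Marks s' 7 (I.decode m x) ∧
      ∀ j : Fin I.nD, s'.nat 8 j 0 = 1 ↔ ∃ u ∈ I.decode m x, j ∈ I.ball u := by
  have hF : I.nF ≤ M + 2 := le_trans (Nat.le_add_right _ _) hnM
  have hD : I.nD ≤ M + 2 := le_trans (Nat.le_add_left _ _) hnM
  refine Ends.seq (Q := fun s' => Marks (I := I) s' 7 ∅) ?_ ?_
  · refine Ends.exp (a := 10 + 10) ?_ (by omega)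
    refine Ends.forPairs (N := I.nF) (K := I.nD) (fun B s' => ∀ u ∈ B, s'.nat 7 u.1 u.2 = 0)
      hF hD ?_ (by simp) ?_ ?_
    · exact fun s' hag => ⟨(hc.agree hag).nF, (hc.agree hag).nD⟩
    · intro i j B hB s' hag hi hj hI
      refine Ends.natSet fun u hu => ?_
      simp only [var_eval, const_eval, hi, hj, Mem.setNat_nat_eq]
      split_ifs with h
      · rfl
      · refine hI u ((Finset.mem_insert.1 hu).resolve_left ?_)
        rintro rfl
        exact h ⟨rfl, rfl⟩
    · intro s' _ hI i j
      simp [hI (i, j) (Finset.mem_univ _)]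
  intro s₁ hag₁ hX₁
  refine Ends.natSet_seq ?_
  set s₂ := s₁.setNat 33 0 0 (s₁.nat 30 0 0) with hs₂
  change Ends M (3 * m + 58) _ s₂ _
  have hc₁ := hc.agree hag₁
  have hc₂ : Ctx I s₂ := ⟨hc₁.nF, hc₁.nD, hc₁.k, hc₁.L, hc₁.d⟩
  have h6₂ : Marks s₂ 6 I.allowed := by
    have := h6.agree hag₁
    exact this
  have hX₂ : Marks (I := I) s₂ 7 ∅ := hX₁
  have h16₂ : s₂.nat 16 0 0 = I.n := by
    change s₁.nat 16 0 0 = _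
    rw [hag₁.nat 16 (by decide), h16]
  have h14₂ : s₂.nat 14 0 0 = m := by
    change s₁.nat 14 0 0 = _
    rw [hag₁.nat 14 (by decide), h14]
  have h33 : s₂.nat 33 0 0 = x := by
    rw [hs₂, hag₁.nat 30 (by decide), hx]; simp
  clear_value s₂
  refine Ends.seq (Q := fun s' => Marks s' 7 (I.decode m x)) ?_ ?_
  · refine Ends.exp (a := 2 * m + 20 + m + 4) ?_ (by omega)
    refine Ends.forN (N := m) (fun q s' => s'.nat 33 0 0 ≤ x ∧ ∃ X : Finset I.Pair, Marks s' 7 X ∧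
      X ∪ I.decode (m - q) (s'.nat 33 0 0) = I.decode m x) (Nat.lt_pow_self (by omega)).le ?_ ?_ ?_ ?_
    · intro s' hag
      rw [var_eval, hag.nat 14 (by decide), h14₂]
    · exact ⟨h33.le, ∅, hX₂, by simp [h33]⟩
    · rintro q hq s₃ hag₃ - ⟨hle, X, hX, hdec⟩
      refine (digitP_spec hn (hc₂.agree hag₃) (by rw [hag₃.nat 16 (by decide), h16₂])
        (h6₂.agree hag₃) hX rfl (hle.trans hxc)).imp ?_
      rintro s₄ - ⟨hX₄, h33₄⟩
      refine ⟨?_, _, hX₄, ?_⟩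
      · rw [h33₄]
        exact ((Nat.div_le_self _ _).trans (Nat.div_le_self _ _)).trans hle
      · rw [h33₄, ← hdec, show m - q = m - (q + 1) + 1 by omega, Inst.decode, Finset.union_assoc]
    · rintro s' - ⟨-, X, hX, hdec⟩
      rw [Nat.sub_self, Inst.decode, Finset.union_empty] at hdec
      rwa [← hdec]
  · intro s₃ hag₃ hX₃
    refine ((coverP_spec hF hD (hc₂.agree hag₃) hX₃).exp (by omega)).imp ?_
    exact fun s₄ hag₄ h₄ => ⟨hX₃.agree hag₄, h₄⟩

/-! ### The algorithm -/

/-- Try all radius bounds for the current guess. -/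
def boundsP : Prog := forPairs 31 32 eF eD (.seq (setR 6 (ed (var 31) (var 32))) processP)

theorem boundsP_spec {I : Inst} {M : ℕ} {s : Mem} (hn : I.nF + I.nD ≤ M + 2) (hD0 : 0 < I.nD)
    (hc : Ctx I s) {X : Finset I.Pair} (h6 : Marks s 6 I.allowed) (hX : Marks s 7 X)
    (hXA : X ⊆ I.allowed) (h8 : ∀ j : Fin I.nD, s.nat 8 j 0 = 1 ↔ ∃ u ∈ X, j ∈ I.ball u)
    (h19 : s.nat 19 0 0 = (I.nF + 1) * I.nD) (hsol : Sol I s) :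
    Ends M 125 boundsP s fun s' => Sol I s' ∧ (∀ V, Good V s → Good V s') ∧
      ∀ u P, I.Guess X (I.rad u) P → Good (I.target X (I.rad u) P) s' := by
  refine Ends.exp (a := 111 + 10) ?_ (by norm_num)
  refine Ends.forPairs (N := I.nF) (K := I.nD) (fun B s' => Sol I s' ∧ (∀ V, Good V s → Good V s') ∧
      ∀ u ∈ B, ∀ P, I.Guess X (I.rad u) P → Good (I.target X (I.rad u) P) s') (by omega) (by omega)
      ?_ ⟨hsol, fun _ h => h, by simp⟩ ?_ ?_
  · exact fun s' hag => ⟨(hc.agree hag).nF, (hc.agree hag).nD⟩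
  · rintro i j B hB s₁ hag hi hj ⟨hsol₁, hgood₁, hB₁⟩
    have hc₁ := hc.agree hag
    have h6₁ := h6.agree hag
    have hX₁ := hX.agree hag
    have hR : (s₁.setReal 6 0 0 (s₁.real 1 (s₁.nat 31 0 0) (s₁.nat 32 0 0))).real 6 0 0 =
        I.rad (i, j) := by
      rw [Mem.setReal_real_self, hi, hj, hc₁.d]; rfl
    refine Ends.realSet_seq ?_
    set s₂ := s₁.setReal 6 0 0 (s₁.real 1 (s₁.nat 31 0 0) (s₁.nat 32 0 0))
    change Ends M 110 _ s₂ _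
    refine (processP_spec (s := s₂) hn hD0 ⟨hc₁.nF, hc₁.nD, hc₁.k, hc₁.L, hc₁.d⟩ h6₁ hX₁ hXA ?_ ?_
      (by rw [hR]; exact Inst.rad_nonneg _) hsol₁).imp ?_
    · change ∀ j : Fin I.nD, s₁.nat 8 j 0 = 1 ↔ _
      rw [hag.nat 8 (by decide)]
      exact h8
    · change s₁.nat 19 0 0 = _
      rw [hag.nat 19 (by decide), h19]
    · rintro s₃ - ⟨hsol₃, hgood₃, hP₃⟩
      rw [hR] at hP₃
      refine ⟨hsol₃, fun V hV => hgood₃ V (hgood₁ V hV), fun u hu P hP => ?_⟩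
      rcases Finset.mem_insert.1 hu with rfl | hu
      · exact hP₃ P hP
      · exact hgood₃ _ (hB₁ u hu P hP)
  · rintro s' - ⟨h1, h2, h3⟩
    exact ⟨h1, h2, fun u => h3 u (Finset.mem_univ _)⟩

/-- The whole algorithm for an instance with clients. -/
def searchP : Prog :=
  .seq allowedP (.seq ceilP (.seq (setV 16 (.add eF eD)) (.seq powP (.seq countP
    (forN 30 (var 17) (.seq decodeP boundsP))))))

/-- The exponent adds `2 * m` for the number of codes to the `3 * m` for decoding one of them. All
codes and all radius bounds are tried, so the guarantee covers any compatible `P` without the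
program knowing it. -/
theorem searchP_spec {I : Inst} {M : ℕ} {s : Mem} {ε : ℝ} (hε : 0 < ε) (hn : I.n ≤ M + 2)
    (hD0 : 0 < I.nD) (hc : Ctx I s) (h0 : s.real 0 0 0 = ε) (h13 : s.nat 13 0 0 ≠ 1) :
    Ends M (5 * ⌈1 / ε⌉₊ + 140) searchP s fun s' => Sol I s' ∧
      ∀ x < (I.n * I.n) ^ ⌈1 / ε⌉₊, ∀ u P, I.Guess (I.decode ⌈1 / ε⌉₊ x) (I.rad u) P →
        Good (I.target (I.decode ⌈1 / ε⌉₊ x) (I.rad u) P) s' := by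
  have hF : I.nF ≤ M + 2 := le_trans (Nat.le_add_right _ _) hn
  have hD : I.nD ≤ M + 2 := le_trans (Nat.le_add_left _ _) hn
  have hn0 : 0 < I.n := by unfold Inst.n; omega
  have hF1 : I.nF + 1 ≤ M + 2 := by unfold Inst.n at hn; omega
  set m := ⌈1 / ε⌉₊ with hm
  have hcard : (I.n * I.n) ^ m ≤ (M + 2) ^ (2 * m) := by
    rw [pow_mul, pow_two]
    exact Nat.pow_le_pow_left (Nat.mul_le_mul hn hn) _
  refine Ends.seq ((allowedP_spec hF hD hc).exp (by omega)) ?_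
  intro s₁ hag₁ h6
  have hc₁ := hc.agree hag₁
  refine Ends.seq ((ceilP_spec hε (by rw [hag₁.real 0 (by decide), h0])).exp (by omega)) ?_
  intro s₂ hag₂ h14
  have hc₂ := hc₁.agree hag₂
  refine Ends.natSet_seq ?_
  set s₃ := s₂.setNat 16 0 0 (s₂.nat 0 0 0 + s₂.nat 1 0 0) with hs₃
  change Ends M (5 * m + 137) _ s₃ _
  have hc₃ : Ctx I s₃ := ⟨hc₂.nF, hc₂.nD, hc₂.k, hc₂.L, hc₂.d⟩
  have h6₃ : Marks s₃ 6 I.allowed := by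
    have := h6.agree hag₂
    exact this
  have h14₃ : s₃.nat 14 0 0 = m := h14
  have h16 : s₃.nat 16 0 0 = I.n := by rw [hs₃, hc₂.nF, hc₂.nD]; simp [Inst.n]
  have h13₃ : s₃.nat 13 0 0 ≠ 1 := by
    change s₂.nat 13 0 0 ≠ 1
    rwa [hag₂.nat 13 (by decide), hag₁.nat 13 (by decide)]
  clear_value s₃
  refine Ends.seq ((powP_spec h16 hn h14₃).exp (by omega)) ?_
  intro s₄ hag₄ h17
  have hc₄ := hc₃.agree hag₄
  refine Ends.seq ((countP_spec hF1 hc₄).exp (by omega)) ?_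
  intro s₅ hag₅ h19
  have hc₅ := hc₄.agree hag₅
  have h6₅ := (h6₃.agree hag₄).agree hag₅
  have h14₅ : s₅.nat 14 0 0 = m := by rw [hag₅.nat 14 (by decide), hag₄.nat 14 (by decide), h14₃]
  have h16₅ : s₅.nat 16 0 0 = I.n := by rw [hag₅.nat 16 (by decide), hag₄.nat 16 (by decide), h16]
  have h17₅ : s₅.nat 17 0 0 = (I.n * I.n) ^ m := by rw [hag₅.nat 17 (by decide), h17]
  have h13₅ : s₅.nat 13 0 0 ≠ 1 := by
    rwa [hag₅.nat 13 (by decide), hag₄.nat 13 (by decide)]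
  refine Ends.exp (a := 3 * m + 127 + 2 * m + 4) ?_ (by omega)
  refine Ends.forN (N := (I.n * I.n) ^ m) (fun x s' => Sol I s' ∧
    ∀ x' < x, ∀ u P, I.Guess (I.decode m x') (I.rad u) P →
      Good (I.target (I.decode m x') (I.rad u) P) s') hcard ?_ ?_ ?_ (fun _ _ h => h)
  · intro s' hag
    rw [var_eval, hag.nat 17 (by decide), h17₅]
  · exact ⟨fun h => (h13₅ h).elim, by simp⟩
  · rintro x hx s₆ hag₆ h30 ⟨hsol, hdone⟩
    have hc₆ := hc₅.agree hag₆
    have h6₆ := h6₅.agree hag₆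
    refine Ends.seq ((decodeP_spec (m := m) hn hn0 hc₆ (by rw [hag₆.nat 16 (by decide), h16₅]) h6₆
      (by rw [hag₆.nat 14 (by decide), h14₅]) h30 (hx.le.trans hcard)).exp (by omega)) ?_
    rintro s₇ hag₇ ⟨hX, h8⟩
    refine ((boundsP_spec hn hD0 (hc₆.agree hag₇) (h6₆.agree hag₇) hX (Inst.decode_subset m x) h8 ?_
      (hsol.agree hag₇)).exp (by omega)).imp ?_
    · rw [hag₇.nat 19 (by decide), hag₆.nat 19 (by decide), h19]
    · rintro s₈ - ⟨hsol₈, hgood₈, hP₈⟩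
      refine ⟨hsol₈, fun x' hx' u P hP => ?_⟩
      rcases Nat.lt_succ_iff_lt_or_eq.1 hx' with h | rfl
      · exact hgood₈ _ ((hdone x' h u P hP).agree hag₇)
      · exact hP₈ u P hP

/-- The largest balls of an optimal solution and the bound for the others form a guess with a good
target. -/
theorem Inst.exists_guess {I : Inst} (hfe : I.IsFeasible) (hD0 : 0 < I.nD) {ε : ℝ} (hε : 0 < ε) :
    ∃ X ⊆ I.allowed, X.card ≤ ⌈1 / ε⌉₊ ∧ ∃ u P, I.Guess X (I.rad u) P ∧
      I.target X (I.rad u) P ≤ (3.83 + 8 * ε) * I.opt := by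
  obtain ⟨P, hcov, hk, hnF, hL, hcost⟩ := exists_opt_pairs hfe
  obtain ⟨X, hXP, hXm, hbig⟩ := exists_largest P ⌈1 / ε⌉₊
  have hsum : 0 ≤ ∑ u ∈ P, I.rad u := Finset.sum_nonneg fun _ _ => rad_nonneg _
  have hopt : 0 ≤ I.opt := hsum.trans hcost
  refine ⟨X, fun u hu => mem_allowed.2 (hL u (hXP hu)), hXm, ?_⟩
  -- If everything is guessed, any pair may serve as radius bound, since `target` does not charge
  -- it.
  by_cases hPX : P ⊆ X
  · obtain ⟨u, -, -⟩ := hcov ⟨0, hD0⟩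
    refine ⟨u, P, ⟨hcov, hk, hnF, hL, hXP, fun v hv hvX => (hvX (hPX hv)).elim⟩, ?_⟩
    rw [target, if_pos hPX]
    have : 0 ≤ ε * I.opt := by positivity
    linarith
  · have hne : (P \ X).Nonempty := Finset.sdiff_nonempty.2 hPX
    obtain ⟨u, hu, hmax⟩ := Finset.exists_max_image (P \ X) I.rad hne
    refine ⟨u, P, ⟨hcov, hk, hnF, hL, hXP, fun v hv hvX => hmax v (by simp [hv, hvX])⟩, ?_⟩
    rw [target, if_neg hPX]
    have h1 : ∑ v ∈ X, I.rad v ≤ ∑ v ∈ P, I.rad v :=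
      Finset.sum_le_sum_of_subset_of_nonneg hXP fun _ _ _ => rad_nonneg _
    have h2 : 1 / ε * I.rad u ≤ I.opt :=
      (mul_le_mul_of_nonneg_right (Nat.le_ceil _) (rad_nonneg u)).trans
        ((hbig u hu).trans (h1.trans hcost))
    -- At least `1 / ε` balls of total radius at most `I.opt` are as large as `u`. The loss is `2 *
    -- 3.83 * ε = 7.66 * ε`, rounded up to `8 * ε`.
    have h3 : I.rad u ≤ ε * I.opt := by
      rw [one_div, inv_mul_le_iff₀ hε] at h2
      exact h2
    have : 0 ≤ ε * I.opt := by positivity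
    linarith

/-! ### The initial memory and the main program. -/

theorem input_ctx (ε : ℝ) (I : Inst) : Ctx I (input ε I) where
  nF := by simp [input]
  nD := by simp [input]
  k := by simp [input]
  L := fun i => by simp [input]
  d := fun i j => by simp [input, Inst.d]

/-- The program: nothing needs to be done without clients. -/
def mainP : Prog := .ite (.natLe (.const 1) eD) searchP .skip

end LBkSR

/-- There is one program, with the parameter `ε` as part of its input, and one absolute constant `C`,
such that for every `ε > 0` and every instance the program halts within `n ^ (C * ⌈1 / ε⌉)` steps
(`n ≥ 2`), and if the instance has a feasible solution then the output is a feasible solution of cost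
at most `(3.83 + C * ε)` times the optimum. -/
theorem theorem3 :
    ∃ (P : LBkSR.Prog) (C : ℕ), ∀ (ε : ℝ), 0 < ε → ∀ (I : LBkSR.Inst),
      ∃ (t : ℕ) (s : LBkSR.Mem),
        LBkSR.Runs P (LBkSR.input ε I) t s ∧
        t ≤ (max 2 I.n) ^ (C * ⌈1 / ε⌉₊) ∧
        (I.IsFeasible →
          ∃ (S : Finset (Fin I.nF)) (σ : Fin I.nD → Fin I.nF),
            LBkSR.Outputs I s S σ ∧ I.Feasible S σ ∧
            I.cost S σ ≤ (3.83 + C * ε) * I.opt) := by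
  -- The constant serves twice: `5 * m + 141 ≤ 150 * m` for `m = ⌈1 / ε⌉₊ ≥ 1`, and `8 ≤ 150` in the
  -- ratio.
  refine ⟨LBkSR.mainP, 150, fun ε hε I => ?_⟩
  have hm : 1 ≤ ⌈1 / ε⌉₊ := Nat.one_le_ceil_iff.2 (by positivity)
  have hc := LBkSR.input_ctx ε I
  -- With this `M` the base `M + 2` is exactly `max 2 I.n`.
  have key : LBkSR.Ends (max 2 I.n - 2) (5 * ⌈1 / ε⌉₊ + 141) LBkSR.mainP (LBkSR.input ε I) fun s =>
      I.IsFeasible → ∃ S σ, LBkSR.Outputs I s S σ ∧ I.Feasible S σ ∧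
        I.cost S σ ≤ (3.83 + (150 : ℕ) * ε) * I.opt := by
    refine LBkSR.Ends.ite ?_ ?_
    · intro ht
      simp only [LBkSR.natLe_eval, LBkSR.eD, LBkSR.var_eval, LBkSR.const_eval, hc.nD] at ht
      refine (LBkSR.searchP_spec hε (by omega) ht hc (by simp [LBkSR.input])
        (by simp [LBkSR.input])).imp ?_
      rintro s - ⟨hsol, hgood⟩ hfe
      obtain ⟨X, hXA, hXm, u, P, hP, htarget⟩ := LBkSR.Inst.exists_guess hfe ht hε
      obtain ⟨x, hx, rfl⟩ := LBkSR.Inst.exists_decode ht _ X hXA hXm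
      have hg := (hgood x hx u P hP).mono htarget
      obtain ⟨S, σ, hout, hfeas, hcost⟩ := hsol hg.1
      refine ⟨S, σ, hout, hfeas, hcost.trans (hg.2.trans ?_)⟩
      have hopt : 0 ≤ I.opt := by
        obtain ⟨S', σ', -, h⟩ := LBkSR.Inst.exists_opt hfe
        rw [← h]
        exact Finset.sum_nonneg fun i _ => LBkSR.Inst.radius_nonneg σ' i
      refine mul_le_mul_of_nonneg_right ?_ hopt
      push_cast
      linarith
    · intro ht
      simp only [LBkSR.natLe_eval, LBkSR.eD, LBkSR.var_eval, LBkSR.const_eval, hc.nD] at ht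
      have hD : IsEmpty (Fin I.nD) := by
        rw [show I.nD = 0 by omega]
        infer_instance
      -- Without clients the untouched zero memory already encodes the empty solution, of cost `0`.
      refine LBkSR.Ends.skip fun hfe => ⟨∅, fun j => isEmptyElim j, ?_, ?_, ?_⟩
      · refine ⟨fun i => ?_, fun j => isEmptyElim j⟩
        simp [LBkSR.input]
      · exact ⟨by simp, fun j => isEmptyElim j, by simp⟩
      · obtain ⟨S', σ', -, h⟩ := LBkSR.Inst.exists_opt hfe
        rw [← h, LBkSR.Inst.cost, Finset.sum_empty]
        exact mul_nonneg (by positivity)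
          (Finset.sum_nonneg fun i _ => LBkSR.Inst.radius_nonneg σ' i)
  obtain ⟨t, s, hr, ht, hs⟩ := key
  refine ⟨t, s, hr, ht.trans ?_, hs⟩
  rw [Nat.sub_add_cancel (le_max_left 2 I.n)]
  exact Nat.pow_le_pow_right (by omega) (by omega)
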